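/- **Notation.** Let $n\ge 1$, $n_*=n(n+1)/2$, and let $|\cdot|$ denote the Euclidean norm of vectors and the Frobenius norm of matrices. Put $$h_0=\sum_{1\le i\le j\le n}\nu_{ij}\otimes\nu_{ij},\qquad \nu_{ij}=\frac{e_i+e_j}{|e_i+e_j|},$$ where $e_1,\dots,e_n$ is the standard basis of $\mathbb R^n$. For an open set $W\subset\mathbb R^n$, $f\in C^k(\overline W)$ means that $f$ is $C^k$ in $W$ and that $f$ and its derivatives of order at most $k$ extend continuously to $\overline W$; $f$ is an immersion on $\overline W$ if $Df$ is injective at every point of $\overline W$. For $m\ge 0$ put $\|f\|_m=\sum_{j=0}^m\max_{|\beta|=j}\sup_W|\partial^\beta f|$; the norms are taken over the domain of the function in question (over $U$ in the hypotheses and over $V$ in the conclusions). **Proposition (Stage).** Let $\Omega\subset\mathbb R^n$ be open and bounded, let $g\in C^2(\overline\Omega,\mathrm{Sym}_n)$ be positive definite at every point of $\overline\Omega$, and let $J\in\mathbb N=\{0,1,2,\dots\}$. There are positive constants $\delta_*,r_*,c_*,C$, depending only on $n,J,g$, such that the following holds. Let $U\subset\Omega$ be an open, bounded, simply connected domain,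 and let $u\in C^2(\overline U,\mathbb R^{n+1})$ be an immersion on $\overline U$ such that $$\|g-Du^tDu-\delta h_0\|_0\le r\delta,\qquad \|u\|_2\le\delta^{1/2}\lambda$$ for some constants $r>0$, $0<\delta\le 1$ and $\lambda\ge\delta^{-1/2}$. If $r\le r_*$ and $\delta\le\delta_*$, then for every open simply connected $V\Subset U$ (i.e. $\overline V$ is compact and contained in $U$), every real $\hat\delta$ with $|\hat\delta|<\dfrac{r\delta}{|h_0|}$ and every $\Lambda\ge c_*$ there exists $v\in C^2(\overline V,\mathbb R^{n+1})$ that is an immersion on $\overline V$ and satisfies $$\|g-Dv^tDv-\hat\delta h_0\|_0\le C\delta\left(\Lambda^{-J}+\delta^{1/2}\right)+\lambda^{-2},$$ $$\|v-u\|_k\le C\delta^{1/2}\lambda^{k-1}\quad\text{for }k=0,1,$$ $$\|v\|_2\le C\delta^{1/2}\lambda\,\eta^{-1}\Lambda^{J(n_*-n)+n},$$ where $\eta=\min\{1,\operatorname{dist}(V,\partial U)\}$. -/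

import Mathlib

namespace NashKuiper

open scoped ENNReal

/-! Matrices carry the Euclidean (Frobenius) norm `|A| = (∑ i j, A i j ^ 2) ^ (1/2)`. -/

attribute [local instance] Matrix.frobeniusNormedAddCommGroup Matrix.frobeniusNormedSpace

/-- Euclidean space `ℝⁿ`. -/
abbrev E (n : ℕ) := EuclideanSpace ℝ (Fin n)

section
variable {n : ℕ} {F : Type*} [NormedAddCommGroup F] [NormedSpace ℝ F]

/-- The iterated partial derivative `∂_{i₁} ⋯ ∂_{iⱼ} f (x)`, for a list of directions `i`. On an
open set where `f` is of class `Cʲ` the order of the directions is irrelevant, so these are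
exactly the derivatives `∂^β f` with `|β| = j`. -/
noncomputable def partialDeriv {j : ℕ} (i : Fin j → Fin n) (f : E n → F) (x : E n) : F :=
  iteratedFDeriv ℝ j f x (fun k => EuclideanSpace.single (i k) (1 : ℝ))

/-- The norm `‖f‖_m = ∑_{j ≤ m} max_{|β| = j} sup_{x ∈ Ω} |∂^β f (x)|` on the open set `Ω`,
with values in `[0, ∞]`. -/
noncomputable def cNorm (m : ℕ) (Ω : Set (E n)) (f : E n → F) : ℝ≥0∞ :=
  ∑ j ∈ Finset.range (m + 1), ⨆ i : Fin j → Fin n, ⨆ x ∈ Ω, ‖partialDeriv i f x‖ₑ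

/-- `f ∈ Cᵏ(Ω̄)` for an open set `Ω`: `f` is of class `Cᵏ` in `Ω`, it is continuous on the closure
of `Ω`, and all its derivatives of order at most `k` extend continuously from `Ω` to the closure. -/
def CkClosure (k : ℕ) (f : E n → F) (Ω : Set (E n)) : Prop :=
  ContDiffOn ℝ k f Ω ∧ ContinuousOn f (closure Ω) ∧
    ∀ j ≤ k, ∃ G : E n → ContinuousMultilinearMap ℝ (fun _ : Fin j => E n) F,
      ContinuousOn G (closure Ω) ∧ Set.EqOn G (iteratedFDeriv ℝ j f) Ω

/-- `f ∈ C¹(Ω̄)` is an immersion on the closure of the open set `Ω`: the differential, extended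
continuously to the closure of `Ω`, is injective at every point of the closure. -/
def ImmersionOnClosure (f : E n → F) (Ω : Set (E n)) : Prop :=
  ∃ G : E n → E n →L[ℝ] F, ContinuousOn G (closure Ω) ∧ Set.EqOn G (fderiv ℝ f) Ω ∧
    ∀ x ∈ closure Ω, Function.Injective (G x)

end

/-- The Jacobian matrix `Du`, with entries `∂_b u_a`. -/
noncomputable def jacobian {n m : ℕ} (u : E n → E m) (x : E n) : Matrix (Fin m) (Fin n) ℝ :=
  Matrix.of fun a b => fderiv ℝ u x (EuclideanSpace.single b (1 : ℝ)) a

/-- The induced metric `Duᵗ Du`. -/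
noncomputable def inducedMetric {n m : ℕ} (u : E n → E m) (x : E n) : Matrix (Fin n) (Fin n) ℝ :=
  (jacobian u x).transpose * jacobian u x

/-- The unit vector `(e_i + e_j) / |e_i + e_j|`. -/
noncomputable def nu {n : ℕ} (i j : Fin n) : E n :=
  let w : E n := EuclideanSpace.single i (1 : ℝ) + EuclideanSpace.single j (1 : ℝ)
  ‖w‖⁻¹ • w

/-- The matrix `h₀ = ∑ ν ⊗ ν`, the sum being over the `n (n + 1) / 2` distinct vectors
`ν = (e_i + e_j) / |e_i + e_j|`, `i ≤ j`. -/
noncomputable def h0 (n : ℕ) : Matrix (Fin n) (Fin n) ℝ :=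
  ∑ p : Fin n × Fin n with p.1 ≤ p.2, Matrix.of fun a b => nu p.1 p.2 a * nu p.1 p.2 b

/-- `n_* = n (n + 1) / 2`, the dimension of the space of symmetric matrices. -/
def nStar (n : ℕ) : ℕ := n * (n + 1) / 2

/-- `dist(A, B) = inf {|a - b| : a ∈ A, b ∈ B}`. -/
noncomputable def setDist {n : ℕ} (A B : Set (E n)) : ℝ := sInf (Set.image2 dist A B)

end NashKuiper

open NashKuiper

attribute [local instance] Matrix.frobeniusNormedAddCommGroup Matrix.frobeniusNormedSpace

/-! Write s = √δ, mollify u at scale ℓ = c₀η/λ to u_ℓ, and look for v = u_ℓ + s W ζ + s² Q w, where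
ζ is a unit normal of u_ℓ and Q is the tangential frame dual to ∂u_ℓ. If W and w are O(ℓ) with
bounded gradients, the metric of v is that of u_ℓ plus s²(∂_aW ∂_bW − 2W B_ab + ∂_a w_b + ∂_b w_a) +
O(s³), where B is the second fundamental form divided by s (`metric_expansion`). It remains to solve
this system of von Kármán type, up to O(Λ⁻ᴶ), with right-hand side h = s⁻²(g_ℓ − Du_ℓᵗDu_ℓ − δ'h₀).
Replacing g by g_ℓ costs O(ℓ²), which is the term λ⁻². Mollifying u costs a quadratic commutator of
size a small multiple of s², so h stays close to h₀: its coefficients along the matrices ν_ij ⊗ ν_ij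
are at least 3/4 (`le_coeff_target`) and can serve as squares of amplitudes.

A corrugation of frequency μ and amplitude α on top of frequency μ' produces α² ν ⊗ ν, a mean error
μ⁻² ∂α ⊗ ∂α, and oscillating errors of size μ'/μ (`exists_corrugation`). Reaching Λ⁻ᴶ by frequency
gaps alone would cost Λᴶ for each of the n_* directions. The n directions ν_{0k} can be had for a
factor Λ each. Their component of index 0 does not vanish, so iterated integration by parts turns an
oscillating error into a symmetrised gradient, which w absorbs, plus a field whose row of index 0 is
zero, plus O(Λ⁻ᴶ) (`exists_decomposition`). The mean errors vary slowly and are compensated in the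
amplitudes by a fixed point iteration (`exists_amplitudes`). The fields with zero row have no
coefficient along ν_{0k} (`coeff_eq_zero`), hence disturb only the other n_* − n directions. Those
are corrugated last, with amplitudes that take these fields into account and a gap Λᴶ each
(`exists_second_family`, `exists_vonKarman`). The final frequency is ℓ⁻¹ Λ^(J(n_* − n) + n);
multiplied by s, it bounds the second derivatives.

For uniformity, estimates are proved for families over an index type with a filter: one constant,
valid eventually. The index type is finally the type of all admissible data, with the filter Λ → ∞,
δ → 0. The eventual statements then yield c_*, δ_* and C (`exists_thresholds`), while r_* is
explicit because r only has to keep the coefficients of h positive. -/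

namespace NashKuiper

open Filter Topology
open scoped ContDiff

/-- The partial derivative `∂_a f` of a scalar function. -/
noncomputable def pd {n : ℕ} (a : Fin n) (f : E n → ℝ) (x : E n) : ℝ :=
  fderiv ℝ f x (EuclideanSpace.single a (1 : ℝ))

/-! ### Calculus of scalar partial derivatives. -/

section pd

variable {n : ℕ} {f g : E n → ℝ} {x : E n} (a b : Fin n)

lemma pd_add (hf : DifferentiableAt ℝ f x) (hg : DifferentiableAt ℝ g x) :
    pd a (fun y => f y + g y) x = pd a f x + pd a g x := by
  simp [pd, fderiv_fun_add hf hg]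

lemma pd_sub (hf : DifferentiableAt ℝ f x) (hg : DifferentiableAt ℝ g x) :
    pd a (fun y => f y - g y) x = pd a f x - pd a g x := by
  simp [pd, fderiv_fun_sub hf hg]

lemma pd_mul (hf : DifferentiableAt ℝ f x) (hg : DifferentiableAt ℝ g x) :
    pd a (fun y => f y * g y) x = f x * pd a g x + pd a f x * g x := by
  simp [pd, fderiv_fun_mul hf hg]
  ring

lemma pd_const (c : ℝ) : pd a (fun _ : E n => c) x = 0 := by
  simp [pd]

lemma pd_const_mul (c : ℝ) (hf : DifferentiableAt ℝ f x) :
    pd a (fun y => c * f y) x = c * pd a f x := by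
  simp [pd, fderiv_const_mul hf]

lemma pd_sum {κ : Type*} (s : Finset κ) {f : κ → E n → ℝ}
    (hf : ∀ k ∈ s, DifferentiableAt ℝ (f k) x) :
    pd a (fun y => ∑ k ∈ s, f k y) x = ∑ k ∈ s, pd a (f k) x := by
  simp [pd, fderiv_fun_sum hf]

lemma pd_inv (hf : DifferentiableAt ℝ f x) (h0 : f x ≠ 0) :
    pd a (fun y => (f y)⁻¹) x = (-1) * (pd a f x * ((f x)⁻¹ * (f x)⁻¹)) := by
  have h := ((hasDerivAt_inv h0).comp_hasFDerivAt x hf.hasFDerivAt).fderiv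
  simp only [pd]
  rw [show (fun y => (f y)⁻¹) = Inv.inv ∘ f from rfl, h]
  simp only [smul_apply, smul_eq_mul]
  field_simp

lemma pd_sqrt (hf : DifferentiableAt ℝ f x) (h0 : f x ≠ 0) :
    pd a (fun y => Real.sqrt (f y)) x = 1 / 2 * (pd a f x * (Real.sqrt (f x))⁻¹) := by
  have h := (hf.hasFDerivAt.sqrt h0).fderiv
  simp only [pd]
  rw [h]
  simp only [smul_apply, smul_eq_mul]
  ring

lemma pd_congr {D : Set (E n)} (hD : IsOpen D) (h : Set.EqOn f g D) (hx : x ∈ D) :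
    pd a f x = pd a g x := by
  have : f =ᶠ[𝓝 x] g := Filter.eventuallyEq_of_mem (hD.mem_nhds hx) h
  simp [pd, this.fderiv_eq]

lemma pd_comm (hf : ContDiffAt ℝ 2 f x) : pd a (pd b f) x = pd b (pd a f) x := by
  have hs : IsSymmSndFDerivAt ℝ f x := hf.isSymmSndFDerivAt (by simp)
  have hd : DifferentiableAt ℝ (fderiv ℝ f) x :=
    (hf.fderiv_right (m := 1) (by norm_num)).differentiableAt (by norm_num)
  have key : ∀ c d : Fin n, pd c (pd d f) x =
      fderiv ℝ (fderiv ℝ f) x (EuclideanSpace.single c 1) (EuclideanSpace.single d 1) := by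
    intro c d
    have h := fderiv_clm_apply hd (differentiableAt_const (EuclideanSpace.single d (1 : ℝ)))
    change fderiv ℝ (fun y => fderiv ℝ f y (EuclideanSpace.single d (1 : ℝ))) x _ = _
    rw [h]
    simp
  rw [key, key, hs.eq]

lemma ContDiffOn.pd {D : Set (E n)} (hD : IsOpen D) {k m : WithTop ℕ∞} (hf : ContDiffOn ℝ k f D)
    (hm : m + 1 ≤ k) : ContDiffOn ℝ m (pd a f) D := by
  have := hf.fderiv_of_isOpen hD hm
  exact this.clm_apply contDiffOn_const

end pd

/-! ### Uniform symbol calculus: size, frequency, and products. -/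

/-- A family of open sets, together with a filter on the index set along which estimates are
required to hold. -/
structure Family (ι : Type*) (n : ℕ) where
  /-- The filter. -/
  l : Filter ι
  /-- The domains. -/
  D : ι → Set (E n)
  isOpen : ∀ i, IsOpen (D i)

variable {ι : Type*} {n : ℕ}

namespace Family

variable (F : Family ι n)

/-- Eventual smoothness on the domains. -/
def Smooth (f : ι → E n → ℝ) : Prop := ∀ᶠ i in F.l, ContDiffOn ℝ ∞ (f i) (F.D i)

/-- Eventual equality on the domains. -/
def Eq (f g : ι → E n → ℝ) : Prop := ∀ᶠ i in F.l, Set.EqOn (f i) (g i) (F.D i)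

/-- `f = O(σ)`, uniformly on the domains. -/
def IsO (σ : ι → ℝ) (f : ι → E n → ℝ) : Prop :=
  ∃ C, 0 ≤ C ∧ ∀ᶠ i in F.l, ∀ x ∈ F.D i, |f i x| ≤ C * σ i

/-- `∂^L f = O(σ μ^{|L|})` for all derivatives of order at most `N`. -/
def SymbolUpTo (μ : ι → ℝ) : ℕ → (ι → ℝ) → (ι → E n → ℝ) → Prop
  | 0, σ, f => F.IsO σ f
  | N + 1, σ, f => F.IsO σ f ∧ ∀ a, SymbolUpTo μ N (fun i => σ i * μ i) (fun i => pd a (f i))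

/-- `f` is smooth of size `σ` and oscillates at frequency at most `μ`:
`∂^L f = O(σ μ^{|L|})` for all `L`. -/
structure Symbol (μ σ : ι → ℝ) (f : ι → E n → ℝ) : Prop where
  smooth : F.Smooth f
  bound : ∀ N, F.SymbolUpTo μ N σ f

end Family

namespace Family

variable {F : Family ι n} {f g : ι → E n → ℝ} {σ τ μ : ι → ℝ}

lemma Eq.symm (h : F.Eq f g) : F.Eq g f := by
  filter_upwards [h] with i hi using hi.symm

lemma Eq.of_eq (h : ∀ i x, f i x = g i x) : F.Eq f g :=
  Eventually.of_forall fun i x _ => h i x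

lemma Eq.pd (h : F.Eq f g) (a : Fin n) : F.Eq (fun i => pd a (f i)) (fun i => pd a (g i)) := by
  filter_upwards [h] with i hi x hx using pd_congr a (F.isOpen i) hi hx

lemma Smooth.congr (hf : F.Smooth f) (h : F.Eq f g) : F.Smooth g := by
  filter_upwards [hf, h] with i hi h using hi.congr h.symm

lemma Smooth.differentiableAt (hf : F.Smooth f) :
    ∀ᶠ i in F.l, ∀ x ∈ F.D i, DifferentiableAt ℝ (f i) x := by
  filter_upwards [hf] with i hi x hx
  exact (hi.contDiffAt ((F.isOpen i).mem_nhds hx)).differentiableAt (by simp)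

lemma Smooth.pd (hf : F.Smooth f) (a : Fin n) : F.Smooth (fun i => pd a (f i)) := by
  filter_upwards [hf] with i hi using ContDiffOn.pd a (F.isOpen i) hi (by simp)

lemma Smooth.add (hf : F.Smooth f) (hg : F.Smooth g) : F.Smooth (fun i x => f i x + g i x) := by
  filter_upwards [hf, hg] with i h1 h2 using h1.add h2

lemma Smooth.mul (hf : F.Smooth f) (hg : F.Smooth g) : F.Smooth (fun i x => f i x * g i x) := by
  filter_upwards [hf, hg] with i h1 h2 using h1.mul h2

lemma Smooth.const (c : ι → ℝ) : F.Smooth (fun i _ => c i) :=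
  Eventually.of_forall fun _ => contDiffOn_const

lemma IsO.congr (hf : F.IsO σ f) (h : F.Eq f g) : F.IsO σ g := by
  obtain ⟨C, hC, hf⟩ := hf
  refine ⟨C, hC, ?_⟩
  filter_upwards [hf, h] with i hi h x hx
  rw [← h hx]; exact hi x hx

lemma IsO.add (hf : F.IsO σ f) (hg : F.IsO σ g) : F.IsO σ (fun i x => f i x + g i x) := by
  obtain ⟨C, hC, hf⟩ := hf
  obtain ⟨C', hC', hg⟩ := hg
  refine ⟨C + C', by positivity, ?_⟩
  filter_upwards [hf, hg] with i hi h x hx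
  calc _ ≤ |f i x| + |g i x| := abs_add_le _ _
    _ ≤ _ := by rw [add_mul]; exact add_le_add (hi x hx) (h x hx)

lemma IsO.mul (hf : F.IsO σ f) (hg : F.IsO τ g) :
    F.IsO (fun i => σ i * τ i) (fun i x => f i x * g i x) := by
  obtain ⟨C, hC, hf⟩ := hf
  obtain ⟨C', hC', hg⟩ := hg
  refine ⟨C * C', by positivity, ?_⟩
  filter_upwards [hf, hg] with i hi h x hx
  rw [abs_mul, show C * C' * (σ i * τ i) = (C * σ i) * (C' * τ i) by ring]
  exact mul_le_mul (hi x hx) (h x hx) (abs_nonneg _) ((abs_nonneg _).trans (hi x hx))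

lemma IsO.mono (hf : F.IsO σ f) (K : ℝ) (h : ∀ i, σ i ≤ K * τ i) (hK : 0 ≤ K := by positivity) :
    F.IsO τ f := by
  obtain ⟨C, hC, hf⟩ := hf
  refine ⟨C * K, by positivity, ?_⟩
  filter_upwards [hf] with i hi x hx
  rw [mul_assoc]
  exact (hi x hx).trans (mul_le_mul_of_nonneg_left (h i) hC)

lemma IsO.const_mul (hf : F.IsO σ f) (c : ℝ) : F.IsO σ (fun i x => c * f i x) := by
  obtain ⟨C, hC, hf⟩ := hf
  refine ⟨|c| * C, by positivity, ?_⟩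
  filter_upwards [hf] with i hi x hx
  rw [abs_mul, mul_assoc]
  exact mul_le_mul_of_nonneg_left (hi x hx) (abs_nonneg _)

lemma IsO.sum {κ : Type*} (s : Finset κ) {f : κ → ι → E n → ℝ}
    (hf : ∀ k ∈ s, F.IsO σ (f k)) : F.IsO σ (fun i x => ∑ k ∈ s, f k i x) := by
  classical
  induction s using Finset.induction_on with
  | empty => exact ⟨0, le_rfl, Eventually.of_forall fun i x _ => by simp⟩
  | insert a s ha ih =>
    simp only [Finset.sum_insert ha]
    exact (hf a (by simp)).add (ih fun k hk => hf k (by simp [hk]))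

lemma pd_add_eq (hf : F.Smooth f) (hg : F.Smooth g) (a : Fin n) :
    F.Eq (fun i => NashKuiper.pd a (fun x => f i x + g i x))
      (fun i x => NashKuiper.pd a (f i) x + NashKuiper.pd a (g i) x) := by
  filter_upwards [hf.differentiableAt, hg.differentiableAt] with i h1 h2 x hx
  exact pd_add a (h1 x hx) (h2 x hx)

lemma pd_mul_eq (hf : F.Smooth f) (hg : F.Smooth g) (a : Fin n) :
    F.Eq (fun i => NashKuiper.pd a (fun x => f i x * g i x))
      (fun i x => f i x * NashKuiper.pd a (g i) x + NashKuiper.pd a (f i) x * g i x) := by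
  filter_upwards [hf.differentiableAt, hg.differentiableAt] with i h1 h2 x hx
  exact pd_mul a (h1 x hx) (h2 x hx)

lemma SymbolUpTo.pred {N : ℕ} (hf : F.SymbolUpTo μ (N + 1) σ f) : F.SymbolUpTo μ N σ f := by
  induction N generalizing f σ with
  | zero => exact hf.1
  | succ N ih => exact ⟨hf.1, fun a => ih (hf.2 a)⟩

lemma SymbolUpTo.congr {N : ℕ} (hf : F.SymbolUpTo μ N σ f) (h : F.Eq f g) :
    F.SymbolUpTo μ N σ g := by
  induction N generalizing f g σ with
  | zero => exact IsO.congr hf h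
  | succ N ih => exact ⟨hf.1.congr h, fun a => ih (hf.2 a) (h.pd a)⟩

lemma SymbolUpTo.mono {N : ℕ} (hf : F.SymbolUpTo μ N σ f) (K : ℝ) (hK : 0 ≤ K)
    (h : ∀ i, σ i ≤ K * τ i) (hμ : ∀ i, 0 ≤ μ i) : F.SymbolUpTo μ N τ f := by
  induction N generalizing f σ τ with
  | zero => exact IsO.mono hf K h hK
  | succ N ih =>
    refine ⟨hf.1.mono K h hK, fun a => ih (hf.2 a) fun i => ?_⟩
    rw [← mul_assoc]
    exact mul_le_mul_of_nonneg_right (h i) (hμ i)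

lemma SymbolUpTo.freq_mono {N : ℕ} {μ' : ι → ℝ} (hf : F.SymbolUpTo μ N σ f) (K : ℝ) (hK : 0 ≤ K)
    (h : ∀ i, μ i ≤ K * μ' i) (hσ : ∀ i, 0 ≤ σ i) (hμ : ∀ i, 0 ≤ μ i) (hμ' : ∀ i, 0 ≤ μ' i) :
    F.SymbolUpTo μ' N σ f := by
  induction N generalizing f σ with
  | zero => exact hf
  | succ N ih =>
    refine ⟨hf.1, fun a => ih ((hf.2 a).mono K hK (fun i => ?_) hμ)
      (fun i => mul_nonneg (hσ i) (hμ' i))⟩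
    calc σ i * μ i ≤ σ i * (K * μ' i) := mul_le_mul_of_nonneg_left (h i) (hσ i)
      _ = _ := by ring

lemma SymbolUpTo.add {N : ℕ} (hf : F.SymbolUpTo μ N σ f) (hg : F.SymbolUpTo μ N σ g)
    (sf : F.Smooth f) (sg : F.Smooth g) : F.SymbolUpTo μ N σ (fun i x => f i x + g i x) := by
  induction N generalizing f g σ with
  | zero => exact IsO.add hf hg
  | succ N ih =>
    refine ⟨hf.1.add hg.1, fun a => ?_⟩
    exact (ih (hf.2 a) (hg.2 a) (sf.pd a) (sg.pd a)).congr (pd_add_eq sf sg a).symm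

lemma SymbolUpTo.mul {N : ℕ} (hf : F.SymbolUpTo μ N σ f) (hg : F.SymbolUpTo μ N τ g)
    (sf : F.Smooth f) (sg : F.Smooth g) :
    F.SymbolUpTo μ N (fun i => σ i * τ i) (fun i x => f i x * g i x) := by
  induction N generalizing f g σ τ with
  | zero => exact IsO.mul hf hg
  | succ N ih =>
    refine ⟨hf.1.mul hg.1, fun a => ?_⟩
    refine SymbolUpTo.congr ?_ (pd_mul_eq sf sg a).symm
    refine SymbolUpTo.add ?_ ?_ (sf.mul (sg.pd a)) ((sf.pd a).mul sg)
    · simpa only [mul_assoc] using ih hf.pred (hg.2 a) sf (sg.pd a)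
    · simpa only [mul_assoc, mul_comm, mul_left_comm] using ih (hf.2 a) hg.pred (sf.pd a) sg

namespace Symbol

lemma isO (hf : F.Symbol μ σ f) : F.IsO σ f := hf.bound 0

lemma congr (hf : F.Symbol μ σ f) (h : F.Eq f g) : F.Symbol μ σ g :=
  ⟨hf.smooth.congr h, fun N => (hf.bound N).congr h⟩

lemma mono (hf : F.Symbol μ σ f) (K : ℝ) (h : ∀ i, σ i ≤ K * τ i) (hμ : ∀ i, 0 ≤ μ i)
    (hK : 0 ≤ K := by positivity) : F.Symbol μ τ f :=
  ⟨hf.smooth, fun N => (hf.bound N).mono K hK h hμ⟩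

lemma freq_mono {μ' : ι → ℝ} (hf : F.Symbol μ σ f) (K : ℝ) (h : ∀ i, μ i ≤ K * μ' i)
    (hσ : ∀ i, 0 ≤ σ i) (hμ : ∀ i, 0 ≤ μ i) (hμ' : ∀ i, 0 ≤ μ' i)
    (hK : 0 ≤ K := by positivity) : F.Symbol μ' σ f :=
  ⟨hf.smooth, fun N => (hf.bound N).freq_mono K hK h hσ hμ hμ'⟩

lemma pd (hf : F.Symbol μ σ f) (a : Fin n) :
    F.Symbol μ (fun i => σ i * μ i) (fun i => pd a (f i)) :=
  ⟨hf.smooth.pd a, fun N => (hf.bound (N + 1)).2 a⟩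

lemma add (hf : F.Symbol μ σ f) (hg : F.Symbol μ σ g) : F.Symbol μ σ (fun i x => f i x + g i x) :=
  ⟨hf.smooth.add hg.smooth, fun N => (hf.bound N).add (hg.bound N) hf.smooth hg.smooth⟩

lemma mul (hf : F.Symbol μ σ f) (hg : F.Symbol μ τ g) :
    F.Symbol μ (fun i => σ i * τ i) (fun i x => f i x * g i x) :=
  ⟨hf.smooth.mul hg.smooth, fun N => (hf.bound N).mul (hg.bound N) hf.smooth hg.smooth⟩

lemma of_pd (hs : F.Smooth f) (h0 : F.IsO σ f)
    (h : ∀ a, F.Symbol μ (fun i => σ i * μ i) (fun i => NashKuiper.pd a (f i))) :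
    F.Symbol μ σ f := by
  refine ⟨hs, fun N => ?_⟩
  cases N with
  | zero => exact h0
  | succ N => exact ⟨h0, fun a => (h a).bound N⟩

lemma zero : F.Symbol μ σ (fun _ _ => 0) := by
  refine ⟨Smooth.const _, fun N => ?_⟩
  have hO : ∀ τ, F.IsO τ (fun _ _ => 0) := fun τ =>
    ⟨0, le_rfl, Eventually.of_forall fun i x _ => by simp⟩
  induction N generalizing σ with
  | zero => exact hO σ
  | succ N ih =>
    exact ⟨hO σ, fun a => ih.congr (Eq.of_eq fun i x => (pd_const a 0).symm)⟩

/-- A family of constants. -/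
lemma const (c : ι → ℝ) (K : ℝ) (h : ∀ i, |c i| ≤ K * σ i) (hK : 0 ≤ K := by positivity) :
    F.Symbol μ σ (fun i _ => c i) :=
  of_pd (Smooth.const _) ⟨K, hK, Eventually.of_forall fun i _ _ => h i⟩ fun a =>
    zero.congr (Eq.of_eq fun i x => (pd_const a (c i)).symm)

lemma smul (hf : F.Symbol μ σ f) (c : ι → ℝ) :
    F.Symbol μ (fun i => |c i| * σ i) (fun i x => c i * f i x) :=
  (const (σ := fun i => |c i|) c 1 (by simp)).mul hf

lemma const_mul (hf : F.Symbol μ σ f) (c : ℝ) : F.Symbol μ σ (fun i x => c * f i x) := by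
  have := (const (F := F) (μ := μ) (σ := fun _ => 1) (fun _ => c) |c| (by simp)).mul hf
  simpa using this

lemma neg (hf : F.Symbol μ σ f) : F.Symbol μ σ (fun i x => - f i x) := by
  simpa using hf.const_mul (-1)

lemma sub (hf : F.Symbol μ σ f) (hg : F.Symbol μ σ g) :
    F.Symbol μ σ (fun i x => f i x - g i x) := by
  simpa only [sub_eq_add_neg] using hf.add hg.neg

lemma sum {κ : Type*} (s : Finset κ) {f : κ → ι → E n → ℝ} (hf : ∀ k ∈ s, F.Symbol μ σ (f k)) :
    F.Symbol μ σ (fun i x => ∑ k ∈ s, f k i x) := by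
  classical
  induction s using Finset.induction_on with
  | empty => simpa using zero
  | insert a s ha ih =>
    simp only [Finset.sum_insert ha]
    exact (hf a (by simp)).add (ih fun k hk => hf k (by simp [hk]))

lemma mul_one' (hf : F.Symbol μ σ f) (hg : F.Symbol μ (fun _ => 1) g) :
    F.Symbol μ σ (fun i x => f i x * g i x) := by
  simpa using hf.mul hg

lemma one_mul' (hf : F.Symbol μ (fun _ => 1) f) (hg : F.Symbol μ σ g) :
    F.Symbol μ σ (fun i x => f i x * g i x) := by
  simpa using hf.mul hg

/-- The identity ∂(1/f) = −∂f · f⁻² expresses order N + 1 of 1/f through order N of 1/f itself, so a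
single induction closes once f is bounded below. -/
lemma inv (hf : F.Symbol μ (fun _ => 1) f) {c : ℝ} (hc : 0 < c)
    (h : ∀ᶠ i in F.l, ∀ x ∈ F.D i, c ≤ f i x) :
    F.Symbol μ (fun _ => 1) (fun i x => (f i x)⁻¹) := by
  have sm : F.Smooth (fun i x => (f i x)⁻¹) := by
    filter_upwards [hf.smooth, h] with i h1 h2
    exact h1.inv fun x hx => (hc.trans_le (h2 x hx)).ne'
  have hO : F.IsO (fun _ => 1) (fun i x => (f i x)⁻¹) := by
    refine ⟨c⁻¹, by positivity, ?_⟩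
    filter_upwards [h] with i h2 x hx
    rw [mul_one, abs_inv, abs_of_pos (hc.trans_le (h2 x hx))]
    exact inv_anti₀ hc (h2 x hx)
  refine ⟨sm, fun N => ?_⟩
  induction N with
  | zero => exact hO
  | succ N ih =>
    refine ⟨hO, fun a => ?_⟩
    have h2 := ((hf.pd a).bound N).mul (ih.mul ih sm sm) (hf.smooth.pd a) (sm.mul sm)
    have h3 := ((const (F := F) (μ := μ) (σ := fun _ => 1) (fun _ => -1) 1 (by simp)).bound N).mul h2
      (Smooth.const _) ((hf.smooth.pd a).mul (sm.mul sm))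
    simp only [one_mul, mul_one] at h3 ⊢
    refine h3.congr ?_
    filter_upwards [hf.smooth.differentiableAt, h] with i h4 h5 x hx
    exact (pd_inv a (h4 x hx) (hc.trans_le (h5 x hx)).ne').symm

/-- As for the inverse, but ∂√f = ½ ∂f · √f · f⁻¹ is written with √f as a factor, so that the
induction hypothesis applies to it. The lower bound on f keeps amplitudes away from the singularity
of the square root. -/
lemma sqrt (hf : F.Symbol μ (fun _ => 1) f) {c : ℝ} (hc : 0 < c)
    (h : ∀ᶠ i in F.l, ∀ x ∈ F.D i, c ≤ f i x) :
    F.Symbol μ (fun _ => 1) (fun i x => Real.sqrt (f i x)) := by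
  have sm : F.Smooth (fun i x => Real.sqrt (f i x)) := by
    filter_upwards [hf.smooth, h] with i h1 h2
    exact h1.sqrt fun x hx => (hc.trans_le (h2 x hx)).ne'
  have hinv := hf.inv hc h
  have hO : F.IsO (fun _ => 1) (fun i x => Real.sqrt (f i x)) := by
    obtain ⟨C, hC, hb⟩ := hf.isO
    refine ⟨Real.sqrt C, by positivity, ?_⟩
    filter_upwards [hb] with i h2 x hx
    rw [mul_one, abs_of_nonneg (Real.sqrt_nonneg _)]
    exact Real.sqrt_le_sqrt ((le_abs_self _).trans (by simpa using h2 x hx))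
  refine ⟨sm, fun N => ?_⟩
  induction N with
  | zero => exact hO
  | succ N ih =>
    refine ⟨hO, fun a => ?_⟩
    have h2 := ((hf.pd a).bound N).mul (ih.mul (hinv.bound N) sm hinv.smooth)
      (hf.smooth.pd a) (sm.mul hinv.smooth)
    have h3 := ((const (F := F) (μ := μ) (σ := fun _ => 1) (fun _ => 1 / 2) 1
      (by intro i; norm_num)).bound N).mul h2
      (Smooth.const _) ((hf.smooth.pd a).mul (sm.mul hinv.smooth))
    simp only [one_mul, mul_one] at h3 ⊢
    refine h3.congr ?_
    filter_upwards [hf.smooth.differentiableAt, h] with i h4 h5 x hx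
    have hp := hc.trans_le (h5 x hx)
    rw [pd_sqrt a (h4 x hx) hp.ne']
    have h6 := Real.mul_self_sqrt hp.le
    have h7 : 0 < Real.sqrt (f i x) := Real.sqrt_pos.2 hp
    have : Real.sqrt (f i x) * (f i x)⁻¹ = (Real.sqrt (f i x))⁻¹ := by
      rw [eq_comm, inv_eq_iff_eq_inv, mul_inv, inv_inv]
      field_simp
      nlinarith
    simp only [this]

end Symbol

/-- `f = O(ρ)` and `∂ f` is a symbol of size `σ` and frequency `μ`. -/
structure Pot (F : Family ι n) (ρ μ σ : ι → ℝ) (f : ι → E n → ℝ) : Prop where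
  smooth : F.Smooth f
  isO : F.IsO ρ f
  pd : ∀ a, F.Symbol μ σ (fun i => NashKuiper.pd a (f i))

namespace Pot

variable {ρ ρ' : ι → ℝ}

lemma of_symbol (hf : F.Symbol μ σ f) : F.Pot σ μ (fun i => σ i * μ i) f :=
  ⟨hf.smooth, hf.isO, hf.pd⟩

lemma symbol (hf : F.Pot ρ μ σ f) (K : ℝ) (h : ∀ i, σ i ≤ K * (ρ i * μ i)) (hμ : ∀ i, 0 ≤ μ i)
    (hK : 0 ≤ K := by positivity) : F.Symbol μ ρ f :=
  Symbol.of_pd hf.smooth hf.isO fun a => (hf.pd a).mono K h hμ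

lemma mono (hf : F.Pot ρ μ σ f) (K : ℝ) (h : ∀ i, ρ i ≤ K * ρ' i) (h' : ∀ i, σ i ≤ K * τ i)
    (hμ : ∀ i, 0 ≤ μ i) (hK : 0 ≤ K := by positivity) : F.Pot ρ' μ τ f :=
  ⟨hf.smooth, hf.isO.mono K h, fun a => (hf.pd a).mono K h' hμ⟩

lemma freq_mono {μ' : ι → ℝ} (hf : F.Pot ρ μ σ f) (K : ℝ) (h : ∀ i, μ i ≤ K * μ' i)
    (hσ : ∀ i, 0 ≤ σ i) (hμ : ∀ i, 0 ≤ μ i) (hμ' : ∀ i, 0 ≤ μ' i)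
    (hK : 0 ≤ K := by positivity) : F.Pot ρ μ' σ f :=
  ⟨hf.smooth, hf.isO, fun a => (hf.pd a).freq_mono K h hσ hμ hμ'⟩

lemma add (hf : F.Pot ρ μ σ f) (hg : F.Pot ρ μ σ g) : F.Pot ρ μ σ (fun i x => f i x + g i x) :=
  ⟨hf.smooth.add hg.smooth, hf.isO.add hg.isO, fun a =>
    ((hf.pd a).add (hg.pd a)).congr (pd_add_eq hf.smooth hg.smooth a).symm⟩

lemma zero : F.Pot ρ μ σ (fun _ _ => 0) :=
  ⟨Symbol.zero.smooth (μ := μ) (σ := σ), Symbol.zero.isO (μ := μ), fun a =>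
    Symbol.zero.congr (Eq.of_eq fun i x => (pd_const a 0).symm)⟩

lemma sum {κ : Type*} (s : Finset κ) {f : κ → ι → E n → ℝ} (hf : ∀ k ∈ s, F.Pot ρ μ σ (f k)) :
    F.Pot ρ μ σ (fun i x => ∑ k ∈ s, f k i x) := by
  classical
  induction s using Finset.induction_on with
  | empty => simpa using zero
  | insert a s ha ih =>
    simp only [Finset.sum_insert ha]
    exact (hf a (by simp)).add (ih fun k hk => hf k (by simp [hk]))

/-- A sum of waves of several frequencies is as large as its slowest wave, while its high
derivatives are governed by the fastest one; this is why the bound on f and the bound on ∂f are kept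
apart. The conditions `h1` and `h2` make each factor a symbol of its own size, as needed when it
multiplies the gradient of the other. -/
lemma mul {ρ'' τ' : ι → ℝ} (hf : F.Pot ρ μ σ f) (hg : F.Pot ρ' μ τ g) (K : ℝ)
    (hμ : ∀ i, 0 ≤ μ i)
    (h1 : ∀ i, σ i ≤ K * (ρ i * μ i)) (h2 : ∀ i, τ i ≤ K * (ρ' i * μ i))
    (h3 : ∀ i, ρ i * ρ' i ≤ K * ρ'' i) (h4 : ∀ i, ρ i * τ i ≤ K * τ' i)
    (h5 : ∀ i, σ i * ρ' i ≤ K * τ' i) (hK : 0 ≤ K := by positivity) :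
    F.Pot ρ'' μ τ' (fun i x => f i x * g i x) :=
  ⟨hf.smooth.mul hg.smooth, (hf.isO.mul hg.isO).mono K h3, fun a =>
    ((((hf.symbol K h1 hμ).mul (hg.pd a)).mono K h4 hμ).add
      (((hf.pd a).mul (hg.symbol K h2 hμ)).mono K h5 hμ)).congr
      (pd_mul_eq hf.smooth hg.smooth a).symm⟩

end Pot

end Family

end NashKuiper

/-! ### Plane waves, integration by parts, and a single corrugation. -/

namespace NashKuiper

open Filter Topology
open scoped ContDiff

variable {ι : Type*} {n : ℕ}

/-- The plane wave `sin (μ ν·x + φ)`. -/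
noncomputable def osc (ν : Fin n → ℝ) (μ : ι → ℝ) (φ : ℝ) (i : ι) (x : E n) : ℝ :=
  Real.sin (μ i * ∑ a, ν a * x a + φ)

lemma contDiff_osc (ν : Fin n → ℝ) (μ : ι → ℝ) (φ : ℝ) (i : ι) : ContDiff ℝ ∞ (osc ν μ φ i) := by
  unfold osc
  fun_prop

lemma pd_osc (ν : Fin n → ℝ) (μ : ι → ℝ) (φ : ℝ) (i : ι) (x : E n) (a : Fin n) :
    pd a (osc ν μ φ i) x = μ i * ν a * osc ν μ (φ + Real.pi / 2) i x := by
  have h1 : HasFDerivAt (fun x : E n => μ i * ∑ a, ν a * x a + φ)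
      (μ i • ∑ b, ν b • (EuclideanSpace.proj b : E n →L[ℝ] ℝ)) x := by
    refine ((HasFDerivAt.fun_sum fun b _ => ?_).const_mul (μ i)).add_const φ
    exact (EuclideanSpace.proj b : E n →L[ℝ] ℝ).hasFDerivAt.const_mul (ν b)
  have h2 := h1.sin.fderiv
  simp only [pd]
  rw [show osc ν μ φ i = fun x => Real.sin (μ i * ∑ a, ν a * x a + φ) from rfl, h2]
  simp only [osc, smul_apply, smul_eq_mul, sum_apply]
  rw [← add_assoc, Real.sin_add_pi_div_two]
  simp
  ring

namespace Family

variable {F : Family ι n} {σ μ : ι → ℝ}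

/-- Differentiation gives back a wave of the same frequency with phase advanced by π/2, so the
induction runs over all phases at once. -/
lemma Symbol.osc (ν : Fin n → ℝ) (φ : ℝ) (hμ : ∀ i, 0 ≤ μ i) :
    F.Symbol μ (fun _ => 1) (osc ν μ φ) := by
  have sm : ∀ φ, F.Smooth (NashKuiper.osc ν μ φ) := fun φ =>
    Eventually.of_forall fun i => (contDiff_osc ν μ φ i).contDiffOn
  have hO : ∀ φ, F.IsO (fun _ => 1) (NashKuiper.osc ν μ φ) := fun φ =>
    ⟨1, zero_le_one, Eventually.of_forall fun i x _ => by
      simpa [NashKuiper.osc] using Real.abs_sin_le_one _⟩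
  refine ⟨sm φ, fun N => ?_⟩
  induction N generalizing φ with
  | zero => exact hO φ
  | succ N ih =>
    refine ⟨hO φ, fun a => ?_⟩
    have h0 : F.Symbol μ μ (fun i _ => μ i * ν a) :=
      Symbol.const _ |ν a| fun i => by rw [abs_mul, abs_of_nonneg (hμ i), mul_comm]
    have h := (h0.bound N).mul (ih (φ + Real.pi / 2)) h0.smooth (sm _)
    simp only [mul_one, one_mul] at h ⊢
    exact h.congr (Eq.of_eq fun i x => (pd_osc _ _ _ _ _ _).symm)

end Family

/-- One step of integration by parts: `osc · (ν ⊙ β)` is a symmetrised gradient up to a term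
gaining a factor `1 / μ`. -/
lemma osc_mul_eq_pd (ν : Fin n → ℝ) (μ : ι → ℝ) (φ : ℝ) (i : ι) (hμ : μ i ≠ 0) {β : E n → ℝ}
    {x : E n} (hβ : DifferentiableAt ℝ β x) (a : Fin n) :
    pd a (fun x => (μ i)⁻¹ * (osc ν μ (φ - Real.pi / 2) i x * β x)) x =
      osc ν μ φ i x * (ν a * β x) + (μ i)⁻¹ * (osc ν μ (φ - Real.pi / 2) i x * pd a β x) := by
  have ho : DifferentiableAt ℝ (osc ν μ (φ - Real.pi / 2) i) x :=
    (contDiff_osc ν μ _ i).differentiable (by simp) x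
  rw [pd_const_mul _ _ (ho.fun_mul hβ), pd_mul _ ho hβ, pd_osc, sub_add_cancel]
  field_simp
  ring

namespace Family

variable {F : Family ι n} {σ μ μ' : ι → ℝ}

/-- Iterated integration by parts: an oscillating symmetric matrix field is a symmetrised
gradient, plus a field without components in the direction `i₀`, plus a small error. -/
lemma exists_decomposition (hμ' : ∀ i, 0 < μ' i) (hle : ∀ i, μ' i ≤ μ i) {ν : Fin n → ℝ}
    {i₀ : Fin n} (hν : ν i₀ ≠ 0) (N : ℕ) (φ : ℝ) (σ : ι → ℝ) (hσ : ∀ i, 0 ≤ σ i)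
    (A : Fin n → Fin n → ι → E n → ℝ) (hA : ∀ a b, F.Symbol μ' σ (A a b))
    (hsym : ∀ a b i x, A a b i x = A b a i x) :
    ∃ (w : Fin n → ι → E n → ℝ) (R Er : Fin n → Fin n → ι → E n → ℝ),
      (∀ b, F.Symbol μ (fun i => σ i * (μ i)⁻¹) (w b)) ∧
      (∀ a b, F.Symbol μ σ (R a b)) ∧ (∀ a b i x, R a b i x = R b a i x) ∧
      (∀ b i x, R i₀ b i x = 0) ∧
      (∀ a b, F.IsO (fun i => σ i * (μ' i / μ i) ^ N) (Er a b)) ∧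
      ∀ a b, F.Eq (fun i x => osc ν μ φ i x * A a b i x)
        (fun i x => pd a (w b i) x + pd b (w a i) x + R a b i x + Er a b i x) := by
  have hμ : ∀ i, 0 < μ i := fun i => (hμ' i).trans_le (hle i)
  have hμ0 : ∀ i, 0 ≤ μ i := fun i => (hμ i).le
  have hup : ∀ {τ : ι → ℝ} {f : ι → E n → ℝ}, (∀ i, 0 ≤ τ i) → F.Symbol μ' τ f → F.Symbol μ τ f :=
    fun h0 h => h.freq_mono 1 (by simpa using hle) h0 (fun i => (hμ' i).le) hμ0
  induction N generalizing φ σ A with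
  | zero =>
    refine ⟨fun _ _ _ => 0, fun _ _ _ _ => 0, fun a b i x => osc ν μ φ i x * A a b i x,
      fun _ => Symbol.zero, fun _ _ => Symbol.zero, by simp, by simp, fun a b => ?_, fun a b => ?_⟩
    · simpa using ((Symbol.osc ν φ hμ0).one_mul' (hup hσ (hA a b))).isO
    · refine Eq.of_eq fun i x => ?_
      simp [pd_const]
  | succ N ih =>
    -- `β` solves ν_{i₀} β_b + ν_b β_{i₀} = A_{i₀ b}; this is where ν_{i₀} ≠ 0 is used. Hence A − (ν
    -- ⊗ β + β ⊗ ν), called `R0` below, has vanishing row `i₀`.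
    set β : Fin n → ι → E n → ℝ := fun b i x =>
      (ν i₀)⁻¹ * A i₀ b i x + (-(ν b / (2 * ν i₀ ^ 2))) * A i₀ i₀ i x with hβdef
    have hβ : ∀ b, F.Symbol μ' σ (β b) := fun b =>
      ((hA i₀ b).const_mul _).add ((hA i₀ i₀).const_mul _)
    -- One integration by parts of the ν ⊗ β + β ⊗ ν part leaves a wave shifted by −π/2 times `A'`.
    -- It is again symmetric, slow, and smaller by μ'/μ, so the induction hypothesis applies to it.
    set A' : Fin n → Fin n → ι → E n → ℝ := fun a b i x =>
      (-(μ i)⁻¹) * (pd a (β b i) x + pd b (β a i) x) with hA'def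
    have hA' : ∀ a b, F.Symbol μ' (fun i => σ i * (μ' i / μ i)) (A' a b) := fun a b =>
      ((((hβ b).pd a).add ((hβ a).pd b)).smul fun i => -(μ i)⁻¹).mono 1
        (fun i => le_of_eq <| by
          rw [abs_neg, abs_inv, abs_of_pos (hμ i)]; field_simp) (fun i => (hμ' i).le)
    have hr : ∀ i, 0 ≤ μ' i / μ i := fun i => div_nonneg (hμ' i).le (hμ0 i)
    have hr1 : ∀ i, μ' i / μ i ≤ 1 := fun i => (div_le_one (hμ i)).2 (hle i)
    have hσ' : ∀ i, 0 ≤ σ i * (μ' i / μ i) := fun i => mul_nonneg (hσ i) (hr i)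
    have hσσ : ∀ i, σ i * (μ' i / μ i) ≤ σ i := fun i => mul_le_of_le_one_right (hσ i) (hr1 i)
    obtain ⟨w, R, Er, hw, hR, hRs, hR0, hE, heq⟩ :=
      ih (φ - Real.pi / 2) (fun i => σ i * (μ' i / μ i)) hσ' A' hA' (fun a b i x => by
        simp only [hA'def]; ring)
    set R0 : Fin n → Fin n → ι → E n → ℝ := fun a b i x =>
      A a b i x - (ν a * β b i x + ν b * β a i x) with hR0def
    have hR0s : ∀ a b, F.Symbol μ' σ (R0 a b) := fun a b =>
      (hA a b).sub (((hβ b).const_mul _).add ((hβ a).const_mul _))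
    have hw0 : ∀ b, F.Symbol μ (fun i => σ i * (μ i)⁻¹)
        (fun i x => (μ i)⁻¹ * (osc ν μ (φ - Real.pi / 2) i x * β b i x)) := fun b =>
      (((Symbol.osc ν _ hμ0).one_mul' (hup hσ (hβ b))).smul fun i => (μ i)⁻¹).mono 1
        (fun i => le_of_eq <| by rw [abs_inv, abs_of_pos (hμ i)]; ring) hμ0
    have hw1 : ∀ b, F.Symbol μ (fun i => σ i * (μ i)⁻¹) (w b) := fun b =>
      (hw b).mono 1 (fun i => by
        rw [one_mul]; exact mul_le_mul_of_nonneg_right (hσσ i) (inv_nonneg.2 (hμ0 i))) hμ0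
    refine ⟨fun b i x => (μ i)⁻¹ * (osc ν μ (φ - Real.pi / 2) i x * β b i x) + w b i x,
      fun a b i x => osc ν μ φ i x * R0 a b i x + R a b i x, Er, fun b => (hw0 b).add (hw1 b),
      fun a b => ((Symbol.osc ν φ hμ0).one_mul' (hup hσ (hR0s a b))).add
        ((hR a b).mono 1 (by simpa using hσσ) hμ0), fun a b i x => ?_, fun b i x => ?_,
      fun a b => (hE a b).mono 1 fun i => le_of_eq (by rw [pow_succ']; ring), fun a b => ?_⟩
    · simp only [hR0def]
      rw [hRs a b i x, hsym a b i x]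
      ring
    · simp only [hR0def, hβdef]
      rw [hR0 b i x]
      field_simp
      ring
    · filter_upwards [heq a b, (hw a).smooth.differentiableAt, (hw b).smooth.differentiableAt,
        (hw0 a).smooth.differentiableAt, (hw0 b).smooth.differentiableAt,
        (hβ a).smooth.differentiableAt, (hβ b).smooth.differentiableAt]
        with i h1 ha hb ha0 hb0 hβa hβb x hx
      have h1 := h1 hx
      simp only at h1 ⊢
      rw [pd_add a (hb0 x hx) (hb x hx), pd_add b (ha0 x hx) (ha x hx),
        osc_mul_eq_pd ν μ φ i (hμ i).ne' (hβb x hx), osc_mul_eq_pd ν μ φ i (hμ i).ne' (hβa x hx)]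
      simp only [hA'def] at h1
      simp only [hR0def]
      linear_combination h1

end Family

/-- The quadratic operator `∂_a W ∂_b W - 2 W B_{ab} + ∂_a w_b + ∂_b w_a`. -/
noncomputable def vonKarman (W : ι → E n → ℝ) (w : Fin n → ι → E n → ℝ)
    (B : Fin n → Fin n → ι → E n → ℝ) (a b : Fin n) (i : ι) (x : E n) : ℝ :=
  pd a (W i) x * pd b (W i) x - 2 * W i x * B a b i x + pd a (w b i) x + pd b (w a i) x

namespace Family

variable {F : Family ι n} {μ₀ μ μ' : ι → ℝ}

/-- Adding a corrugation of frequency `μ` in direction `ν`: it produces the metric term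
`α² ν ⊗ ν`, a non-oscillating term and three oscillating errors of size `μ' / μ`. -/
lemma exists_corrugation (hμ₀ : ∀ i, 0 < μ₀ i) (hle0 : ∀ i, μ₀ i ≤ μ' i) (hle : ∀ i, μ' i ≤ μ i)
    (ν : Fin n → ℝ) {α : ι → E n → ℝ} (hα : F.Symbol μ' (fun _ => 1) α)
    {W : ι → E n → ℝ} {w : Fin n → ι → E n → ℝ} {B : Fin n → Fin n → ι → E n → ℝ}
    (hW : F.Pot (fun i => (μ₀ i)⁻¹) μ' (fun _ => 1) W) (hw : ∀ b, F.Smooth (w b))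
    (hB : ∀ a b, F.Symbol μ' μ' (B a b)) (hBs : ∀ a b i x, B a b i x = B b a i x) :
    ∃ (W₁ : ι → E n → ℝ) (w₁ : Fin n → ι → E n → ℝ) (X Y Z : Fin n → Fin n → ι → E n → ℝ),
      F.Pot (fun i => (μ₀ i)⁻¹) μ (fun _ => 1) W₁ ∧
      (∀ b, F.Pot (fun i => (μ₀ i)⁻¹) μ (fun _ => 1) (w₁ b)) ∧
      (∀ a b, F.Symbol μ' (fun i => μ' i / μ i) (X a b)) ∧
      (∀ a b, F.Symbol μ' (fun i => μ' i / μ i) (Y a b)) ∧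
      (∀ a b, F.Symbol μ' (fun i => μ' i / μ i) (Z a b)) ∧
      (∀ a b i x, X a b i x = X b a i x) ∧ (∀ a b i x, Y a b i x = Y b a i x) ∧
      (∀ a b i x, Z a b i x = Z b a i x) ∧
      ∀ a b, F.Eq (vonKarman (fun i x => W i x + W₁ i x) (fun b i x => w b i x + w₁ b i x) B a b)
        (fun i x => vonKarman W w B a b i x + α i x ^ 2 * (ν a * ν b) +
          (μ i)⁻¹ ^ 2 * (pd a (α i) x * pd b (α i) x) +
          (osc ν (fun i => 2 * μ i) 0 i x * X a b i x +
          osc ν (fun i => 2 * μ i) (Real.pi / 2) i x * Y a b i x +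
          osc ν μ 0 i x * Z a b i x)) := by
  have hμ' : ∀ i, 0 < μ' i := fun i => (hμ₀ i).trans_le (hle0 i)
  have hμ : ∀ i, 0 < μ i := fun i => (hμ' i).trans_le (hle i)
  have hμ'0 : ∀ i, 0 ≤ μ' i := fun i => (hμ' i).le
  have hμ0 : ∀ i, 0 ≤ μ i := fun i => (hμ i).le
  have hinv : ∀ i, (μ i)⁻¹ ≤ (μ₀ i)⁻¹ := fun i => inv_anti₀ (hμ₀ i) ((hle0 i).trans (hle i))
  have hup : ∀ {τ : ι → ℝ} {f : ι → E n → ℝ}, (∀ i, 0 ≤ τ i) → F.Symbol μ' τ f → F.Symbol μ τ f :=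
    fun h0 h => h.freq_mono 1 (by simpa using hle) h0 hμ'0 hμ0
  have habs : ∀ i, |(μ i)⁻¹| = (μ i)⁻¹ := fun i => abs_of_pos (inv_pos.2 (hμ i))
  have hosc2 : ∀ φ, F.Symbol μ (fun _ => 1) (osc ν (fun i => 2 * μ i) φ) := fun φ =>
    (Symbol.osc ν φ fun i => by linarith [hμ0 i]).freq_mono 2 (fun i => le_rfl)
      (fun _ => zero_le_one) (fun i => by linarith [hμ0 i]) hμ0
  have hα1 := hup (fun _ => zero_le_one) hα
  have hdα : ∀ a, F.Symbol μ' μ' (fun i => pd a (α i)) := fun a => by simpa using hα.pd a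
  have hddW : ∀ a b, F.Symbol μ' μ' (fun i => pd a (pd b (W i))) := fun a b => by
    simpa using (hW.pd b).pd a
  -- The factor √2 is chosen because 2cos² has mean 1, so that ∂W₁ ⊗ ∂W₁ has leading mean part α² ν
  -- ⊗ ν.
  have hW₁ : F.Symbol μ (fun i => (μ i)⁻¹)
      (fun i x => Real.sqrt 2 * ((μ i)⁻¹ * (α i x * osc ν μ 0 i x))) :=
    ((((hα1.one_mul' (Symbol.osc ν 0 hμ0)).smul fun i => (μ i)⁻¹).mono 1 (fun i => by
      simp [abs_of_pos (hμ i)]) hμ0).const_mul (Real.sqrt 2))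
  set W₁ : ι → E n → ℝ := fun i x => Real.sqrt 2 * ((μ i)⁻¹ * (α i x * osc ν μ 0 i x)) with hW₁def
  -- The part −W₁ ∂W cancels the cross terms of ∂W₁ with ∂W, leaving only −2W₁ ∂∂W. The part with
  -- −ν/4 cancels the oscillation α² cos(2μν·x) ν ⊗ ν coming from 2cos².
  have hw₁ : ∀ b, F.Symbol μ (fun i => (μ i)⁻¹) (fun i x => (-1) * (W₁ i x * pd b (W i) x) +
      (-(ν b / 4)) * ((μ i)⁻¹ * (osc ν (fun i => 2 * μ i) 0 i x * (α i x * α i x)))) := fun b =>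
    ((hW₁.mul_one' (hup (fun _ => zero_le_one) (hW.pd b))).const_mul _).add
      ((((hosc2 0).mul_one' (hα1.mul_one' hα1)).smul fun i => (μ i)⁻¹).mono 1 (fun i => by
        simp [abs_of_pos (hμ i)]) hμ0 |>.const_mul _)
  have toPot : ∀ {f : ι → E n → ℝ}, F.Symbol μ (fun i => (μ i)⁻¹) f →
      F.Pot (fun i => (μ₀ i)⁻¹) μ (fun _ => 1) f := fun hf =>
    (Pot.of_symbol hf).mono 1 (by simpa using hinv)
      (fun i => by rw [inv_mul_cancel₀ (hμ i).ne']; simp) hμ0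
  -- The amplitudes belong to sin 2μν·x, cos 2μν·x and sin μν·x in turn. The last one is symmetrised
  -- by hand so that its symmetry holds everywhere and not only where second derivatives are known
  -- to commute.
  refine ⟨W₁, fun b i x => (-1) * (W₁ i x * pd b (W i) x) +
      (-(ν b / 4)) * ((μ i)⁻¹ * (osc ν (fun i => 2 * μ i) 0 i x * (α i x * α i x))),
    fun a b i x => (μ i)⁻¹ * (1 / 2 * (α i x * (ν a * pd b (α i) x + ν b * pd a (α i) x))),
    fun a b i x => (-1) * (((μ i)⁻¹ * pd a (α i) x) * ((μ i)⁻¹ * pd b (α i) x)),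
    fun a b i x => (μ i)⁻¹ * (-(2 * Real.sqrt 2) * (α i x *
      (1 / 2 * (pd a (pd b (W i)) x + pd b (pd a (W i)) x) + 1 / 2 * (B a b i x + B b a i x)))),
    toPot hW₁, fun b => toPot (hw₁ b), fun a b => ?_, fun a b => ?_, fun a b => ?_,
    fun a b i x => by ring, fun a b i x => by ring, fun a b i x => by ring, fun a b => ?_⟩
  · refine Symbol.mono (Symbol.smul ((hα.one_mul' (((hdα b).const_mul _).add
      ((hdα a).const_mul _))).const_mul _) fun i => (μ i)⁻¹) 1 (fun i => le_of_eq ?_) hμ'0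
    rw [habs]; field_simp
  · have h1 : ∀ a, F.Symbol μ' (fun i => μ' i / μ i) (fun i x => (μ i)⁻¹ * pd a (α i) x) :=
      fun a => ((hdα a).smul fun i => (μ i)⁻¹).mono 1 (fun i => le_of_eq (by
        rw [habs]; field_simp)) hμ'0
    refine (((h1 a).mul (h1 b)).const_mul _).mono 1 (fun i => ?_) hμ'0
    rw [one_mul]
    exact mul_le_of_le_one_right (div_nonneg (hμ'0 i) (hμ0 i)) ((div_le_one (hμ i)).2 (hle i))
  · refine Symbol.mono (Symbol.smul ((hα.one_mul' ((((hddW a b).add (hddW b a)).const_mul _).add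
      (((hB a b).add (hB b a)).const_mul _))).const_mul _) fun i => (μ i)⁻¹) 1
      (fun i => le_of_eq ?_) hμ'0
    rw [habs]; field_simp
  · filter_upwards [hα.smooth.differentiableAt, hW.smooth.differentiableAt, hW.smooth,
      (hW.pd a).smooth.differentiableAt, (hW.pd b).smooth.differentiableAt,
      hW₁.smooth.differentiableAt, (hw₁ a).smooth.differentiableAt,
      (hw₁ b).smooth.differentiableAt, (hw a).differentiableAt, (hw b).differentiableAt]
      with i dα dW sW dWa dWb dW₁ dwa₁ dwb₁ dwa dwb x hx
    have hm := (hμ i).ne'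
    have dS : DifferentiableAt ℝ (osc ν μ 0 i) x :=
      (contDiff_osc ν μ _ i).differentiable (by simp) x
    have dS2 : DifferentiableAt ℝ (osc ν (fun i => 2 * μ i) 0 i) x :=
      (contDiff_osc ν _ _ i).differentiable (by simp) x
    have hcomm : pd a (pd b (W i)) x = pd b (pd a (W i)) x :=
      pd_comm a b ((sW.contDiffAt ((F.isOpen i).mem_nhds hx)).of_le (WithTop.coe_le_coe.2 le_top))
    have pW₁ : ∀ c, pd c (W₁ i) x = Real.sqrt 2 *
        (α i x * (ν c * osc ν μ (Real.pi / 2) i x) +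
          (μ i)⁻¹ * (pd c (α i) x * osc ν μ 0 i x)) := by
      intro c
      have d1 := (dα x hx).fun_mul dS
      rw [hW₁def]
      simp only
      rw [pd_const_mul _ _ (d1.const_mul _), pd_const_mul _ _ d1, pd_mul _ (dα x hx) dS, pd_osc,
        zero_add]
      field_simp
    have pw₁ : ∀ c d, DifferentiableAt ℝ (pd d (W i)) x →
        pd c (fun x => (-1) * (W₁ i x * pd d (W i) x) +
        (-(ν d / 4)) * ((μ i)⁻¹ * (osc ν (fun i => 2 * μ i) 0 i x * (α i x * α i x)))) x =
        (-1) * (W₁ i x * pd c (pd d (W i)) x + pd c (W₁ i) x * pd d (W i) x) +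
        (-(ν d / 4)) * ((μ i)⁻¹ * (osc ν (fun i => 2 * μ i) 0 i x *
          (α i x * pd c (α i) x + pd c (α i) x * α i x)) +
          2 * ν c * osc ν (fun i => 2 * μ i) (Real.pi / 2) i x * (α i x * α i x)) := by
      intro c d hd
      have d1 := (dW₁ x hx).fun_mul hd
      have d2 := (dα x hx).fun_mul (dα x hx)
      have d3 := dS2.fun_mul d2
      rw [pd_add _ (d1.const_mul _) ((d3.const_mul _).const_mul _), pd_const_mul _ _ d1,
        pd_mul _ (dW₁ x hx) hd, pd_const_mul _ _ (d3.const_mul _), pd_const_mul _ _ d3,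
        pd_mul _ dS2 d2, pd_mul _ (dα x hx) (dα x hx), pd_osc, zero_add]
      field_simp
    simp only [vonKarman]
    rw [pd_add _ (dW x hx) (dW₁ x hx), pd_add _ (dW x hx) (dW₁ x hx),
      pd_add _ (dwb x hx) (dwb₁ x hx), pd_add _ (dwa x hx) (dwa₁ x hx),
      pw₁ a b (dWb x hx), pw₁ b a (dWa x hx), pW₁, pW₁, hcomm, hBs b a]
    have e0 : osc ν μ 0 i x ^ 2 + osc ν μ (Real.pi / 2) i x ^ 2 = 1 := by
      simp only [osc, add_zero, Real.sin_add_pi_div_two, Real.sin_sq_add_cos_sq]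
    have e1 : osc ν (fun i => 2 * μ i) 0 i x =
        2 * osc ν μ 0 i x * osc ν μ (Real.pi / 2) i x := by
      simp only [osc, add_zero, Real.sin_add_pi_div_two]
      rw [mul_assoc, Real.sin_two_mul]
    have e2 : osc ν (fun i => 2 * μ i) (Real.pi / 2) i x =
        osc ν μ (Real.pi / 2) i x ^ 2 - osc ν μ 0 i x ^ 2 := by
      simp only [osc, add_zero, Real.sin_add_pi_div_two]
      rw [mul_assoc, Real.cos_two_mul, Real.sin_sq]
      ring
    have hs2 : Real.sqrt 2 ^ 2 = 2 := Real.sq_sqrt (by norm_num)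
    rw [e1, e2, hW₁def]
    linear_combination (α i x * (ν a * osc ν μ (Real.pi / 2) i x) +
          (μ i)⁻¹ * (pd a (α i) x * osc ν μ 0 i x)) * (α i x * (ν b * osc ν μ (Real.pi / 2) i x) +
          (μ i)⁻¹ * (pd b (α i) x * osc ν μ 0 i x)) * hs2 +
          (α i x ^ 2 * (ν a * ν b) + (μ i)⁻¹ ^ 2 * (pd a (α i) x * pd b (α i) x)) * e0

end Family
end NashKuiper

/-! ### Removal of oscillating errors and the two families of corrugations. -/

namespace NashKuiper

open Filter Topology
open scoped ContDiff

variable {ι : Type*} {n : ℕ}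

namespace Family

variable {F : Family ι n} {μ₀ μ μ' Λ : ι → ℝ}

/-- The decomposition of an oscillating field of size `μ' / μ` and frequency `κ μ`. -/
lemma exists_decomposition_pot (hμ₀ : ∀ i, 0 < μ₀ i) (hle0 : ∀ i, μ₀ i ≤ μ' i)
    (hle : ∀ i, μ' i ≤ μ i) {ν : Fin n → ℝ} {i₀ : Fin n} (hν : ν i₀ ≠ 0) (N : ℕ) (φ κ : ℝ)
    (hκ : 1 ≤ κ) (A : Fin n → Fin n → ι → E n → ℝ)
    (hA : ∀ a b, F.Symbol μ' (fun i => μ' i / μ i) (A a b))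
    (hsym : ∀ a b i x, A a b i x = A b a i x) :
    ∃ (w : Fin n → ι → E n → ℝ) (R Er : Fin n → Fin n → ι → E n → ℝ),
      (∀ b, F.Pot (fun i => (μ₀ i)⁻¹) μ (fun _ => 1) (w b)) ∧
      (∀ a b, F.Symbol μ (fun i => μ' i / μ i) (R a b)) ∧ (∀ a b i x, R a b i x = R b a i x) ∧
      (∀ b i x, R i₀ b i x = 0) ∧
      (∀ a b, F.IsO (fun i => (μ' i / μ i) ^ N) (Er a b)) ∧
      ∀ a b, F.Eq (fun i x => osc ν (fun i => κ * μ i) φ i x * A a b i x)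
        (fun i x => pd a (w b i) x + pd b (w a i) x + R a b i x + Er a b i x) := by
  have hκ0 : 0 < κ := one_pos.trans_le hκ
  have hμ' : ∀ i, 0 < μ' i := fun i => (hμ₀ i).trans_le (hle0 i)
  have hμ : ∀ i, 0 < μ i := fun i => (hμ' i).trans_le (hle i)
  have hκμ : ∀ i, 0 < κ * μ i := fun i => mul_pos hκ0 (hμ i)
  have hr : ∀ i, 0 ≤ μ' i / μ i := fun i => (div_pos (hμ' i) (hμ i)).le
  have hr1 : ∀ i, μ' i / μ i ≤ 1 := fun i => (div_le_one (hμ i)).2 (hle i)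
  obtain ⟨w, R, Er, hw, hR, hRs, hR0, hE, heq⟩ := exists_decomposition (F := F)
    (μ := fun i => κ * μ i) hμ' (fun i => (hle i).trans (le_mul_of_one_le_left (hμ i).le hκ))
    hν N φ _ hr A hA hsym
  refine ⟨w, R, Er, fun b => ?_, fun a b => (hR a b).freq_mono κ (fun i => le_rfl) hr
    (fun i => (hκμ i).le) (fun i => (hμ i).le), hRs, hR0, fun a b => (hE a b).mono 1 fun i => ?_,
    heq⟩
  · refine ((Pot.of_symbol (hw b)).freq_mono κ (fun i => le_rfl) (fun i => ?_)
      (fun i => (hκμ i).le) (fun i => (hμ i).le)).mono 1 (fun i => ?_) (fun i => ?_)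
      (fun i => (hμ i).le)
    · have := hr i; have := hκμ i; positivity
    · rw [one_mul]
      calc μ' i / μ i * (κ * μ i)⁻¹ ≤ 1 * (μ₀ i)⁻¹ := by
            refine mul_le_mul (hr1 i) (inv_anti₀ (hμ₀ i) ?_) (inv_nonneg.2 (hκμ i).le) zero_le_one
            exact ((hle0 i).trans (hle i)).trans (le_mul_of_one_le_left (hμ i).le hκ)
        _ = _ := one_mul _
    · rw [mul_assoc, inv_mul_cancel₀ (hκμ i).ne']
      simpa using hr1 i
  · rw [one_mul]
    have h1 : μ' i / (κ * μ i) ≤ μ' i / μ i :=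
      div_le_div_of_nonneg_left (hμ' i).le (hμ i) (le_mul_of_one_le_left (hμ i).le hκ)
    calc μ' i / μ i * (μ' i / (κ * μ i)) ^ N ≤ 1 * (μ' i / μ i) ^ N := by
          refine mul_le_mul (hr1 i) (pow_le_pow_left₀ ?_ h1 N) ?_ zero_le_one
          · exact (div_pos (hμ' i) (hκμ i)).le
          · exact pow_nonneg (div_pos (hμ' i) (hκμ i)).le N
      _ = _ := one_mul _

/-- The operator is affine in w, so any symmetrised gradient among the errors can be removed by
changing w alone. -/
lemma vonKarman_add {W : ι → E n → ℝ} {w w' : Fin n → ι → E n → ℝ}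
    {B : Fin n → Fin n → ι → E n → ℝ} (hw : ∀ b, F.Smooth (w b)) (hw' : ∀ b, F.Smooth (w' b))
    (a b : Fin n) :
    F.Eq (vonKarman W (fun b i x => w b i x + w' b i x) B a b)
      (fun i x => vonKarman W w B a b i x + (pd a (w' b i) x + pd b (w' a i) x)) := by
  filter_upwards [pd_add_eq (hw b) (hw' b) a, pd_add_eq (hw a) (hw' a) b] with i h1 h2 x hx
  have h1 := h1 hx
  have h2 := h2 hx
  simp only at h1 h2
  simp only [vonKarman, h1, h2]
  ring

/-- The corrugation step with a frequency gain `Λ`, whose oscillating errors are removed up to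
order `(μ' / μ) ^ N` except for components that do not involve the direction `i₀`. -/
lemma exists_corrugation_remove (hμ₀ : ∀ i, 0 < μ₀ i) (hle0 : ∀ i, μ₀ i ≤ μ' i)
    (hle : ∀ i, μ' i ≤ μ i) {ν : Fin n → ℝ} {i₀ : Fin n} (hν : ν i₀ ≠ 0) (N : ℕ)
    {α : ι → E n → ℝ} (hα : F.Symbol μ' (fun _ => 1) α)
    {W : ι → E n → ℝ} {w : Fin n → ι → E n → ℝ} {B : Fin n → Fin n → ι → E n → ℝ}
    (hW : F.Pot (fun i => (μ₀ i)⁻¹) μ' (fun _ => 1) W)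
    (hw : ∀ b, F.Pot (fun i => (μ₀ i)⁻¹) μ' (fun _ => 1) (w b))
    (hB : ∀ a b, F.Symbol μ' μ' (B a b)) (hBs : ∀ a b i x, B a b i x = B b a i x) :
    ∃ (W₁ : ι → E n → ℝ) (w₁ : Fin n → ι → E n → ℝ) (R Er : Fin n → Fin n → ι → E n → ℝ),
      F.Pot (fun i => (μ₀ i)⁻¹) μ (fun _ => 1) W₁ ∧
      (∀ b, F.Pot (fun i => (μ₀ i)⁻¹) μ (fun _ => 1) (w₁ b)) ∧
      (∀ a b, F.Symbol μ (fun i => μ' i / μ i) (R a b)) ∧ (∀ a b i x, R a b i x = R b a i x) ∧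
      (∀ b i x, R i₀ b i x = 0) ∧
      (∀ a b, F.IsO (fun i => (μ' i / μ i) ^ N) (Er a b)) ∧
      ∀ a b, F.Eq (vonKarman W₁ w₁ B a b)
        (fun i x => vonKarman W w B a b i x + α i x ^ 2 * (ν a * ν b) +
          (μ i)⁻¹ ^ 2 * (pd a (α i) x * pd b (α i) x) + R a b i x + Er a b i x) := by
  have hμ'0 : ∀ i, 0 ≤ μ' i := fun i => ((hμ₀ i).trans_le (hle0 i)).le
  have hμ0 : ∀ i, 0 ≤ μ i := fun i => (hμ'0 i).trans (hle i)
  obtain ⟨W₁, w₁, X, Y, Z, hW₁, hw₁, hX, hY, hZ, sX, sY, sZ, heq⟩ :=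
    exists_corrugation hμ₀ hle0 hle ν hα hW (fun b => (hw b).smooth) hB hBs
  obtain ⟨wx, Rx, Ex, hwx, hRx, sRx, zRx, hEx, ex⟩ :=
    exists_decomposition_pot hμ₀ hle0 hle hν N 0 2 one_le_two X hX sX
  obtain ⟨wy, Ry, Ey, hwy, hRy, sRy, zRy, hEy, ey⟩ :=
    exists_decomposition_pot hμ₀ hle0 hle hν N (Real.pi / 2) 2 one_le_two Y hY sY
  obtain ⟨wz, Rz, Ez, hwz, hRz, sRz, zRz, hEz, ez⟩ :=
    exists_decomposition_pot hμ₀ hle0 hle hν N 0 1 le_rfl Z hZ sZ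
  simp only [one_mul] at ez
  have up : ∀ {f : ι → E n → ℝ}, F.Pot (fun i => (μ₀ i)⁻¹) μ' (fun _ => 1) f →
      F.Pot (fun i => (μ₀ i)⁻¹) μ (fun _ => 1) f := fun h =>
    h.freq_mono 1 (by simpa using hle) (fun _ => zero_le_one) hμ'0 hμ0
  -- The potentials of the three oscillating errors are subtracted from w, which cancels their
  -- symmetrised gradients exactly.
  have hwxyz : ∀ b, F.Pot (fun i => (μ₀ i)⁻¹) μ (fun _ => 1)
      (fun i x => (-1) * (wx b i x + wy b i x + wz b i x)) := fun b => by
    have h1 := ((hwx b).add (hwy b)).add (hwz b)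
    refine ⟨(Smooth.const _).mul h1.smooth, h1.isO.const_mul _, fun a => ?_⟩
    refine ((h1.pd a).const_mul (-1)).congr ?_
    filter_upwards [h1.smooth.differentiableAt] with i h x hx
    exact (pd_const_mul a _ (h x hx)).symm
  refine ⟨fun i x => W i x + W₁ i x,
    fun b i x => (w b i x + w₁ b i x) + (-1) * (wx b i x + wy b i x + wz b i x),
    fun a b i x => Rx a b i x + Ry a b i x + Rz a b i x,
    fun a b i x => Ex a b i x + Ey a b i x + Ez a b i x, (up hW).add hW₁,
    fun b => ((up (hw b)).add (hw₁ b)).add (hwxyz b),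
    fun a b => ((hRx a b).add (hRy a b)).add (hRz a b),
    fun a b i x => by
      beta_reduce; rw [sRx, sRy, sRz], fun b i x => by beta_reduce; rw [zRx, zRy, zRz]; ring,
    fun a b => ((hEx a b).add (hEy a b)).add (hEz a b), fun a b => ?_⟩
  have hsm : ∀ b, F.Smooth (fun i x => w b i x + w₁ b i x) := fun b =>
    (hw b).smooth.add (hw₁ b).smooth
  filter_upwards [vonKarman_add (W := fun i x => W i x + W₁ i x) (B := B) hsm
      (fun b => (hwxyz b).smooth) a b, heq a b, ex a b, ey a b, ez a b,
    (hwx a).smooth.differentiableAt, (hwx b).smooth.differentiableAt,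
    (hwy a).smooth.differentiableAt, (hwy b).smooth.differentiableAt,
    (hwz a).smooth.differentiableAt, (hwz b).smooth.differentiableAt]
    with i h1 h2 h3 h4 h5 xa xb ya yb za zb x hx
  have h1 := h1 hx
  have h2 := h2 hx
  have h3 := h3 hx
  have h4 := h4 hx
  have h5 := h5 hx
  have xa := xa x hx
  have xb := xb x hx
  have ya := ya x hx
  have yb := yb x hx
  have za := za x hx
  have zb := zb x hx
  simp only at h1 h2 h3 h4 h5 ⊢
  rw [h1, h2, h3, h4, h5, pd_const_mul _ _ ((xb.fun_add yb).fun_add zb),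
    pd_const_mul _ _ ((xa.fun_add ya).fun_add za), pd_add _ (xb.fun_add yb) zb,
    pd_add _ (xa.fun_add ya) za, pd_add _ xb yb, pd_add _ xa ya]
  ring

/-- The corrugation step without removal of the oscillating errors. -/
lemma exists_corrugation_isO (hμ₀ : ∀ i, 0 < μ₀ i) (hle0 : ∀ i, μ₀ i ≤ μ' i)
    (hle : ∀ i, μ' i ≤ μ i) (ν : Fin n → ℝ)
    {α : ι → E n → ℝ} (hα : F.Symbol μ' (fun _ => 1) α)
    {W : ι → E n → ℝ} {w : Fin n → ι → E n → ℝ} {B : Fin n → Fin n → ι → E n → ℝ}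
    (hW : F.Pot (fun i => (μ₀ i)⁻¹) μ' (fun _ => 1) W)
    (hw : ∀ b, F.Pot (fun i => (μ₀ i)⁻¹) μ' (fun _ => 1) (w b))
    (hB : ∀ a b, F.Symbol μ' μ' (B a b)) (hBs : ∀ a b i x, B a b i x = B b a i x) :
    ∃ (W₁ : ι → E n → ℝ) (w₁ : Fin n → ι → E n → ℝ) (Er : Fin n → Fin n → ι → E n → ℝ),
      F.Pot (fun i => (μ₀ i)⁻¹) μ (fun _ => 1) W₁ ∧
      (∀ b, F.Pot (fun i => (μ₀ i)⁻¹) μ (fun _ => 1) (w₁ b)) ∧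
      (∀ a b, F.IsO (fun i => μ' i / μ i) (Er a b)) ∧
      ∀ a b, F.Eq (vonKarman W₁ w₁ B a b)
        (fun i x => vonKarman W w B a b i x + α i x ^ 2 * (ν a * ν b) + Er a b i x) := by
  have hμ' : ∀ i, 0 < μ' i := fun i => (hμ₀ i).trans_le (hle0 i)
  have hμ : ∀ i, 0 < μ i := fun i => (hμ' i).trans_le (hle i)
  have hμ0 : ∀ i, 0 ≤ μ i := fun i => (hμ i).le
  obtain ⟨W₁, w₁, X, Y, Z, hW₁, hw₁, hX, hY, hZ, sX, sY, sZ, heq⟩ :=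
    exists_corrugation hμ₀ hle0 hle ν hα hW (fun b => (hw b).smooth) hB hBs
  have up : ∀ {f : ι → E n → ℝ}, F.Pot (fun i => (μ₀ i)⁻¹) μ' (fun _ => 1) f →
      F.Pot (fun i => (μ₀ i)⁻¹) μ (fun _ => 1) f := fun h =>
    h.freq_mono 1 (by simpa using hle) (fun _ => zero_le_one) (fun i => (hμ' i).le) hμ0
  have ho : ∀ κ φ, 0 ≤ κ → F.IsO (fun _ => 1) (osc ν (fun i => κ * μ i) φ) := fun κ φ hκ =>
    (Symbol.osc ν φ fun i => mul_nonneg hκ (hμ0 i)).isO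
  have hd : ∀ a, F.IsO (fun i => μ' i / μ i) (fun i x => (μ i)⁻¹ * pd a (α i) x) := fun a =>
    ((hα.pd a).smul fun i => (μ i)⁻¹).isO.mono 1 fun i => le_of_eq <| by
      rw [abs_of_pos (inv_pos.2 (hμ i))]; field_simp
  have mul1 : ∀ {f g : ι → E n → ℝ}, F.IsO (fun _ => 1) f → F.IsO (fun i => μ' i / μ i) g →
      F.IsO (fun i => μ' i / μ i) (fun i x => f i x * g i x) := fun hf hg => by
    simpa using hf.mul hg
  refine ⟨fun i x => W i x + W₁ i x, fun b i x => w b i x + w₁ b i x,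
    fun a b i x => ((μ i)⁻¹ * pd a (α i) x) * ((μ i)⁻¹ * pd b (α i) x) +
          (osc ν (fun i => 2 * μ i) 0 i x * X a b i x +
          osc ν (fun i => 2 * μ i) (Real.pi / 2) i x * Y a b i x +
          osc ν (fun i => 1 * μ i) 0 i x * Z a b i x), (up hW).add hW₁,
    fun b => (up (hw b)).add (hw₁ b), fun a b => ?_, fun a b => ?_⟩
  · refine (((hd a).mul (hd b)).mono 1 fun i => ?_).add
      (((mul1 (ho _ _ zero_le_two) (hX a b).isO).add (mul1 (ho _ _ zero_le_two) (hY a b).isO)).add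
      (mul1 (ho _ _ zero_le_one) (hZ a b).isO))
    rw [one_mul]
    exact mul_le_of_le_one_right (div_pos (hμ' i) (hμ i)).le ((div_le_one (hμ i)).2 (hle i))
  · filter_upwards [heq a b] with i h x hx
    rw [h hx]
    simp only [one_mul]
    ring

/-- The first family of corrugations. -/
lemma exists_first_family (hμ₀ : ∀ i, 0 < μ₀ i) (hΛ : ∀ i, 1 ≤ Λ i) {i₀ : Fin n} (N : ℕ)
    (ν : ℕ → Fin n → ℝ) (hν : ∀ k, ν k i₀ ≠ 0)
    {α : ℕ → ι → E n → ℝ} (hα : ∀ k, F.Symbol μ₀ (fun _ => 1) (α k))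
    {B : Fin n → Fin n → ι → E n → ℝ}
    (hB : ∀ a b, F.Symbol μ₀ μ₀ (B a b)) (hBs : ∀ a b i x, B a b i x = B b a i x) (m : ℕ) :
    ∃ (W : ι → E n → ℝ) (w : Fin n → ι → E n → ℝ) (R Er : Fin n → Fin n → ι → E n → ℝ),
      F.Pot (fun i => (μ₀ i)⁻¹) (fun i => μ₀ i * Λ i ^ m) (fun _ => 1) W ∧
      (∀ b, F.Pot (fun i => (μ₀ i)⁻¹) (fun i => μ₀ i * Λ i ^ m) (fun _ => 1) (w b)) ∧
      (∀ a b, F.Symbol (fun i => μ₀ i * Λ i ^ m) (fun i => (Λ i)⁻¹) (R a b)) ∧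
      (∀ a b i x, R a b i x = R b a i x) ∧ (∀ b i x, R i₀ b i x = 0) ∧
      (∀ a b, F.IsO (fun i => ((Λ i) ^ N)⁻¹) (Er a b)) ∧
      ∀ a b, F.Eq (vonKarman W w B a b)
        (fun i x => ∑ k ∈ Finset.range m, (α k i x ^ 2 * (ν k a * ν k b) +
          (μ₀ i * Λ i ^ (k + 1))⁻¹ ^ 2 * (pd a (α k i) x * pd b (α k i) x)) +
          R a b i x + Er a b i x) := by
  have hΛ0 : ∀ i, 0 < Λ i := fun i => one_pos.trans_le (hΛ i)
  have hμp : ∀ m : ℕ, ∀ i, 0 < μ₀ i * Λ i ^ m := fun m i => mul_pos (hμ₀ i) (pow_pos (hΛ0 i) m)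
  have hmono : ∀ m : ℕ, ∀ i, μ₀ i ≤ μ₀ i * Λ i ^ m := fun m i =>
    le_mul_of_one_le_right (hμ₀ i).le (one_le_pow₀ (hΛ i))
  have hsucc : ∀ m : ℕ, ∀ i, μ₀ i * Λ i ^ m ≤ μ₀ i * Λ i ^ (m + 1) := fun m i =>
    mul_le_mul_of_nonneg_left (pow_le_pow_right₀ (hΛ i) (Nat.le_succ m)) (hμ₀ i).le
  have hratio : ∀ m : ℕ, ∀ i, (μ₀ i * Λ i ^ m) / (μ₀ i * Λ i ^ (m + 1)) = (Λ i)⁻¹ := fun m i => by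
    have := (hμ₀ i).ne'; have := (hΛ0 i).ne'
    field_simp
    rw [pow_succ]
  induction m with
  | zero =>
    refine ⟨fun _ _ => 0, fun _ _ _ => 0, fun _ _ _ _ => 0, fun _ _ _ _ => 0, Pot.zero,
      fun _ => Pot.zero, fun _ _ => Symbol.zero, by simp, by simp,
      fun a b => (Symbol.zero (μ := μ₀)).isO, fun a b => Eq.of_eq fun i x => ?_⟩
    simp [vonKarman, pd_const]
  | succ m ih =>
    obtain ⟨W, w, R, Er, hW, hw, hR, sR, zR, hE, heq⟩ := ih
    -- The frequency rises from μ₀Λᵐ to μ₀Λᵐ⁺¹. All the amplitudes stay at frequency μ₀, hence so do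
    -- their mean errors, which are therefore kept explicit for later compensation.
    obtain ⟨W₁, w₁, R₁, Er₁, hW₁, hw₁, hR₁, sR₁, zR₁, hE₁, heq₁⟩ :=
      exists_corrugation_remove hμ₀ (hmono m) (hsucc m) (hν m) N
        ((hα m).freq_mono 1 (by simpa using hmono m) (fun _ => zero_le_one) (fun i => (hμ₀ i).le)
          (fun i => (hμp m i).le)) hW hw
        (fun a b => ((hB a b).freq_mono 1 (by simpa using hmono m) (fun i => (hμ₀ i).le)
          (fun i => (hμ₀ i).le) (fun i => (hμp m i).le)).mono 1 (by simpa using hmono m)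
          (fun i => (hμp m i).le)) hBs
    refine ⟨W₁, w₁, fun a b i x => R a b i x + R₁ a b i x, fun a b i x => Er a b i x + Er₁ a b i x,
      hW₁, hw₁, fun a b => ?_, fun a b i x => by beta_reduce; rw [sR, sR₁],
      fun b i x => by beta_reduce; rw [zR, zR₁, add_zero],
      fun a b => (hE a b).add ((hE₁ a b).mono 1 fun i => ?_), fun a b => ?_⟩
    · refine ((hR a b).freq_mono 1 (by simpa using hsucc m) (fun i => (inv_pos.2 (hΛ0 i)).le)
        (fun i => (hμp m i).le) (fun i => (hμp _ i).le)).add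
        ((hR₁ a b).mono 1 (fun i => ?_) (fun i => (hμp _ i).le))
      rw [hratio, one_mul]
    · rw [hratio, one_mul, inv_pow]
    · filter_upwards [heq a b, heq₁ a b] with i h1 h2 x hx
      rw [h2 hx]
      simp only [h1 hx, Finset.sum_range_succ]
      ring

/-- The second family of corrugations, starting from frequency `μ₀ Λ ^ M`. -/
lemma exists_second_family (hμ₀ : ∀ i, 0 < μ₀ i) (hΛ : ∀ i, 1 ≤ Λ i) {κ : Type*} (S : Finset κ) (J M : ℕ) (ν : κ → Fin n → ℝ)
    {α : κ → ι → E n → ℝ} (hα : ∀ k, F.Symbol (fun i => μ₀ i * Λ i ^ M) (fun _ => 1) (α k))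
    {B : Fin n → Fin n → ι → E n → ℝ}
    (hB : ∀ a b, F.Symbol μ₀ μ₀ (B a b)) (hBs : ∀ a b i x, B a b i x = B b a i x)
    {W : ι → E n → ℝ} {w : Fin n → ι → E n → ℝ}
    (hW : F.Pot (fun i => (μ₀ i)⁻¹) (fun i => μ₀ i * Λ i ^ M) (fun _ => 1) W)
    (hw : ∀ b, F.Pot (fun i => (μ₀ i)⁻¹) (fun i => μ₀ i * Λ i ^ M) (fun _ => 1) (w b)) :
    ∃ (W₁ : ι → E n → ℝ) (w₁ : Fin n → ι → E n → ℝ) (Er : Fin n → Fin n → ι → E n → ℝ),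
      F.Pot (fun i => (μ₀ i)⁻¹) (fun i => μ₀ i * Λ i ^ (J * S.card + M)) (fun _ => 1) W₁ ∧
      (∀ b, F.Pot (fun i => (μ₀ i)⁻¹) (fun i => μ₀ i * Λ i ^ (J * S.card + M))
        (fun _ => 1) (w₁ b)) ∧
      (∀ a b, F.IsO (fun i => ((Λ i) ^ J)⁻¹) (Er a b)) ∧
      ∀ a b, F.Eq (vonKarman W₁ w₁ B a b)
        (fun i x => vonKarman W w B a b i x + ∑ k ∈ S, α k i x ^ 2 * (ν k a * ν k b) +
          Er a b i x) := by
  classical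
  have hΛ0 : ∀ i, 0 < Λ i := fun i => one_pos.trans_le (hΛ i)
  have hμp : ∀ m : ℕ, ∀ i, 0 < μ₀ i * Λ i ^ m := fun m i => mul_pos (hμ₀ i) (pow_pos (hΛ0 i) m)
  have hmono : ∀ m : ℕ, ∀ i, μ₀ i ≤ μ₀ i * Λ i ^ m := fun m i =>
    le_mul_of_one_le_right (hμ₀ i).le (one_le_pow₀ (hΛ i))
  have hmono' : ∀ m k : ℕ, m ≤ k → ∀ i, μ₀ i * Λ i ^ m ≤ μ₀ i * Λ i ^ k := fun m k h i =>
    mul_le_mul_of_nonneg_left (pow_le_pow_right₀ (hΛ i) h) (hμ₀ i).le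
  induction S using Finset.induction_on with
  | empty =>
    refine ⟨W, w, fun _ _ _ _ => 0, by simpa using hW, by simpa using hw,
      fun a b => (Symbol.zero (μ := μ₀)).isO, fun a b => Eq.of_eq fun i x => by simp⟩
  | insert s S hs ih =>
    obtain ⟨W', w', Er, hW', hw', hE, heq⟩ := ih
    set m := J * S.card + M with hm
    have hm' : J * (insert s S).card + M = m + J := by
      rw [Finset.card_insert_of_notMem hs, hm]; ring
    have hMm : M ≤ m := hm ▸ Nat.le_add_left _ _
    clear_value m
    -- The jump from μ₀Λᵐ to μ₀Λᵐ⁺ᴶ makes all errors O(Λ⁻ᴶ) without integration by parts. The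
    -- amplitudes are fixed beforehand at frequency μ₀Λᴹ, which never exceeds the current one.
    obtain ⟨W₁, w₁, Er₁, hW₁, hw₁, hE₁, heq₁⟩ :=
      exists_corrugation_isO hμ₀ (hmono m) (hmono' m (m + J) (Nat.le_add_right _ _)) (ν s)
        ((hα s).freq_mono 1 (by simpa using hmono' M m hMm)
          (fun _ => zero_le_one) (fun i => (hμp M i).le) (fun i => (hμp m i).le)) hW' hw'
        (fun a b => ((hB a b).freq_mono 1 (by simpa using hmono m) (fun i => (hμ₀ i).le)
          (fun i => (hμ₀ i).le) (fun i => (hμp m i).le)).mono 1 (by simpa using hmono m)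
          (fun i => (hμp m i).le)) hBs
    rw [hm']
    refine ⟨W₁, w₁, fun a b i x => Er a b i x + Er₁ a b i x, hW₁, hw₁,
      fun a b => (hE a b).add ((hE₁ a b).mono 1 fun i => ?_), fun a b => ?_⟩
    · have := (hμ₀ i).ne'; have := (hΛ0 i).ne'
      rw [one_mul, pow_add]
      apply le_of_eq
      field_simp
    · filter_upwards [heq a b, heq₁ a b] with i h1 h2 x hx
      rw [h2 hx]
      simp only [h1 hx, Finset.sum_insert hs]
      ring

end Family
end NashKuiper

/-! ### Linear algebra of the basis ν_ij ⊗ ν_ij. -/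

namespace NashKuiper

open Filter Topology
open scoped ContDiff

section algebra

variable {n : ℕ}

/-- The coefficients of a symmetric matrix with respect to the matrices `ν_{ij} ⊗ ν_{ij}`. -/
def coeff (M : Fin n → Fin n → ℝ) (p : Fin n × Fin n) : ℝ :=
  if p.1 = p.2 then M p.1 p.1 - ∑ j, (if p.1 = j then 0 else M p.1 j) else 2 * M p.1 p.2

/-- The pairs `i ≤ j`. -/
def pairs (n : ℕ) : Finset (Fin n × Fin n) := {p | p.1 ≤ p.2}

lemma sum_pairs (d : Fin n → ℝ) (g : Fin n → Fin n → ℝ) :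
    ∑ p ∈ pairs n, (if p.1 = p.2 then d p.1 else g p.1 p.2 + g p.2 p.1) =
      ∑ i, d i + ∑ i, ∑ j, if i = j then 0 else g i j := by
  have h1 : ∑ p ∈ pairs n, (if p.1 = p.2 then d p.1 else g p.1 p.2 + g p.2 p.1) =
      ∑ i, ∑ j, (((if i = j then d i else 0) + if i < j then g i j else 0) +
        if i < j then g j i else 0) := by
    rw [pairs, Finset.sum_filter, Fintype.sum_prod_type]
    refine Finset.sum_congr rfl fun i _ => Finset.sum_congr rfl fun j _ => ?_
    rcases lt_trichotomy i j with h | h | h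
    · simp [h, h.le, h.ne]
    · simp [h]
    · simp [h.not_ge, h.ne', h.not_gt]
  rw [h1]
  simp only [Finset.sum_add_distrib]
  rw [Finset.sum_comm (f := fun i j => if i < j then g j i else 0), add_assoc,
    ← Finset.sum_add_distrib]
  congr 1
  · simp
  · refine Finset.sum_congr rfl fun i _ => ?_
    rw [← Finset.sum_add_distrib]
    refine Finset.sum_congr rfl fun j _ => ?_
    rcases lt_trichotomy i j with h | h | h
    · simp [h, h.ne, h.not_gt]
    · simp [h]
    · simp [h, h.ne', h.not_gt]

lemma nu_self (i a : Fin n) : nu i i a = if a = i then 1 else 0 := by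
  have h : ‖EuclideanSpace.single i (1 : ℝ) + EuclideanSpace.single i 1‖ = 2 := by
    rw [← two_smul ℝ, norm_smul]; simp
  simp only [nu, h]
  by_cases ha : a = i
  · subst ha; simp; norm_num
  · simp [ha]

lemma nu_of_ne {i j : Fin n} (hij : i ≠ j) (a : Fin n) :
    nu i j a = (Real.sqrt 2)⁻¹ * ((if a = i then 1 else 0) + if a = j then 1 else 0) := by
  have h : ‖EuclideanSpace.single i (1 : ℝ) + EuclideanSpace.single j 1‖ = Real.sqrt 2 := by
    rw [EuclideanSpace.norm_eq]
    congr 1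
    have : ∀ k, ‖(EuclideanSpace.single i (1 : ℝ) + EuclideanSpace.single j 1 : E n) k‖ ^ 2 =
        (if k = i then 1 else 0) + if k = j then 1 else 0 := by
      intro k
      by_cases h1 : k = i
      · subst h1; simp [hij]
      · by_cases h2 : k = j
        · subst h2; simp [h1]
        · simp [h1, h2]
    simp only [this, Finset.sum_add_distrib]
    simp; norm_num
  simp only [nu, h]
  simp [mul_add]

/-- For i ≠ j the matrix ν_ij ⊗ ν_ij has entries ½ at the four positions formed from i and j. The
coefficient 2M_ij thus restores the off-diagonal entry and adds M_ij to the diagonal entries i and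
j; the coefficients of ν_ii ⊗ ν_ii subtract this surplus. -/
lemma sum_coeff_nu (M : Fin n → Fin n → ℝ) (hM : ∀ a b, M a b = M b a) (a b : Fin n) :
    ∑ p ∈ pairs n, coeff M p * (nu p.1 p.2 a * nu p.1 p.2 b) = M a b := by
  have hs : (Real.sqrt 2)⁻¹ * (Real.sqrt 2)⁻¹ = 1 / 2 := by
    rw [← mul_inv, Real.mul_self_sqrt (by norm_num)]; norm_num
  have h := sum_pairs (fun i => (M i i - ∑ j, (if i = j then 0 else M i j)) *
    ((if a = i then 1 else 0) * if b = i then 1 else 0))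
    (fun i j => M i j * (((if a = i then 1 else 0) * if b = i then 1 else 0) +
      (if a = i then 1 else 0) * if b = j then 1 else 0))
  refine Eq.trans (Finset.sum_congr rfl fun p _ => ?_) (h.trans ?_)
  · obtain ⟨i, j⟩ := p
    by_cases hij : i = j
    · subst hij
      simp only [coeff, if_true, nu_self]
    · simp only [coeff, hij, if_false, nu_of_ne hij, hM j i]
      linear_combination 2 * M i j * ((if a = i then 1 else 0) + if a = j then 1 else 0) *
        ((if b = i then 1 else 0) + if b = j then 1 else 0) * hs
  have e1 : ∀ i, (∑ j, if i = j then 0 else M i j * (((if a = i then (1 : ℝ) else 0) *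
      if b = i then 1 else 0) + (if a = i then 1 else 0) * if b = j then 1 else 0)) =
      (∑ j, if i = j then 0 else M i j) * ((if a = i then 1 else 0) * if b = i then 1 else 0) +
      (if a = i then 1 else 0) * if i = b then 0 else M i b := by
    intro i
    rw [Finset.sum_mul]
    have : (if a = i then (1 : ℝ) else 0) * (if i = b then 0 else M i b) =
        ∑ j, if j = b then (if a = i then (1 : ℝ) else 0) * (if i = j then 0 else M i j) else 0 := by
      simp
    rw [this, ← Finset.sum_add_distrib]
    refine Finset.sum_congr rfl fun j _ => ?_
    by_cases h1 : i = j
    · simp [h1]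
    · by_cases h2 : j = b
      · subst h2; by_cases h3 : a = i <;> simp [h1, h3, Ne.symm h1]
      · simp [h1, h2, Ne.symm h2]
  simp only [e1]
  rw [← Finset.sum_add_distrib, Finset.sum_eq_single a]
  · by_cases hab : a = b
    · subst hab; simp
    · simp [hab, Ne.symm hab]
  · intro i _ hi; simp [Ne.symm hi]
  · simp

lemma h0_apply (a b : Fin n) : h0 n a b = if a = b then ((n : ℝ) + 1) / 2 else 1 / 2 := by
  have hM := sum_coeff_nu (n := n) (fun a b => if a = b then ((n : ℝ) + 1) / 2 else 1 / 2)
    (fun a b => by simp [eq_comm]) a b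
  rw [← hM, h0, Matrix.sum_apply]
  refine Finset.sum_congr rfl fun p _ => ?_
  have : coeff (fun a b => if a = b then ((n : ℝ) + 1) / 2 else 1 / 2) p = 1 := by
    by_cases h : p.1 = p.2
    · have e : ∀ j, (if p.1 = j then (0 : ℝ) else if p.1 = j then ((n : ℝ) + 1) / 2 else 1 / 2) =
          1 / 2 - if p.1 = j then 1 / 2 else 0 := by
        intro j; by_cases h : p.1 = j <;> simp [h]
      simp only [coeff, h, if_true]
      simp only [h] at e
      simp only [e, Finset.sum_sub_distrib]
      simp; ring
    · simp [coeff, h]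
  rw [this, one_mul, Matrix.of_apply]

lemma coeff_h0 (p : Fin n × Fin n) : coeff (fun a b => h0 n a b) p = 1 := by
  simp only [h0_apply]
  by_cases h : p.1 = p.2
  · have e : ∀ j, (if p.1 = j then (0 : ℝ) else if p.1 = j then ((n : ℝ) + 1) / 2 else 1 / 2) =
        1 / 2 - if p.1 = j then 1 / 2 else 0 := by
      intro j; by_cases h : p.1 = j <;> simp [h]
    simp only [coeff, h, if_true]
    simp only [h] at e
    simp only [e, Finset.sum_sub_distrib]
    simp; ring
  · simp [coeff, h]

lemma coeff_add (M N : Fin n → Fin n → ℝ) (p : Fin n × Fin n) :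
    coeff (fun a b => M a b + N a b) p = coeff M p + coeff N p := by
  simp only [coeff]
  split_ifs
  · have : ∀ j, (if p.1 = j then 0 else M p.1 j + N p.1 j) =
        (if p.1 = j then 0 else M p.1 j) + if p.1 = j then 0 else N p.1 j := by
      intro j; split_ifs <;> simp
    simp only [this, Finset.sum_add_distrib]
    ring
  · ring

lemma coeff_mul (c : ℝ) (M : Fin n → Fin n → ℝ) (p : Fin n × Fin n) :
    coeff (fun a b => c * M a b) p = c * coeff M p := by
  simp only [coeff]
  split_ifs
  · rw [mul_sub, Finset.mul_sum]
    congr 1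
    exact Finset.sum_congr rfl fun j _ => by split_ifs <;> simp
  · ring

lemma coeff_sub (M N : Fin n → Fin n → ℝ) (p : Fin n × Fin n) :
    coeff (fun a b => M a b - N a b) p = coeff M p - coeff N p := by
  have := coeff_add M (fun a b => (-1) * N a b) p
  rw [coeff_mul] at this
  simpa [sub_eq_add_neg] using this

/-- A diagonal coefficient involves at most n + 1 entries and an off-diagonal one twice a single
entry; n + 2 covers both. -/
lemma abs_coeff_le (M : Fin n → Fin n → ℝ) (p : Fin n × Fin n) {K : ℝ}
    (hK : ∀ a b, |M a b| ≤ K) : |coeff M p| ≤ (n + 2) * K := by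
  have hK0 : 0 ≤ K := (abs_nonneg _).trans (hK p.1 p.2)
  have hn : (0 : ℝ) ≤ n := Nat.cast_nonneg n
  simp only [coeff]
  split_ifs
  · have h1 : |∑ j, (if p.1 = j then 0 else M p.1 j)| ≤ n * K := by
      refine (Finset.abs_sum_le_sum_abs _ _).trans ?_
      calc _ ≤ ∑ _j : Fin n, K := Finset.sum_le_sum fun j _ => by
            split_ifs
            · simpa using hK0
            · exact hK _ _
        _ = _ := by simp
    have h2 := hK p.1 p.1
    calc _ ≤ |M p.1 p.1| + |∑ j, (if p.1 = j then 0 else M p.1 j)| := abs_sub _ _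
      _ ≤ K + n * K := add_le_add h2 h1
      _ ≤ _ := by nlinarith
  · rw [abs_mul, abs_two]
    nlinarith [hK p.1 p.2]

/-- This decouples the two families: the remainders of integration by parts in the direction 0 do
not change the amplitudes of the first family. -/
lemma coeff_eq_zero [NeZero n] (M : Fin n → Fin n → ℝ) (hM : ∀ b, M 0 b = 0) (k : Fin n) :
    coeff M (0, k) = 0 := by
  simp [coeff, hM]

/-- Needed in order to integrate by parts with `i₀ = 0` along every direction of the first family.
-/
lemma nu_zero_ne [NeZero n] (k : Fin n) : nu 0 k (0 : Fin n) ≠ 0 := by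
  by_cases h : 0 = k
  · subst h; simp [nu_self]
  · rw [nu_of_ne h]; simp [h]

/-- The pairs `i ≤ j` with `i ≠ 0`. -/
def innerPairs (n : ℕ) [NeZero n] : Finset (Fin n × Fin n) := {p ∈ pairs n | p.1 ≠ 0}

lemma sum_pairs_eq [NeZero n] (f : Fin n × Fin n → ℝ) :
    ∑ p ∈ pairs n, f p =
      ∑ k ∈ Finset.range n, f (0, Fin.ofNat n k) + ∑ p ∈ innerPairs n, f p := by
  rw [← Finset.sum_filter_add_sum_filter_not (pairs n) (fun p => p.1 = 0) f]
  congr 1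
  have : {p ∈ pairs n | p.1 = 0} = (Finset.range n).image fun k => ((0 : Fin n), Fin.ofNat n k) := by
    ext ⟨i, j⟩
    simp only [pairs, Finset.mem_filter, Finset.mem_univ, true_and, Finset.mem_image,
      Finset.mem_range, Prod.mk.injEq]
    constructor
    · rintro ⟨_, rfl⟩
      exact ⟨j, j.2, rfl, by simp⟩
    · rintro ⟨k, hk, rfl, rfl⟩
      exact ⟨Fin.zero_le _, rfl⟩
  rw [this, Finset.sum_image]
  intro k hk l hl h
  simp only [Finset.coe_range, Set.mem_Iio] at hk hl
  simpa [Fin.ext_iff, Fin.ofNat, Nat.mod_eq_of_lt hk, Nat.mod_eq_of_lt hl] using h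

/-- Counted by giving weight 1 to diagonal pairs and ½ + ½ to the others. This number is the
multiplier of J in the final exponent. -/
lemma card_innerPairs [NeZero n] : (innerPairs n).card = nStar n - n := by
  have h1 := sum_pairs (n := n) (fun _ => 1) (fun _ _ => 1 / 2)
  have h2 := sum_pairs_eq (n := n) (fun _ => 1)
  have h3 : ∑ p ∈ pairs n, (if p.1 = p.2 then (1 : ℝ) else 1 / 2 + 1 / 2) = ∑ p ∈ pairs n, 1 :=
    Finset.sum_congr rfl fun p _ => by split_ifs <;> norm_num
  have h4 : ∀ i : Fin n, (∑ j, if i = j then (0 : ℝ) else 1 / 2) = ((n : ℝ) - 1) / 2 := by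
    intro i
    have e : ∀ j, (if i = j then (0 : ℝ) else 1 / 2) = 1 / 2 - if i = j then 1 / 2 else 0 := by
      intro j; by_cases h : i = j <;> simp [h]
    simp only [e, Finset.sum_sub_distrib]
    simp; ring
  rw [h3, h2] at h1
  simp only [h4] at h1
  simp only [Finset.sum_const, Finset.card_range, Finset.card_univ, Fintype.card_fin,
    nsmul_eq_mul, mul_one] at h1
  have h5 : 2 * (n + (innerPairs n).card) = n * (n + 1) := by
    have : (2 : ℝ) * (n + (innerPairs n).card) = n * (n + 1) := by linarith
    exact_mod_cast this
  rw [nStar]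
  omega

end algebra

end NashKuiper

/-! ### Källén's iteration and approximate solution of the von Kármán system. -/

namespace NashKuiper

open Filter Topology
open scoped ContDiff

variable {ι : Type*} {n : ℕ}

namespace Family

variable {F : Family ι n} {μ₀ μ Λ σ : ι → ℝ}

lemma Symbol.coeff {M : Fin n → Fin n → ι → E n → ℝ} (hM : ∀ a b, F.Symbol μ σ (M a b))
    (p : Fin n × Fin n) : F.Symbol μ σ (fun i x => coeff (fun a b => M a b i x) p) := by
  simp only [NashKuiper.coeff]
  by_cases h : p.1 = p.2
  · simp only [h, if_true]
    refine (hM _ _).sub (Symbol.sum _ fun j _ => ?_)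
    by_cases h : p.2 = j
    · simpa only [h, if_true] using Symbol.zero
    · simpa only [h, if_false] using hM _ _
  · simpa only [h, if_false] using (hM _ _).const_mul 2

/-- `c⁻¹ ∂_a c ∂_b c`, which is `4 ∂_a √c ∂_b √c`. -/
noncomputable def gradSq (c : ι → E n → ℝ) (a b : Fin n) (i : ι) (x : E n) : ℝ :=
  (c i x)⁻¹ * (pd a (c i) x * pd b (c i) x)

lemma Symbol.gradSq (hμ₀ : ∀ i, 0 ≤ μ₀ i) {c : ι → E n → ℝ} (hc : F.Symbol μ₀ (fun _ => 1) c)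
    (hpos : ∀ᶠ i in F.l, ∀ x ∈ F.D i, 1 / 2 ≤ c i x) (a b : Fin n) :
    F.Symbol μ₀ (fun i => μ₀ i ^ 2) (gradSq c a b) :=
  ((hc.inv one_half_pos hpos).one_mul' ((hc.pd a).mul (hc.pd b))).mono 1
    (fun i => le_of_eq (by ring)) hμ₀

/-- The difference telescopes into terms that each contain `e` or a derivative of `e` as a factor;
everything else is bounded at frequency μ₀. This is the Lipschitz estimate behind the iteration. -/
lemma Symbol.gradSq_sub (hμ₀ : ∀ i, 0 ≤ μ₀ i) {c e : ι → E n → ℝ}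
    (hσ1 : ∀ i, σ i ≤ 1)
    (hc : F.Symbol μ₀ (fun _ => 1) c) (he : F.Symbol μ₀ σ e)
    (hpos : ∀ᶠ i in F.l, ∀ x ∈ F.D i, 1 / 2 ≤ c i x)
    (hpos' : ∀ᶠ i in F.l, ∀ x ∈ F.D i, 1 / 2 ≤ c i x + e i x) (a b : Fin n) :
    F.Symbol μ₀ (fun i => σ i * μ₀ i ^ 2)
      (fun i x => Family.gradSq (fun i x => c i x + e i x) a b i x -
        Family.gradSq c a b i x) := by
  have hc' : F.Symbol μ₀ (fun _ => 1) (fun i x => c i x + e i x) :=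
    hc.add (he.mono 1 (by simpa using hσ1) hμ₀)
  have hi := hc.inv one_half_pos hpos
  have hi' := hc'.inv one_half_pos hpos'
  have h1 := hi'.one_mul' ((((he.pd a).mul (hc'.pd b)).mono (τ := fun i => σ i * μ₀ i ^ 2) 1
    (fun i => le_of_eq (by ring)) hμ₀).add
    (((hc.pd a).mul (he.pd b)).mono 1 (fun i => le_of_eq (by ring)) hμ₀))
  have h2 := (((he.mul_one' (hi'.one_mul' hi)).mul ((hc.pd a).mul (hc.pd b))).mono
    (τ := fun i => σ i * μ₀ i ^ 2) 1 (fun i => le_of_eq (by ring)) hμ₀)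
  refine (h1.sub h2).congr ?_
  filter_upwards [hc.smooth.differentiableAt, he.smooth.differentiableAt, hpos, hpos']
    with i d1 d2 p1 p2 x hx
  have q1 : c i x ≠ 0 := (one_half_pos.trans_le (p1 x hx)).ne'
  have q2 : c i x + e i x ≠ 0 := (one_half_pos.trans_le (p2 x hx)).ne'
  simp only [Family.gradSq]
  rw [pd_add _ (d1 x hx) (d2 x hx), pd_add _ (d1 x hx) (d2 x hx)]
  field_simp
  ring

/-- The mean error produced by the first family of corrugations with amplitudes `√(c k)`. -/
noncomputable def meanError (μ₀ Λ : ι → ℝ) (c : ℕ → ι → E n → ℝ) (a b : Fin n) (i : ι)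
    (x : E n) : ℝ :=
  ∑ k ∈ Finset.range n, 1 / 4 * ((μ₀ i * Λ i ^ (k + 1))⁻¹ ^ 2 * gradSq (c k) a b i x)

/-- This trades a constant for a threshold: an unspecified C is beaten by going far enough along the
filter. -/
lemma IsO.eventually_le {f : ι → E n → ℝ} {σ : ι → ℝ} (hf : F.IsO σ f)
    (hσ : Tendsto σ F.l (𝓝 0)) {ε : ℝ} (hε : 0 < ε) :
    ∀ᶠ i in F.l, ∀ x ∈ F.D i, |f i x| ≤ ε := by
  obtain ⟨C, hC, h⟩ := hf
  have h1 : ∀ᶠ i in F.l, C * σ i < ε := by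
    have := hσ.const_mul C
    rw [mul_zero] at this
    exact this.eventually_lt_const hε
  filter_upwards [h, h1] with i h h1 x hx using (h x hx).trans h1.le

/-- The factor (μ₀Λᵏ⁺¹)⁻² cancels the μ₀² of two derivatives and still gains at least Λ⁻². -/
lemma Symbol.meanError_aux (hμ₀ : ∀ i, 0 < μ₀ i) (hΛ : ∀ i, 1 ≤ Λ i) (hσ : ∀ i, 0 ≤ σ i)
    {f : ℕ → ι → E n → ℝ} (hf : ∀ k, F.Symbol μ₀ (fun i => σ i * μ₀ i ^ 2) (f k)) :
    F.Symbol μ₀ (fun i => σ i * (Λ i)⁻¹ ^ 2)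
      (fun i x => ∑ k ∈ Finset.range n, 1 / 4 * ((μ₀ i * Λ i ^ (k + 1))⁻¹ ^ 2 * f k i x)) := by
  refine Symbol.sum _ fun k _ => Symbol.const_mul ?_ _
  refine ((hf k).smul fun i => (μ₀ i * Λ i ^ (k + 1))⁻¹ ^ 2).mono 1 (fun i => ?_)
    fun i => (hμ₀ i).le
  have hL := one_pos.trans_le (hΛ i)
  have hm := hμ₀ i
  rw [abs_of_nonneg (by positivity), one_mul]
  have h1 : (Λ i ^ (k + 1))⁻¹ ^ 2 ≤ (Λ i)⁻¹ ^ 2 := by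
    refine pow_le_pow_left₀ (by positivity) (inv_anti₀ hL ?_) 2
    exact le_self_pow₀ (hΛ i) (Nat.succ_ne_zero k)
  calc (μ₀ i * Λ i ^ (k + 1))⁻¹ ^ 2 * (σ i * μ₀ i ^ 2) = σ i * (Λ i ^ (k + 1))⁻¹ ^ 2 := by
        field_simp
    _ ≤ _ := mul_le_mul_of_nonneg_left h1 (hσ i)

variable [NeZero n]

/-- Källén's iteration: the amplitudes of the first family can be chosen such that they
compensate the mean error up to a high power of `Λ⁻¹`. -/
lemma exists_amplitudes (hμ₀ : ∀ i, 0 < μ₀ i) (hΛ : ∀ i, 1 ≤ Λ i) (hΛl : Tendsto Λ F.l atTop)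
    {h : Fin n → Fin n → ι → E n → ℝ} (hh : ∀ a b, F.Symbol μ₀ (fun _ => 1) (h a b))
    (hpos : ∀ p, ∀ᶠ i in F.l, ∀ x ∈ F.D i, 3 / 4 ≤ NashKuiper.coeff (fun a b => h a b i x) p)
    (N : ℕ) :
    ∃ c : ℕ → ι → E n → ℝ, (∀ k, F.Symbol μ₀ (fun _ => 1) (c k)) ∧
      (∀ k, ∀ᶠ i in F.l, ∀ x ∈ F.D i, 1 / 2 ≤ c k i x) ∧
      ∀ k, F.Symbol μ₀ (fun i => (Λ i)⁻¹ ^ (2 * (N + 1))) (fun i x => c k i x -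
        NashKuiper.coeff (fun a b => h a b i x - meanError μ₀ Λ c a b i x) (0, Fin.ofNat n k)) := by
  have hΛ0 : ∀ i, 0 < Λ i := fun i => one_pos.trans_le (hΛ i)
  have hμ0 : ∀ i, 0 ≤ μ₀ i := fun i => (hμ₀ i).le
  have hinv1 : ∀ i, (Λ i)⁻¹ ≤ 1 := fun i => inv_le_one_of_one_le₀ (hΛ i)
  have hinv0 : ∀ i, 0 ≤ (Λ i)⁻¹ := fun i => (inv_pos.2 (hΛ0 i)).le
  have hpow1 : ∀ m : ℕ, ∀ i, (Λ i)⁻¹ ^ m ≤ 1 := fun m i => pow_le_one₀ (hinv0 i) (hinv1 i)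
  have hlim : Tendsto (fun i => (Λ i)⁻¹ ^ 2) F.l (𝓝 0) := by
    simpa using (tendsto_inv_atTop_zero.comp hΛl).pow 2
  set H : ℕ → ι → E n → ℝ := fun k i x =>
    NashKuiper.coeff (fun a b => h a b i x) (0, Fin.ofNat n k) with hHdef
  have hH : ∀ k, F.Symbol μ₀ (fun _ => 1) (H k) := fun k => Symbol.coeff hh _
  have hme : ∀ c : ℕ → ι → E n → ℝ, (∀ k, F.Symbol μ₀ (fun _ => 1) (c k)) →
      (∀ k, ∀ᶠ i in F.l, ∀ x ∈ F.D i, 1 / 2 ≤ c k i x) → ∀ a b,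
      F.Symbol μ₀ (fun i => (Λ i)⁻¹ ^ 2) (meanError μ₀ Λ c a b) := fun c h1 h2 a b => by
    have := Symbol.meanError_aux (σ := fun _ => 1) hμ₀ hΛ (fun _ => zero_le_one)
      (fun k => ((h1 k).gradSq hμ0 (h2 k) a b).mono 1 (fun i => by simp) hμ0)
    simp only [one_mul] at this
    exact this
  suffices hs : ∃ c : ℕ → ι → E n → ℝ, (∀ k, F.Symbol μ₀ (fun _ => 1) (c k)) ∧
      (∀ k, ∀ᶠ i in F.l, ∀ x ∈ F.D i, 1 / 2 ≤ c k i x) ∧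
      ∀ k, F.Symbol μ₀ (fun i => (Λ i)⁻¹ ^ (2 * (N + 1))) (fun i x => c k i x - (H k i x -
        NashKuiper.coeff (fun a b => meanError μ₀ Λ c a b i x) (0, Fin.ofNat n k))) by
    obtain ⟨c, h1, h2, h3⟩ := hs
    exact ⟨c, h1, h2, fun k => (h3 k).congr (Eq.of_eq fun i x => by
      rw [coeff_sub])⟩
  induction N with
  | zero =>
    have hp : ∀ k, ∀ᶠ i in F.l, ∀ x ∈ F.D i, 1 / 2 ≤ H k i x := fun k => by
      filter_upwards [hpos (0, Fin.ofNat n k)] with i hi x hx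
      have := hi x hx
      simp only [hHdef]; linarith
    refine ⟨H, hH, hp, fun k => ?_⟩
    refine (Symbol.coeff (hme H hH hp) (0, Fin.ofNat n k)).congr (Eq.of_eq fun i x => ?_)
    ring
  | succ N ih =>
    obtain ⟨c, hc, hcp, he⟩ := ih
    set e : ℕ → ι → E n → ℝ := fun k i x => H k i x -
        NashKuiper.coeff (fun a b => meanError μ₀ Λ c a b i x) (0, Fin.ofNat n k) - c k i x with hedef
    have he' : ∀ k, F.Symbol μ₀ (fun i => (Λ i)⁻¹ ^ (2 * (N + 1))) (e k) := fun k =>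
      (he k).neg.congr (Eq.of_eq fun i x => by simp only [hedef]; ring)
    -- Here c + e = H − coeff(meanError c), one Picard step. Since H ≥ 3/4 and the correction is
    -- eventually at most 1/4, the new amplitudes stay above 1/2.
    set c' : ℕ → ι → E n → ℝ := fun k i x => c k i x + e k i x with hc'def
    have hc' : ∀ k, F.Symbol μ₀ (fun _ => 1) (c' k) := fun k =>
      (hc k).add ((he' k).mono 1 (by simpa using hpow1 _) hμ0)
    have hmc : ∀ k, F.Symbol μ₀ (fun i => (Λ i)⁻¹ ^ 2) (fun i x =>
      NashKuiper.coeff (fun a b => meanError μ₀ Λ c a b i x) (0, Fin.ofNat n k)) := fun k =>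
      Symbol.coeff (hme c hc hcp) _
    have hcp' : ∀ k, ∀ᶠ i in F.l, ∀ x ∈ F.D i, 1 / 2 ≤ c' k i x := fun k => by
      filter_upwards [hpos (0, Fin.ofNat n k), (hmc k).isO.eventually_le hlim
        (by norm_num : (0 : ℝ) < 1 / 4)] with i h1 h2 x hx
      have h1 := h1 x hx
      have h2 := (abs_le.1 (h2 x hx)).2
      simp only [hc'def, hedef, hHdef]
      linarith
    refine ⟨c', hc', hcp', fun k => ?_⟩
    -- The new residual is the change of the mean error, which is Λ⁻² times the old residual.
    have hd : ∀ a b, F.Symbol μ₀ (fun i => (Λ i)⁻¹ ^ (2 * (N + 1 + 1)))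
        (fun i x => meanError μ₀ Λ c' a b i x - meanError μ₀ Λ c a b i x) := fun a b => by
      have := Symbol.meanError_aux (σ := fun i => (Λ i)⁻¹ ^ (2 * (N + 1))) hμ₀ hΛ
        (fun i => pow_nonneg (hinv0 i) _)
        (fun k => Symbol.gradSq_sub hμ0 (hpow1 _) (hc k) (he' k) (hcp k) (hcp' k) a b)
      refine (this.congr (Eq.of_eq fun i x => ?_)).mono 1 (fun i => le_of_eq (by ring)) hμ0
      simp only [meanError, ← Finset.sum_sub_distrib, hc'def]
      exact Finset.sum_congr rfl fun k _ => by ring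
    refine (Symbol.coeff hd (0, Fin.ofNat n k)).congr (Eq.of_eq fun i x => ?_)
    rw [coeff_sub]
    simp only [hc'def, hedef]
    ring

/-- Approximate solution of the system `∂_a W ∂_b W - 2 W B_{ab} + ∂_a w_b + ∂_b w_a = h_{ab}`. -/
theorem exists_vonKarman (hμ₀ : ∀ i, 0 < μ₀ i) (hΛ : ∀ i, 1 ≤ Λ i) (hΛl : Tendsto Λ F.l atTop)
    {B h : Fin n → Fin n → ι → E n → ℝ}
    (hB : ∀ a b, F.Symbol μ₀ μ₀ (B a b)) (hBs : ∀ a b i x, B a b i x = B b a i x)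
    (hh : ∀ a b, F.Symbol μ₀ (fun _ => 1) (h a b)) (hhs : ∀ a b i x, h a b i x = h b a i x)
    (hpos : ∀ p, ∀ᶠ i in F.l, ∀ x ∈ F.D i, 3 / 4 ≤ NashKuiper.coeff (fun a b => h a b i x) p)
    (J : ℕ) :
    ∃ (W : ι → E n → ℝ) (w : Fin n → ι → E n → ℝ),
      F.Pot (fun i => (μ₀ i)⁻¹) (fun i => μ₀ i * Λ i ^ (J * (nStar n - n) + n)) (fun _ => 1) W ∧
      (∀ b, F.Pot (fun i => (μ₀ i)⁻¹) (fun i => μ₀ i * Λ i ^ (J * (nStar n - n) + n))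
        (fun _ => 1) (w b)) ∧
      ∀ a b, F.IsO (fun i => (Λ i ^ J)⁻¹) (fun i x => vonKarman W w B a b i x - h a b i x) := by
  have hΛ0 : ∀ i, 0 < Λ i := fun i => one_pos.trans_le (hΛ i)
  have hμ0 : ∀ i, 0 ≤ μ₀ i := fun i => (hμ₀ i).le
  have hinv1 : ∀ i, (Λ i)⁻¹ ≤ 1 := fun i => inv_le_one_of_one_le₀ (hΛ i)
  have hinv0 : ∀ i, 0 ≤ (Λ i)⁻¹ := fun i => (inv_pos.2 (hΛ0 i)).le
  have hlim : Tendsto (fun i => (Λ i)⁻¹) F.l (𝓝 0) := tendsto_inv_atTop_zero.comp hΛl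
  have hμn : ∀ i, 0 ≤ μ₀ i * Λ i ^ n := fun i => mul_nonneg (hμ0 i) (pow_pos (hΛ0 i) n).le
  have hmono : ∀ i, μ₀ i ≤ μ₀ i * Λ i ^ n := fun i =>
    le_mul_of_one_le_right (hμ₀ i).le (one_le_pow₀ (hΛ i))
  obtain ⟨c, hc, hcp, he⟩ := exists_amplitudes hμ₀ hΛ hΛl hh hpos J
  have hα : ∀ k, F.Symbol μ₀ (fun _ => 1) (fun i x => Real.sqrt (c k i x)) := fun k =>
    (hc k).sqrt one_half_pos (hcp k)
  obtain ⟨W, w, R, Er, hW, hw, hR, sR, zR, hE, heq⟩ := exists_first_family hμ₀ hΛ J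
    (fun k a => nu 0 (Fin.ofNat n k) a) (fun k => nu_zero_ne _) hα hB hBs n
  have hme : ∀ a b, F.Symbol μ₀ (fun i => (Λ i)⁻¹) (meanError μ₀ Λ c a b) := fun a b => by
    have := Symbol.meanError_aux (σ := fun _ => 1) hμ₀ hΛ (fun _ => zero_le_one)
      (fun k => ((hc k).gradSq hμ0 (hcp k) a b).mono 1 (fun i => by simp) hμ0)
    refine this.mono 1 (fun i => ?_) hμ0
    rw [one_mul, one_mul, sq]
    exact mul_le_of_le_one_right (hinv0 i) (hinv1 i)
  have hsmall : ∀ a b, F.Symbol (fun i => μ₀ i * Λ i ^ n) (fun i => (Λ i)⁻¹)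
      (fun i x => meanError μ₀ Λ c a b i x + R a b i x) := fun a b =>
    ((hme a b).freq_mono 1 (by simpa using hmono) hinv0 hμ0 hμn).add (hR a b)
  -- What is still to be produced after the mean errors and the remainders `R` of the first family
  -- are accounted for; through `R` it oscillates at frequency μ₀Λⁿ. It differs from h by O(Λ⁻¹), so
  -- its coefficients are eventually at least 1/2.
  set h' : Fin n → Fin n → ι → E n → ℝ := fun a b i x =>
    h a b i x - (meanError μ₀ Λ c a b i x + R a b i x) with hh'def
  have hh' : ∀ a b, F.Symbol (fun i => μ₀ i * Λ i ^ n) (fun _ => 1) (h' a b) := fun a b =>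
    ((hh a b).freq_mono 1 (by simpa using hmono) (fun _ => zero_le_one) hμ0 hμn).sub
      ((hsmall a b).mono 1 (by simpa using hinv1) hμn)
  have hbp : ∀ p, ∀ᶠ i in F.l, ∀ x ∈ F.D i,
      1 / 2 ≤ NashKuiper.coeff (fun a b => h' a b i x) p := fun p => by
    filter_upwards [hpos p, (Symbol.coeff hsmall p).isO.eventually_le hlim
        (by norm_num : (0 : ℝ) < 1 / 4)] with i h1 h2 x hx
    have h1 := h1 x hx
    have h2 := (abs_le.1 (h2 x hx)).2
    simp only [hh'def]
    rw [coeff_sub]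
    linarith
  have hβ : ∀ p, F.Symbol (fun i => μ₀ i * Λ i ^ n) (fun _ => 1)
      (fun i x => Real.sqrt (NashKuiper.coeff (fun a b => h' a b i x) p)) := fun p =>
    (Symbol.coeff hh' p).sqrt one_half_pos (hbp p)
  -- Only the pairs with first index different from 0 are used here: the coefficients of `h'` along
  -- ν_{0k} have already been produced by the first family.
  obtain ⟨W₁, w₁, Er₁, hW₁, hw₁, hE₁, heq₁⟩ := exists_second_family hμ₀ hΛ (innerPairs n) J n
    (fun p a => nu p.1 p.2 a) hβ hB hBs hW hw
  rw [card_innerPairs] at hW₁ hw₁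
  refine ⟨W₁, w₁, hW₁, hw₁, fun a b => ?_⟩
  have hfin : F.IsO (fun i => (Λ i ^ J)⁻¹) (fun i x =>
      (Er a b i x + Er₁ a b i x) + ∑ k ∈ Finset.range n, (c k i x -
        NashKuiper.coeff (fun a b => h a b i x - meanError μ₀ Λ c a b i x) (0, Fin.ofNat n k)) *
        (nu 0 (Fin.ofNat n k) a * nu 0 (Fin.ofNat n k) b)) := by
    refine ((hE a b).add (hE₁ a b)).add (IsO.sum _
      fun k _ => ?_)
    have := ((he k).isO.const_mul (nu 0 (Fin.ofNat n k) a * nu 0 (Fin.ofNat n k) b)).mono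
      (τ := fun i => (Λ i ^ J)⁻¹) 1 (fun i => ?_)
    · simpa only [mul_comm] using this
    · rw [one_mul, ← inv_pow]
      exact pow_le_pow_of_le_one (hinv0 i) (hinv1 i) (by omega)
  refine hfin.congr ?_
  have hev : ∀ᶠ i in F.l, ∀ k ∈ Finset.range n, (∀ x ∈ F.D i, 1 / 2 ≤ c k i x) ∧
      ∀ x ∈ F.D i, DifferentiableAt ℝ (c k i) x := by
    rw [Finset.eventually_all]
    exact fun k _ => (hcp k).and (hc k).smooth.differentiableAt
  have hevb : ∀ᶠ i in F.l, ∀ p ∈ innerPairs n,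
      ∀ x ∈ F.D i, 1 / 2 ≤ NashKuiper.coeff (fun a b => h' a b i x) p := by
    rw [Finset.eventually_all]
    exact fun p _ => hbp p
  filter_upwards [heq a b, heq₁ a b, hev, hevb] with i e0 e1 hc hb x hx
  have e0 := e0 hx
  have e1 := e1 hx
  simp only at e0 e1 ⊢
  rw [e1, e0]
  have h1 : ∑ p ∈ innerPairs n, Real.sqrt (NashKuiper.coeff (fun a b => h' a b i x) p) ^ 2 *
      (nu p.1 p.2 a * nu p.1 p.2 b) =
      ∑ p ∈ innerPairs n, NashKuiper.coeff (fun a b => h' a b i x) p *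
      (nu p.1 p.2 a * nu p.1 p.2 b) :=
    Finset.sum_congr rfl fun p hp => by
      rw [Real.sq_sqrt (one_half_pos.le.trans (hb p hp x hx))]
  have h2 : ∑ k ∈ Finset.range n, (Real.sqrt (c k i x) ^ 2 *
      (nu 0 (Fin.ofNat n k) a * nu 0 (Fin.ofNat n k) b) + (μ₀ i * Λ i ^ (k + 1))⁻¹ ^ 2 *
      (pd a (fun x => Real.sqrt (c k i x)) x * pd b (fun x => Real.sqrt (c k i x)) x)) =
      ∑ k ∈ Finset.range n, c k i x * (nu 0 (Fin.ofNat n k) a * nu 0 (Fin.ofNat n k) b) +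
      meanError μ₀ Λ c a b i x := by
    rw [meanError, ← Finset.sum_add_distrib]
    refine Finset.sum_congr rfl fun k hk => ?_
    have hp : 0 < c k i x := one_half_pos.trans_le ((hc k hk).1 x hx)
    have hd := (hc k hk).2 x hx
    rw [pd_sqrt _ hd hp.ne', pd_sqrt _ hd hp.ne', Real.sq_sqrt hp.le, gradSq]
    have hs : (Real.sqrt (c k i x))⁻¹ * (Real.sqrt (c k i x))⁻¹ = (c k i x)⁻¹ := by
      rw [← mul_inv, Real.mul_self_sqrt hp.le]
    rw [← hs]
    ring
  have hsymm : ∀ a b, h' a b i x = h' b a i x := fun a b => by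
    have : meanError μ₀ Λ c a b i x = meanError μ₀ Λ c b a i x := by
      simp only [meanError, gradSq, mul_comm (pd a _ x)]
    simp only [hh'def, sR a b, hhs a b, this]
  have h3 := sum_coeff_nu (fun a b => h' a b i x) hsymm a b
  rw [sum_pairs_eq] at h3
  -- The vanishing row of `R` makes its coefficients along ν_{0k} zero, so the first family needs to
  -- match only h minus the mean error, independently of `R`.
  have h4 : ∀ k, NashKuiper.coeff (fun a b => h' a b i x) (0, Fin.ofNat n k) =
      NashKuiper.coeff (fun a b => h a b i x - meanError μ₀ Λ c a b i x) (0, Fin.ofNat n k) := by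
    intro k
    have := coeff_sub (fun a b => h a b i x - meanError μ₀ Λ c a b i x) (fun a b => R a b i x)
      (0, Fin.ofNat n k)
    rw [coeff_eq_zero (fun a b => R a b i x) (fun b => zR b i x), sub_zero] at this
    rw [← this]
    simp only [hh'def, sub_sub]
  simp only [h4] at h3
  simp only [h1, h2, sub_mul, Finset.sum_sub_distrib]
  have h5 : h' a b i x = h a b i x - (meanError μ₀ Λ c a b i x + R a b i x) := rfl
  linear_combination h5 - h3

end Family
end NashKuiper

/-! ### Unit normal and dual frame with controlled derivatives. -/

namespace NashKuiper

open Filter Topology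
open scoped ContDiff

section algebra

variable {n : ℕ}

/-- A square matrix obtained by adding a zero column. -/
def addCol (M : Matrix (Fin (n + 1)) (Fin n) ℝ) : Matrix (Fin (n + 1)) (Fin (n + 1)) ℝ :=
  Matrix.of fun A j => Fin.lastCases (motive := fun _ => ℝ) 0 (fun b => M A b) j

lemma addCol_last (M : Matrix (Fin (n + 1)) (Fin n) ℝ) (A : Fin (n + 1)) :
    addCol M A (Fin.last n) = 0 := by
  simp [addCol]

lemma addCol_castSucc (M : Matrix (Fin (n + 1)) (Fin n) ℝ) (A : Fin (n + 1)) (b : Fin n) :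
    addCol M A b.castSucc = M A b := by
  simp [addCol]

/-- The vector of maximal minors, which is normal to the columns of `M`. -/
def minors (M : Matrix (Fin (n + 1)) (Fin n) ℝ) (A : Fin (n + 1)) : ℝ :=
  (addCol M).adjugate (Fin.last n) A

/-- The appended zero column makes the determinant vanish, so adjugate times matrix is zero; its
last row says that the minors are orthogonal to the columns of M. -/
lemma sum_minors_mul (M : Matrix (Fin (n + 1)) (Fin n) ℝ) (b : Fin n) :
    ∑ A, minors M A * M A b = 0 := by
  have h0 : (addCol M).det = 0 := Matrix.det_eq_zero_of_column_eq_zero (Fin.last n) (addCol_last M)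
  have h := congrFun (congrFun (Matrix.adjugate_mul (addCol M)) (Fin.last n)) b.castSucc
  rw [h0, zero_smul, Matrix.mul_apply] at h
  simp only [addCol_castSucc, Matrix.zero_apply] at h
  exact h

/-- Replace the appended column by a vector z ≠ 0 normal to the columns of M. The Gram determinant
of the new square matrix is |z|² det(MᵗM), and it is also the square of minors · z; Cauchy–Schwarz
concludes. -/
lemma det_le_sum_minors_sq (M : Matrix (Fin (n + 1)) (Fin n) ℝ) :
    (M.transpose * M).det ≤ ∑ A, minors M A ^ 2 := by
  have h0 : (addCol M).det = 0 := Matrix.det_eq_zero_of_column_eq_zero (Fin.last n) (addCol_last M)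
  obtain ⟨z, hz, hzM⟩ := Matrix.exists_vecMul_eq_zero_iff.2 h0
  have hz' : ∀ b, ∑ A, z A * M A b = 0 := fun b => by
    have := congrFun hzM b.castSucc
    simpa only [Matrix.vecMul, dotProduct, addCol_castSucc, Pi.zero_apply] using this
  set N := (addCol M).updateCol (Fin.last n) z with hN
  have hdet : N.det = ∑ A, minors M A * z A := by
    rw [hN, ← Matrix.cramer_apply, Matrix.cramer_eq_adjugate_mulVec]
    rfl
  have hNc : ∀ A (b : Fin n), N A b.castSucc = M A b := fun A b => by
    rw [hN, Matrix.updateCol_ne (Fin.castSucc_lt_last b).ne, addCol_castSucc]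
  have hNl : ∀ A, N A (Fin.last n) = z A := fun A => by
    rw [hN, Matrix.updateCol_self]
  have hsq : (N.transpose * N).det = (∑ A, z A ^ 2) * (M.transpose * M).det := by
    rw [Matrix.det_succ_row _ (Fin.last n), Fin.sum_univ_castSucc]
    have e1 : ∀ b : Fin n, (N.transpose * N) (Fin.last n) b.castSucc = 0 := fun b => by
      rw [Matrix.mul_apply]
      simpa only [Matrix.transpose_apply, hNc, hNl] using hz' b
    have e2 : (N.transpose * N) (Fin.last n) (Fin.last n) = ∑ A, z A ^ 2 := by
      rw [Matrix.mul_apply]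
      simp only [Matrix.transpose_apply, hNl, sq]
    have e3 : (N.transpose * N).submatrix (Fin.last n).succAbove (Fin.last n).succAbove =
        M.transpose * M := by
      ext a b
      rw [Matrix.submatrix_apply, Matrix.mul_apply, Matrix.mul_apply]
      simp only [Matrix.transpose_apply, Fin.succAbove_last, hNc]
    simp only [e1, e2, e3]
    simp
  have hpos : 0 < ∑ A, z A ^ 2 := by
    obtain ⟨A, hA⟩ := Function.ne_iff.1 hz
    exact Finset.sum_pos' (fun _ _ => sq_nonneg _) ⟨A, Finset.mem_univ _, by
      have : z A ≠ 0 := hA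
      positivity⟩
  rw [Matrix.det_mul, Matrix.det_transpose, hdet] at hsq
  have hcs := Finset.sum_mul_sq_le_sq_mul_sq Finset.univ (minors M) z
  have : (∑ A, z A ^ 2) * (M.transpose * M).det ≤ (∑ A, z A ^ 2) * ∑ A, minors M A ^ 2 := by
    rw [← hsq]; linarith
  exact le_of_mul_le_mul_left this hpos

end algebra

variable {ι : Type*} {n : ℕ}

namespace Family

variable {F : Family ι n} {μ₀ μ s : ι → ℝ} {f g : ι → E n → ℝ}

/-- `f = O(1)` is smooth at frequency `μ₀`, with derivatives smaller by the factor `s`. -/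
def Slow (F : Family ι n) (μ₀ s : ι → ℝ) (f : ι → E n → ℝ) : Prop :=
  F.Pot (fun _ => 1) μ₀ (fun i => s i * μ₀ i) f

namespace Slow

lemma symbol (hμ : ∀ i, 0 ≤ μ₀ i) (hs1 : ∀ i, s i ≤ 1) (hf : F.Slow μ₀ s f) :
    F.Symbol μ₀ (fun _ => 1) f :=
  Pot.symbol hf 1 (fun i => by
    have := mul_le_mul_of_nonneg_right (hs1 i) (hμ i)
    linarith) hμ

lemma const (c : ℝ) : F.Slow μ₀ s (fun _ _ => c) :=
  ⟨Smooth.const _, ⟨|c|, abs_nonneg c, Eventually.of_forall fun _ _ _ => by simp⟩, fun a =>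
    Symbol.zero.congr (Eq.of_eq fun _ _ => (pd_const a c).symm)⟩

lemma sum {κ : Type*} (S : Finset κ) {f : κ → ι → E n → ℝ} (hf : ∀ k ∈ S, F.Slow μ₀ s (f k)) :
    F.Slow μ₀ s (fun i x => ∑ k ∈ S, f k i x) :=
  Pot.sum S hf

lemma mul (hμ : ∀ i, 0 ≤ μ₀ i) (hs1 : ∀ i, s i ≤ 1) (hf : F.Slow μ₀ s f) (hg : F.Slow μ₀ s g) :
    F.Slow μ₀ s (fun i x => f i x * g i x) := by
  have h : ∀ i, s i * μ₀ i ≤ 1 * (1 * μ₀ i) := fun i => by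
    have := mul_le_mul_of_nonneg_right (hs1 i) (hμ i)
    linarith
  exact Pot.mul hf hg 1 hμ h h (by simp) (by simp) (by simp)

lemma prod {κ : Type*} (hμ : ∀ i, 0 ≤ μ₀ i) (hs1 : ∀ i, s i ≤ 1) (S : Finset κ)
    {f : κ → ι → E n → ℝ} (hf : ∀ k ∈ S, F.Slow μ₀ s (f k)) :
    F.Slow μ₀ s (fun i x => ∏ k ∈ S, f k i x) := by
  classical
  induction S using Finset.induction_on with
  | empty => simpa using const 1
  | insert a S ha ih =>
    simp only [Finset.prod_insert ha]
    exact (hf a (by simp)).mul hμ hs1 (ih fun k hk => hf k (by simp [hk]))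

/-- The Leibniz formula is a polynomial in the entries, and slow functions form an algebra. -/
lemma det {κ : Type*} [Fintype κ] [DecidableEq κ] (hμ : ∀ i, 0 ≤ μ₀ i) (hs1 : ∀ i, s i ≤ 1)
    {M : ι → E n → Matrix κ κ ℝ} (hM : ∀ a b, F.Slow μ₀ s (fun i x => M i x a b)) :
    F.Slow μ₀ s (fun i x => (M i x).det) := by
  simp only [Matrix.det_apply']
  exact sum _ fun σ _ => (const _).mul hμ hs1 (prod hμ hs1 _ fun k _ => hM _ _)

lemma adjugate {κ : Type*} [Fintype κ] [DecidableEq κ] (hμ : ∀ i, 0 ≤ μ₀ i)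
    (hs1 : ∀ i, s i ≤ 1) {M : ι → E n → Matrix κ κ ℝ}
    (hM : ∀ a b, F.Slow μ₀ s (fun i x => M i x a b)) (a b : κ) :
    F.Slow μ₀ s (fun i x => (M i x).adjugate a b) := by
  simp only [Matrix.adjugate_apply]
  refine det hμ hs1 fun c d => ?_
  simp only [Matrix.updateRow_apply]
  by_cases h : c = b
  · simpa only [h, if_true] using const _
  · simpa only [h, if_false] using hM c d

lemma inv (hμ : ∀ i, 0 ≤ μ₀ i) (hs1 : ∀ i, s i ≤ 1) (hf : F.Slow μ₀ s f) {c : ℝ} (hc : 0 < c)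
    (h : ∀ᶠ i in F.l, ∀ x ∈ F.D i, c ≤ f i x) : F.Slow μ₀ s (fun i x => (f i x)⁻¹) := by
  have hi := (hf.symbol hμ hs1).inv hc h
  refine ⟨hi.smooth, hi.isO, fun a => ?_⟩
  refine (((hf.pd a).mul_one' (hi.mul_one' hi)).const_mul (-1)).congr ?_
  filter_upwards [hf.smooth.differentiableAt, h] with i h4 h5 x hx
  exact (pd_inv a (h4 x hx) (hc.trans_le (h5 x hx)).ne').symm

lemma sqrt (hμ : ∀ i, 0 ≤ μ₀ i) (hs1 : ∀ i, s i ≤ 1) (hf : F.Slow μ₀ s f) {c : ℝ} (hc : 0 < c)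
    (h : ∀ᶠ i in F.l, ∀ x ∈ F.D i, c ≤ f i x) : F.Slow μ₀ s (fun i x => Real.sqrt (f i x)) := by
  have hq := (hf.symbol hμ hs1).sqrt hc h
  have hi := hq.inv (c := Real.sqrt c) (Real.sqrt_pos.2 hc) (by
    filter_upwards [h] with i h x hx using Real.sqrt_le_sqrt (h x hx))
  refine ⟨hq.smooth, hq.isO, fun a => ?_⟩
  refine (((hf.pd a).mul_one' hi).const_mul (1 / 2)).congr ?_
  filter_upwards [hf.smooth.differentiableAt, h] with i h4 h5 x hx
  exact (pd_sqrt a (h4 x hx) (hc.trans_le (h5 x hx)).ne').symm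

end Slow

/-- The matrix `(M A b)` as a function on the domain. -/
def jac (U : Fin (n + 1) → Fin n → ι → E n → ℝ) (i : ι) (x : E n) :
    Matrix (Fin (n + 1)) (Fin n) ℝ := Matrix.of fun A b => U A b i x

/-- Existence of a unit normal with controlled derivatives. -/
lemma exists_normal (hμ : ∀ i, 0 ≤ μ₀ i) (hs1 : ∀ i, s i ≤ 1)
    {U : Fin (n + 1) → Fin n → ι → E n → ℝ} (hU : ∀ A b, F.Slow μ₀ s (U A b)) {c : ℝ} (hc : 0 < c)
    (hdet : ∀ᶠ i in F.l, ∀ x ∈ F.D i, c ≤ ((jac U i x).transpose * jac U i x).det) :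
    ∃ ζ : Fin (n + 1) → ι → E n → ℝ, (∀ A, F.Slow μ₀ s (ζ A)) ∧
      (∀ᶠ i in F.l, ∀ x ∈ F.D i, ∑ A, ζ A i x ^ 2 = 1) ∧
      ∀ b, ∀ i x, ∑ A, ζ A i x * U A b i x = 0 := by
  -- The normal is the normalised vector of maximal minors. The lower bound on the Gram determinant
  -- keeps its length away from zero.
  have hm : ∀ A, F.Slow μ₀ s (fun i x => minors (jac U i x) A) := fun A => by
    refine Slow.adjugate (M := fun i x => addCol (jac U i x)) hμ hs1 (fun B j => ?_) _ _
    induction j using Fin.lastCases with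
    | last => simpa only [addCol_last] using Slow.const 0
    | cast b => simpa only [addCol_castSucc, jac, Matrix.of_apply] using hU B b
  have hq : F.Slow μ₀ s (fun i x => ∑ A, minors (jac U i x) A ^ 2) := by
    simp only [sq]
    exact Slow.sum _ fun A _ => (hm A).mul hμ hs1 (hm A)
  have hqc : ∀ᶠ i in F.l, ∀ x ∈ F.D i, c ≤ ∑ A, minors (jac U i x) A ^ 2 := by
    filter_upwards [hdet] with i h x hx
    exact (h x hx).trans (det_le_sum_minors_sq _)
  have hi := (hq.sqrt hμ hs1 hc hqc).inv hμ hs1 (Real.sqrt_pos.2 hc) (by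
    filter_upwards [hqc] with i h x hx using Real.sqrt_le_sqrt (h x hx))
  refine ⟨fun A i x => minors (jac U i x) A * (Real.sqrt (∑ A, minors (jac U i x) A ^ 2))⁻¹,
    fun A => (hm A).mul hμ hs1 hi, ?_, fun b i x => ?_⟩
  · filter_upwards [hqc] with i h x hx
    have hp := hc.trans_le (h x hx)
    simp only [mul_pow, ← Finset.sum_mul]
    rw [inv_pow, Real.sq_sqrt hp.le, mul_inv_cancel₀ hp.ne']
  · have := sum_minors_mul (jac U i x) b
    simp only [jac, Matrix.of_apply] at this ⊢
    rw [← zero_mul (Real.sqrt (∑ A, minors (Matrix.of fun A b => U A b i x) A ^ 2))⁻¹, ← this,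
      Finset.sum_mul]
    exact Finset.sum_congr rfl fun A _ => by ring

/-- Existence of a dual frame: tangential fields `Q_c` with `∂_a u · Q_c = δ_{ac}`. -/
lemma exists_dual (hμ : ∀ i, 0 ≤ μ₀ i) (hs1 : ∀ i, s i ≤ 1)
    {U : Fin (n + 1) → Fin n → ι → E n → ℝ} (hU : ∀ A b, F.Slow μ₀ s (U A b)) {c : ℝ} (hc : 0 < c)
    (hdet : ∀ᶠ i in F.l, ∀ x ∈ F.D i, c ≤ ((jac U i x).transpose * jac U i x).det) :
    ∃ Q : Fin (n + 1) → Fin n → ι → E n → ℝ, (∀ A b, F.Slow μ₀ s (Q A b)) ∧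
      ∀ᶠ i in F.l, ∀ x ∈ F.D i, ∀ a b, ∑ A, U A a i x * Q A b i x = if a = b then 1 else 0 := by
  -- The frame is U G⁻¹ with G the Gram matrix. Writing the inverse as adjugate over determinant
  -- keeps it slow.
  set G : ι → E n → Matrix (Fin n) (Fin n) ℝ := fun i x => (jac U i x).transpose * jac U i x
  have hG : ∀ a b, F.Slow μ₀ s (fun i x => G i x a b) := fun a b => by
    simp only [G, Matrix.mul_apply, Matrix.transpose_apply, jac, Matrix.of_apply]
    exact Slow.sum _ fun A _ => (hU A a).mul hμ hs1 (hU A b)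
  have hd := Slow.det hμ hs1 hG
  have hdi := hd.inv hμ hs1 hc hdet
  have hinv : ∀ a b, F.Slow μ₀ s (fun i x => (G i x)⁻¹ a b) := fun a b => by
    simp only [Matrix.inv_def, Ring.inverse_eq_inv', Matrix.smul_apply, smul_eq_mul]
    exact hdi.mul hμ hs1 (Slow.adjugate hμ hs1 hG a b)
  refine ⟨fun A b i x => ∑ d, U A d i x * (G i x)⁻¹ d b, fun A b =>
    Slow.sum _ fun d _ => (hU A d).mul hμ hs1 (hinv d b), ?_⟩
  filter_upwards [hdet] with i h x hx a b
  have hu : IsUnit (G i x).det := (hc.trans_le (h x hx)).ne'.isUnit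
  have h1 := congrFun (congrFun (Matrix.mul_nonsing_inv (G i x) hu) a) b
  rw [Matrix.mul_apply, Matrix.one_apply] at h1
  rw [← h1]
  simp only [Finset.mul_sum]
  rw [Finset.sum_comm]
  refine Finset.sum_congr rfl fun d _ => ?_
  simp only [G, Matrix.mul_apply, Matrix.transpose_apply, jac, Matrix.of_apply]
  rw [Finset.sum_mul]
  exact Finset.sum_congr rfl fun A _ => by ring

end Family
end NashKuiper

/-! ### Expansion of the induced metric. -/

namespace NashKuiper

open Filter Topology
open scoped ContDiff

variable {ι : Type*} {n : ℕ}

namespace Family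

variable {F : Family ι n} {μ₀ μ s : ι → ℝ}

lemma pd_sum_mul_eq {m : ℕ} {f g : Fin m → ι → E n → ℝ} (hf : ∀ A, F.Smooth (f A))
    (hg : ∀ A, F.Smooth (g A)) (a : Fin n) :
    F.Eq (fun i => NashKuiper.pd a (fun x => ∑ A, f A i x * g A i x))
      (fun i x => ∑ A, f A i x * NashKuiper.pd a (g A i) x +
        ∑ A, NashKuiper.pd a (f A i) x * g A i x) := by
  have h1 : ∀ᶠ i in F.l, ∀ A, ∀ x ∈ F.D i, DifferentiableAt ℝ (f A i) x :=
    eventually_all.2 fun A => (hf A).differentiableAt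
  have h2 : ∀ᶠ i in F.l, ∀ A, ∀ x ∈ F.D i, DifferentiableAt ℝ (g A i) x :=
    eventually_all.2 fun A => (hg A).differentiableAt
  filter_upwards [h1, h2] with i h1 h2 x hx
  simp only
  rw [pd_sum _ _ (fun A _ => (h1 A x hx).fun_mul (h2 A x hx)), ← Finset.sum_add_distrib]
  exact Finset.sum_congr rfl fun A _ => pd_mul _ (h1 A x hx) (h2 A x hx)

/-- The normalised second fundamental form. -/
noncomputable def secondForm (s : ι → ℝ) (u ζ : Fin (n + 1) → ι → E n → ℝ) (a b : Fin n) (i : ι)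
    (x : E n) : ℝ :=
  (s i)⁻¹ * (1 / 2 * ∑ A, (pd a (pd b (u A i)) x + pd b (pd a (u A i)) x) * ζ A i x)

/-- Second derivatives of u are O(s μ₀), so division by s gives size μ₀, exactly what the von Kármán
system allows for B. -/
lemma Symbol.secondForm (hs : ∀ i, 0 < s i) (hs1 : ∀ i, s i ≤ 1) (hμ : ∀ i, 0 ≤ μ₀ i)
    {u ζ : Fin (n + 1) → ι → E n → ℝ} (hu : ∀ A b, F.Slow μ₀ s (fun i => NashKuiper.pd b (u A i)))
    (hζ : ∀ A, F.Slow μ₀ s (ζ A)) (a b : Fin n) :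
    F.Symbol μ₀ μ₀ (Family.secondForm s u ζ a b) := by
  refine ((((Symbol.sum Finset.univ fun A _ => ((((hu A b).pd a).add ((hu A a).pd b)).mul_one'
    ((hζ A).symbol hμ hs1))).const_mul (1 / 2)).smul fun i => (s i)⁻¹)).mono 1 (fun i => ?_) hμ
  rw [abs_of_pos (inv_pos.2 (hs i)), one_mul, inv_mul_cancel_left₀ (hs i).ne']

lemma secondForm_symm (s : ι → ℝ) (u ζ : Fin (n + 1) → ι → E n → ℝ) (a b : Fin n) (i : ι)
    (x : E n) : secondForm s u ζ a b i x = secondForm s u ζ b a i x := by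
  simp only [secondForm, add_comm]

/-- The metric of the perturbed map `u + s W ζ + s² P`. -/
theorem metric_expansion (hs : ∀ i, 0 < s i) (hs1 : ∀ i, s i ≤ 1) (hμ₀ : ∀ i, 0 < μ₀ i)
    {u ζ : Fin (n + 1) → ι → E n → ℝ} (hus : ∀ A, F.Smooth (u A))
    (hu : ∀ A b, F.Slow μ₀ s (fun i => pd b (u A i)))
    (hζ : ∀ A, F.Slow μ₀ s (ζ A))
    (hζ1 : ∀ᶠ i in F.l, ∀ x ∈ F.D i, ∑ A, ζ A i x ^ 2 = 1)
    (hζu : ∀ b, ∀ i x, ∑ A, ζ A i x * pd b (u A i) x = 0)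
    {W : ι → E n → ℝ} {w : Fin n → ι → E n → ℝ} {P : Fin (n + 1) → ι → E n → ℝ}
    (hW : F.Pot (fun i => (μ₀ i)⁻¹) μ (fun _ => 1) W)
    (hP : ∀ A, F.Pot (fun i => (μ₀ i)⁻¹) μ (fun _ => 1) (P A))
    (hPw : ∀ a, F.Eq (fun i x => ∑ A, pd a (u A i) x * P A i x) (w a)) (a b : Fin n) :
    F.IsO (fun i => s i ^ 3) (fun i x =>
      ∑ A, pd a (fun x => u A i x + (s i * (W i x * ζ A i x) + s i ^ 2 * P A i x)) x *
        pd b (fun x => u A i x + (s i * (W i x * ζ A i x) + s i ^ 2 * P A i x)) x -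
      ∑ A, pd a (u A i) x * pd b (u A i) x -
      s i ^ 2 * vonKarman W w (secondForm s u ζ) a b i x) := by
  have hμ0 : ∀ i, 0 ≤ μ₀ i := fun i => (hμ₀ i).le
  have hs0 : ∀ i, 0 ≤ s i := fun i => (hs i).le
  have oW : F.IsO (fun i => (μ₀ i)⁻¹) W := hW.isO
  have odW : ∀ a, F.IsO (fun _ => 1) (fun i => pd a (W i)) := fun a => (hW.pd a).isO
  have oP : ∀ A, F.IsO (fun i => (μ₀ i)⁻¹) (P A) := fun A => (hP A).isO
  have odP : ∀ a A, F.IsO (fun _ => 1) (fun i => pd a (P A i)) := fun a A => ((hP A).pd a).isO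
  have oζ : ∀ A, F.IsO (fun _ => 1) (ζ A) := fun A => (hζ A).isO
  have odζ : ∀ a A, F.IsO (fun i => s i * μ₀ i) (fun i => pd a (ζ A i)) := fun a A =>
    ((hζ A).pd a).isO
  have oddu : ∀ a b A, F.IsO (fun i => s i * μ₀ i) (fun i => pd a (pd b (u A i))) := fun a b A =>
    ((hu A b).pd a).isO
  have oX : ∀ a A, F.IsO (fun _ => 1)
      (fun i x => pd a (W i) x * ζ A i x + W i x * pd a (ζ A i) x) := fun a A =>
    (((odW a).mul (oζ A)).mono 1 (by simp)).add ((oW.mul (odζ a A)).mono 1 fun i => by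
      have := hs1 i
      rw [mul_comm (s i), inv_mul_cancel_left₀ (hμ₀ i).ne']; simpa)
  have osc_ : ∀ k : ℕ, F.IsO (fun i => s i ^ k) (fun i _ => s i ^ k) := fun k =>
    ⟨1, zero_le_one, Eventually.of_forall fun i _ _ => by
      rw [one_mul, abs_of_nonneg (pow_nonneg (hs0 i) k)]⟩
  have hs3 : ∀ i, 0 ≤ s i ^ 3 := fun i => pow_nonneg (hs0 i) 3
  -- The four remainders: P against ∂∂u, where P = O(μ₀⁻¹) and ∂∂u = O(sμ₀); the square of W ∂ζ =
  -- O(s); the cross terms of order s³; and the square of s² ∂P.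
  have r1 : F.IsO (fun i => s i ^ 3) (fun i x => s i ^ 2 *
      ∑ A, ((-1) * ((pd a (pd b (u A i)) x + pd b (pd a (u A i)) x) * P A i x))) := by
    refine ((osc_ 2).mul (IsO.sum Finset.univ fun A _ => IsO.const_mul ?_ (-1))).mono 1
      fun i => le_of_eq (by ring)
    exact (((oddu a b A).add (oddu b a A)).mul (oP A)).mono 1 fun i => le_of_eq (by
      have := (hμ₀ i).ne'; field_simp)
  have r2 : F.IsO (fun i => s i ^ 3) (fun i x => s i ^ 2 *
      ∑ A, ((W i x * pd a (ζ A i) x) * (W i x * pd b (ζ A i) x))) := by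
    have h1 : ∀ a A, F.IsO s (fun i x => W i x * pd a (ζ A i) x) := fun a A =>
      (oW.mul (odζ a A)).mono 1 fun i => le_of_eq (by
        have := (hμ₀ i).ne'; field_simp)
    refine ((osc_ 2).mul (IsO.sum Finset.univ fun A _ =>
      ((h1 a A).mul (h1 b A)).mono 1 fun i => ?_)).mono 1 fun i => le_of_eq (by ring)
    rw [one_mul]
    exact mul_le_of_le_one_right (hs0 i) (hs1 i)
  have r3 : F.IsO (fun i => s i ^ 3) (fun i x => s i ^ 3 * ∑ A,
      ((pd a (W i) x * ζ A i x + W i x * pd a (ζ A i) x) * pd b (P A i) x +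
      (pd b (W i) x * ζ A i x + W i x * pd b (ζ A i) x) * pd a (P A i) x)) := by
    refine ((osc_ 3).mul (IsO.sum (σ := fun _ => 1) Finset.univ fun A _ =>
      ?_)).mono 1 fun i => by simp
    exact (((oX a A).mul (odP b A)).add ((oX b A).mul (odP a A))).mono 1 (by simp)
  have r4 : F.IsO (fun i => s i ^ 3) (fun i x => s i ^ 4 * ∑ A,
      (pd a (P A i) x * pd b (P A i) x)) := by
    refine ((osc_ 4).mul (IsO.sum (σ := fun _ => 1) Finset.univ fun A _ =>
      ((odP a A).mul (odP b A)).mono 1 (by simp))).mono 1 fun i => ?_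
    have := mul_le_of_le_one_right (hs3 i) (hs1 i)
    nlinarith
  refine (((r1.add r2).add r3).add r4).congr ?_
  have ev : ∀ {f : Fin (n + 1) → ι → E n → ℝ}, (∀ A, F.Smooth (f A)) →
      ∀ᶠ i in F.l, ∀ A, ∀ x ∈ F.D i, DifferentiableAt ℝ (f A i) x := fun h =>
    eventually_all.2 fun A => (h A).differentiableAt
  have hζs := fun A => (hζ A).smooth
  have hPs := fun A => (hP A).smooth
  filter_upwards [ev hus, ev hζs, ev hPs, hW.smooth.differentiableAt, hζ1,
    pd_sum_mul_eq hζs hζs a, pd_sum_mul_eq hζs hζs b,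
    pd_sum_mul_eq hζs (fun A => (hu A a).smooth) b, pd_sum_mul_eq hζs (fun A => (hu A b).smooth) a,
    pd_sum_mul_eq (fun A => (hu A a).smooth) hPs b, pd_sum_mul_eq (fun A => (hu A b).smooth) hPs a,
    (hPw a).pd b, (hPw b).pd a] with i du dζ dP dW hn n1 n2 t1 t2 q1 q2 w1 w2 x hx
  have hcongr : ∀ c, pd c (fun x => ∑ A, ζ A i x * ζ A i x) x = 0 := fun c => by
    rw [pd_congr c (F.isOpen i) (g := fun _ => 1) (fun y hy => by
      simpa only [sq] using hn y hy) hx, pd_const]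
  have n1 := (n1 hx).symm.trans (hcongr a)
  have n2 := (n2 hx).symm.trans (hcongr b)
  -- Differentiating ζ · ∂_d u = 0 trades ∂ζ · ∂u for −ζ · ∂∂u and so produces the second
  -- fundamental form. Likewise |ζ|² = 1 gives ζ · ∂ζ = 0, and P · ∂_a u = w_a gives the symmetrised
  -- gradient of w up to P · ∂∂u.
  have hz : ∀ c d, pd c (fun x => ∑ A, ζ A i x * pd d (u A i) x) x = 0 := fun c d => by
    simp only [hζu d i, pd_const]
  have t1 := (t1 hx).symm.trans (hz b a)
  have t2 := (t2 hx).symm.trans (hz a b)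
  have q1 := (q1 hx).symm.trans (w1 hx)
  have q2 := (q2 hx).symm.trans (w2 hx)
  have o1 := hζu a i x
  have o2 := hζu b i x
  have hn := hn x hx
  have hpd : ∀ c A, pd c (fun x => u A i x + (s i * (W i x * ζ A i x) + s i ^ 2 * P A i x)) x =
      pd c (u A i) x + (s i * (W i x * pd c (ζ A i) x + pd c (W i) x * ζ A i x) +
        s i ^ 2 * pd c (P A i) x) := fun c A => by
    have h1 := (dW x hx).fun_mul (dζ A x hx)
    rw [pd_add _ (du A x hx) ((h1.const_mul _).fun_add ((dP A x hx).const_mul _)),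
      pd_add _ (h1.const_mul _) ((dP A x hx).const_mul _), pd_const_mul _ _ h1,
      pd_const_mul _ _ (dP A x hx), pd_mul _ (dW x hx) (dζ A x hx)]
  have hB : s i * secondForm s u ζ a b i x =
      1 / 2 * ∑ A, (pd a (pd b (u A i)) x + pd b (pd a (u A i)) x) * ζ A i x := by
    rw [secondForm, mul_inv_cancel_left₀ (hs i).ne']
  have hB' : ∑ A, (pd a (pd b (u A i)) x + pd b (pd a (u A i)) x) * ζ A i x =
      ∑ A, ζ A i x * pd a (pd b (u A i)) x + ∑ A, ζ A i x * pd b (pd a (u A i)) x := by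
    rw [← Finset.sum_add_distrib]
    exact Finset.sum_congr rfl fun A _ => by ring
  have expand : ∑ A, pd a (fun x => u A i x + (s i * (W i x * ζ A i x) + s i ^ 2 * P A i x)) x *
        pd b (fun x => u A i x + (s i * (W i x * ζ A i x) + s i ^ 2 * P A i x)) x =
      ∑ A, pd a (u A i) x * pd b (u A i) x +
      s i * pd b (W i) x * ∑ A, ζ A i x * pd a (u A i) x +
      s i * pd a (W i) x * ∑ A, ζ A i x * pd b (u A i) x +
      s i * W i x * (∑ A, pd b (ζ A i) x * pd a (u A i) x +
        ∑ A, pd a (ζ A i) x * pd b (u A i) x) +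
      s i ^ 2 * (∑ A, pd a (u A i) x * pd b (P A i) x + ∑ A, pd b (u A i) x * pd a (P A i) x) +
      s i ^ 2 * (pd a (W i) x * pd b (W i) x) * ∑ A, ζ A i x ^ 2 +
      s i ^ 2 * (pd a (W i) x * W i x) * ∑ A, ζ A i x * pd b (ζ A i) x +
      s i ^ 2 * (pd b (W i) x * W i x) * ∑ A, ζ A i x * pd a (ζ A i) x +
      s i ^ 2 * ∑ A, ((W i x * pd a (ζ A i) x) * (W i x * pd b (ζ A i) x)) +
      s i ^ 3 * ∑ A,
      ((pd a (W i) x * ζ A i x + W i x * pd a (ζ A i) x) * pd b (P A i) x +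
      (pd b (W i) x * ζ A i x + W i x * pd b (ζ A i) x) * pd a (P A i) x) +
      s i ^ 4 * ∑ A, (pd a (P A i) x * pd b (P A i) x) := by
    simp only [mul_add, Finset.mul_sum, ← Finset.sum_add_distrib]
    refine Finset.sum_congr rfl fun A _ => ?_
    rw [hpd, hpd]
    ring
  have hc : ∀ c, ∑ A, pd c (ζ A i) x * ζ A i x = ∑ A, ζ A i x * pd c (ζ A i) x := fun c =>
    Finset.sum_congr rfl fun A _ => mul_comm _ _
  have hsplit : ∑ A, (-1) * ((pd a (pd b (u A i)) x + pd b (pd a (u A i)) x) * P A i x) =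
      - ∑ A, pd a (pd b (u A i)) x * P A i x - ∑ A, pd b (pd a (u A i)) x * P A i x := by
    rw [← Finset.sum_neg_distrib, ← Finset.sum_sub_distrib]
    exact Finset.sum_congr rfl fun A _ => by ring
  simp only [hc] at n1 n2
  simp only [vonKarman]
  rw [expand, hsplit, o1, o2, hn]
  rw [hB'] at hB
  linear_combination (-(s i ^ 2)) * (pd a (W i) x * W i x) / 2 * n2 -
    s i ^ 2 * (pd b (W i) x * W i x) / 2 * n1 - s i * W i x * (t1 + t2) - s i ^ 2 * (q1 + q2) -
    2 * s i * W i x * hB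

end Family
end NashKuiper

/-! ### Mollification with smooth kernels. -/

namespace NashKuiper

open Filter Topology MeasureTheory
open scoped ContDiff Convolution

variable {n : ℕ}

/-- Smooth functions supported in the unit ball. -/
structure IsKernel (ψ : E n → ℝ) : Prop where
  contDiff : ContDiff ℝ ∞ ψ
  zero : ∀ y, 1 < ‖y‖ → ψ y = 0

lemma IsKernel.hasCompactSupport {ψ : E n → ℝ} (h : IsKernel ψ) : HasCompactSupport ψ :=
  HasCompactSupport.intro (isCompact_closedBall 0 1) fun y hy => h.zero y (by simpa using hy)

lemma IsKernel.pd {ψ : E n → ℝ} (h : IsKernel ψ) (a : Fin n) : IsKernel (pd a ψ) where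
  contDiff := contDiffOn_univ.1 (ContDiffOn.pd a isOpen_univ h.contDiff.contDiffOn (by simp))
  zero y hy := by
    have ho : IsOpen {y : E n | 1 < ‖y‖} := isOpen_lt continuous_const continuous_norm
    rw [pd_congr a ho (g := fun _ => 0) (fun z hz => h.zero z hz) hy, pd_const]

lemma IsKernel.integrable {ψ : E n → ℝ} (h : IsKernel ψ) : Integrable ψ :=
  h.contDiff.continuous.integrable_of_hasCompactSupport h.hasCompactSupport

/-- Mollification of `f` at scale `ℓ` with the kernel `ψ`. -/
noncomputable def moll (ψ : E n → ℝ) (ℓ : ℝ) (f : E n → ℝ) (x : E n) : ℝ :=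
  ∫ y, ψ y * f (x - ℓ • y)

section moll

variable {ψ φ f g : E n → ℝ} {ℓ : ℝ}

lemma integrable_moll (hψ : IsKernel ψ) (hf : Continuous f) (x : E n) :
    Integrable fun y => ψ y * f (x - ℓ • y) :=
  (hψ.contDiff.continuous.mul (hf.comp (by fun_prop))).integrable_of_hasCompactSupport
    hψ.hasCompactSupport.mul_right

lemma moll_const_mul (c : ℝ) (x : E n) :
    moll ψ ℓ (fun y => c * f y) x = c * moll ψ ℓ f x := by
  simp only [moll, ← integral_const_mul]
  congr 1
  ext y
  ring

lemma moll_sub (hψ : IsKernel ψ) (hf : Continuous f) (hg : Continuous g) (x : E n) :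
    moll ψ ℓ (fun y => f y - g y) x = moll ψ ℓ f x - moll ψ ℓ g x := by
  simp only [moll, mul_sub]
  exact integral_sub (integrable_moll hψ hf x) (integrable_moll hψ hg x)

lemma moll_sum {κ : Type*} (s : Finset κ) {f : κ → E n → ℝ} (hψ : IsKernel ψ)
    (hf : ∀ k ∈ s, Continuous (f k)) (x : E n) :
    moll ψ ℓ (fun y => ∑ k ∈ s, f k y) x = ∑ k ∈ s, moll ψ ℓ (f k) x := by
  simp only [moll, Finset.mul_sum]
  exact integral_finsetSum _ fun k hk => integrable_moll hψ (hf k hk) x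

lemma abs_moll_le (hψ : IsKernel ψ) (hℓ : 0 < ℓ) {x : E n} {K : ℝ}
    (hK : ∀ z, ‖z - x‖ ≤ ℓ → |f z| ≤ K) : |moll ψ ℓ f x| ≤ (∫ y, |ψ y|) * K := by
  rw [← integral_mul_const, moll, ← Real.norm_eq_abs]
  refine norm_integral_le_of_norm_le (hψ.integrable.abs.mul_const K)
    (Eventually.of_forall fun y => ?_)
  rw [norm_mul, Real.norm_eq_abs, Real.norm_eq_abs]
  by_cases hy : 1 < ‖y‖
  · simp [hψ.zero y hy]
  · refine mul_le_mul_of_nonneg_left (hK _ ?_) (abs_nonneg _)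
    rw [sub_sub_cancel_left, norm_neg, norm_smul, Real.norm_of_nonneg hℓ.le]
    exact mul_le_of_le_one_right hℓ.le (not_lt.1 hy)

lemma moll_eq_convolution (hℓ : 0 < ℓ) :
    moll ψ ℓ f = fun x =>
      (ψ ⋆[ContinuousLinearMap.mul ℝ ℝ, volume] fun z => f (ℓ • z)) (ℓ⁻¹ • x) := by
  ext x
  simp only [moll, convolution_def, ContinuousLinearMap.mul_apply']
  congr 1
  ext y
  rw [smul_sub, smul_inv_smul₀ hℓ.ne']

lemma pd_comp_smul {h : E n → ℝ} (c : ℝ) (x : E n) (a : Fin n)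
    (hh : DifferentiableAt ℝ h (c • x)) :
    pd a (fun x => h (c • x)) x = c * pd a h (c • x) := by
  have h1 : HasFDerivAt (fun x : E n => c • x) (c • ContinuousLinearMap.id ℝ (E n)) x :=
    (hasFDerivAt_id x).const_smul c
  have := (hh.hasFDerivAt.comp x h1).fderiv
  simp only [pd]
  rw [show (fun x => h (c • x)) = h ∘ fun x => c • x from rfl, this]
  simp

lemma hasFDerivAt_kernel_convolution (hψ : IsKernel ψ) (hf : Continuous f) (x : E n) :
    DifferentiableAt ℝ (ψ ⋆[ContinuousLinearMap.mul ℝ ℝ, volume] f) x ∧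
    ∀ a, pd a (ψ ⋆[ContinuousLinearMap.mul ℝ ℝ, volume] f) x =
      (pd a ψ ⋆[ContinuousLinearMap.mul ℝ ℝ, volume] f) x := by
  have h1 : ContDiff ℝ 1 ψ := hψ.contDiff.of_le (WithTop.coe_le_coe.2 le_top)
  have h := hψ.hasCompactSupport.hasFDerivAt_convolution_right
    (ContinuousLinearMap.mul ℝ ℝ).flip (hf.locallyIntegrable (μ := volume)) h1 x
  rw [convolution_flip] at h
  refine ⟨h.differentiableAt, fun a => ?_⟩
  rw [pd, h.fderiv, convolution_precompR_apply _ hf.locallyIntegrable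
    (hψ.hasCompactSupport.fderiv ℝ) (h1.continuous_fderiv one_ne_zero), convolution_flip]
  rfl

lemma contDiff_moll (hψ : IsKernel ψ) (hℓ : 0 < ℓ) (hf : Continuous f) :
    ContDiff ℝ ∞ (moll ψ ℓ f) := by
  rw [moll_eq_convolution hℓ]
  have h := hψ.hasCompactSupport.contDiff_convolution_left (ContinuousLinearMap.mul ℝ ℝ)
    (n := ⊤) hψ.contDiff ((hf.comp (continuous_const_smul ℓ)).locallyIntegrable (μ := volume))
  exact h.comp (contDiff_const_smul _)

/-- The derivative falls on the kernel at the cost of ℓ⁻¹, and ∂ψ is again a kernel; the formula can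
therefore be iterated without regularity of f. -/
lemma pd_moll (hψ : IsKernel ψ) (hℓ : 0 < ℓ) (hf : Continuous f) (a : Fin n) (x : E n) :
    pd a (moll ψ ℓ f) x = ℓ⁻¹ * moll (pd a ψ) ℓ f x := by
  have h := hasFDerivAt_kernel_convolution hψ (hf.comp (continuous_const_smul ℓ)) (ℓ⁻¹ • x)
  rw [moll_eq_convolution hℓ, moll_eq_convolution hℓ]
  have := pd_comp_smul ℓ⁻¹ x a h.1
  rw [h.2] at this
  exact this

lemma pd_moll' (hψ : IsKernel ψ) (hℓ : 0 < ℓ) (hf : ContDiff ℝ 1 f) (hfc : HasCompactSupport f)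
    (a : Fin n) (x : E n) : pd a (moll ψ ℓ f) x = moll ψ ℓ (pd a f) x := by
  have h1 : ContDiff ℝ 1 fun z => f (ℓ • z) := hf.comp (contDiff_const_smul ℓ)
  have hc : HasCompactSupport fun z => f (ℓ • z) := hfc.comp_smul hℓ.ne'
  have h := hc.hasFDerivAt_convolution_right (ContinuousLinearMap.mul ℝ ℝ)
    (hψ.contDiff.continuous.locallyIntegrable (μ := volume)) h1 (ℓ⁻¹ • x)
  rw [moll_eq_convolution hℓ, pd_comp_smul ℓ⁻¹ x a h.differentiableAt, pd, h.fderiv,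
    convolution_precompR_apply _ hψ.contDiff.continuous.locallyIntegrable
    (hc.fderiv ℝ) (h1.continuous_fderiv one_ne_zero)]
  have e : (fun z => fderiv ℝ (fun z => f (ℓ • z)) z (EuclideanSpace.single a 1)) =
      fun z => ℓ * pd a f (ℓ • z) := by
    ext z
    exact pd_comp_smul ℓ z a ((hf.differentiable one_ne_zero) _)
  rw [e, moll, convolution_def, ← integral_const_mul]
  refine integral_congr_ae (Eventually.of_forall fun y => ?_)
  simp only [ContinuousLinearMap.mul_apply']
  rw [smul_sub, smul_inv_smul₀ hℓ.ne']
  field_simp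

lemma norm_fderiv_le_of_pd {x : E n} {K : ℝ} (hK0 : 0 ≤ K) (h : ∀ a, |pd a f x| ≤ K) :
    ‖fderiv ℝ f x‖ ≤ n * K := by
  refine ContinuousLinearMap.opNorm_le_bound _ (by positivity) fun v => ?_
  have hv : v = ∑ a, v a • EuclideanSpace.single a (1 : ℝ) := by
    ext b
    simp [Pi.single_apply]
  have : fderiv ℝ f x v = ∑ a, v a * pd a f x := by
    conv_lhs => rw [hv]
    simp [map_sum, pd]
  rw [this]
  refine (norm_sum_le _ _).trans ?_
  calc _ ≤ ∑ _a : Fin n, ‖v‖ * K := Finset.sum_le_sum fun a _ => by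
        rw [norm_mul]
        exact mul_le_mul (PiLp.norm_apply_le v a) (h a) (norm_nonneg _) (norm_nonneg _)
    _ = _ := by simp; ring

lemma abs_sub_le_of_pd {x : E n} {r K : ℝ} (hK0 : 0 ≤ K)
    (hf : ∀ z, ‖z - x‖ ≤ r → DifferentiableAt ℝ f z)
    (hK : ∀ z, ‖z - x‖ ≤ r → ∀ a, |pd a f z| ≤ K) {y z : E n} (hy : ‖y - x‖ ≤ r)
    (hz : ‖z - x‖ ≤ r) : |f y - f z| ≤ n * K * ‖y - z‖ := by
  have := (convex_closedBall x r).norm_image_sub_le_of_norm_fderiv_le (𝕜 := ℝ) (f := f)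
    (C := n * K) (fun w hw => hf w (by simpa [dist_eq_norm] using hw))
    (fun w hw => norm_fderiv_le_of_pd hK0 (hK w (by simpa [dist_eq_norm] using hw)))
    (x := z) (y := y) (by simpa [dist_eq_norm] using hz) (by simpa [dist_eq_norm] using hy)
  simpa [Real.norm_eq_abs] using this

/-- The derivative of t ↦ f(x − ty) + f(x + ty) is a difference of first derivatives at points 2t|y|
apart, hence controlled by second derivatives; the linear terms cancel. -/
lemma abs_second_difference_le (hf : ContDiff ℝ 2 f) {x y : E n} {K : ℝ} (hK0 : 0 ≤ K)
    (hK : ∀ z, ‖z - x‖ ≤ ‖y‖ → ∀ a b, |pd a (pd b f) z| ≤ K) :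
    |f (x - y) + f (x + y) - 2 * f x| ≤ 2 * n ^ 2 * K * ‖y‖ ^ 2 := by
  have hd : Differentiable ℝ f := hf.differentiable two_ne_zero
  have hd1 : ∀ b, Differentiable ℝ (pd b f) := fun b =>
    (contDiffOn_univ.1 (ContDiffOn.pd (m := 1) b isOpen_univ hf.contDiffOn
      (by norm_num))).differentiable one_ne_zero
  set h : ℝ → ℝ := fun t => f (x - t • y) + f (x + t • y) with hh
  have hder : ∀ t, HasDerivAt h (fderiv ℝ f (x - t • y) (-y) + fderiv ℝ f (x + t • y) y) t := by
    intro t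
    have h1 : HasDerivAt (fun t : ℝ => x - t • y) (-y) t := by
      simpa using ((hasDerivAt_id t).smul_const y).const_sub x
    have h2 : HasDerivAt (fun t : ℝ => x + t • y) y t := by
      simpa using ((hasDerivAt_id t).smul_const y).const_add x
    exact ((hd _).hasFDerivAt.comp_hasDerivAt t h1).add ((hd _).hasFDerivAt.comp_hasDerivAt t h2)
  have hsum : ∀ z v, fderiv ℝ f z v = ∑ a, v a * pd a f z := by
    intro z v
    have hv : v = ∑ a, v a • EuclideanSpace.single a (1 : ℝ) := by
      ext b
      simp [Pi.single_apply]
    conv_lhs => rw [hv]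
    simp [map_sum, pd]
  have hbd : ∀ t ∈ Set.Ico (0 : ℝ) 1,
      ‖fderiv ℝ f (x - t • y) (-y) + fderiv ℝ f (x + t • y) y‖ ≤ 2 * n ^ 2 * K * ‖y‖ ^ 2 := by
    intro t ht
    have hty : ‖t • y‖ ≤ ‖y‖ := by
      rw [norm_smul, Real.norm_of_nonneg ht.1]
      exact mul_le_of_le_one_left (norm_nonneg _) ht.2.le
    have e : fderiv ℝ f (x - t • y) (-y) + fderiv ℝ f (x + t • y) y =
        ∑ a, y a * (pd a f (x + t • y) - pd a f (x - t • y)) := by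
      rw [map_neg, hsum, hsum, ← Finset.sum_neg_distrib, ← Finset.sum_add_distrib]
      exact Finset.sum_congr rfl fun a _ => by ring
    rw [e]
    refine (norm_sum_le _ _).trans ?_
    calc _ ≤ ∑ _a : Fin n, ‖y‖ * (n * K * (2 * ‖y‖)) := Finset.sum_le_sum fun a _ => by
          rw [norm_mul]
          refine mul_le_mul (PiLp.norm_apply_le y a) ?_ (norm_nonneg _) (norm_nonneg _)
          rw [Real.norm_eq_abs]
          refine (abs_sub_le_of_pd (f := pd a f) (x := x) hK0 (fun z _ => hd1 a z)
            (fun z hz b => hK z hz b a) (by simpa using hty) (by simpa using hty)).trans ?_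
          refine mul_le_mul_of_nonneg_left ?_ (by positivity)
          have : x + t • y - (x - t • y) = t • y + t • y := by abel
          rw [this]
          exact (norm_add_le _ _).trans (by linarith)
      _ = _ := by simp; ring
  have := norm_image_sub_le_of_norm_deriv_le_segment_01' (f := h) (fun t _ => (hder t).hasDerivWithinAt)
    hbd
  have e : f (x - y) + f (x + y) - 2 * f x = h 1 - h 0 := by simp [hh]; ring
  rw [e]
  exact this

/-- A nonnegative even kernel of integral one. -/
structure IsMollifier (φ : E n → ℝ) : Prop extends IsKernel φ where
  nonneg : ∀ y, 0 ≤ φ y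
  even : ∀ y, φ (-y) = φ y
  integral : ∫ y, φ y = 1

lemma exists_isMollifier (n : ℕ) : ∃ φ : E n → ℝ, IsMollifier φ := by
  let b : ContDiffBump (0 : E n) := ⟨1 / 2, 1, by norm_num, by norm_num⟩
  refine ⟨b.normed volume, ⟨⟨b.contDiff_normed, fun y hy => ?_⟩, b.nonneg_normed, b.normed_neg,
    b.integral_normed⟩⟩
  have : y ∉ Function.support (b.normed volume) := by
    rw [b.support_normed_eq]
    simpa [b] using hy.le
  simpa using this

lemma IsMollifier.integral_abs (hφ : IsMollifier φ) : ∫ y, |φ y| = 1 := by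
  simp only [abs_of_nonneg (hφ.nonneg _), hφ.integral]

lemma moll_const (hφ : IsMollifier φ) (c : ℝ) (x : E n) : moll φ ℓ (fun _ => c) x = c := by
  rw [moll, integral_mul_const, hφ.integral, one_mul]

lemma abs_moll_sub_le (hφ : IsMollifier φ) (hℓ : 0 < ℓ) (hf : Continuous f) {x : E n} {K : ℝ}
    (hK : ∀ z, ‖z - x‖ ≤ ℓ → |f z - f x| ≤ K) : |moll φ ℓ f x - f x| ≤ K := by
  have h := abs_moll_le hφ.toIsKernel hℓ hK
  rw [hφ.integral_abs, one_mul, moll_sub hφ.toIsKernel hf continuous_const, moll_const hφ] at h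
  exact h

/-- Evenness of the kernel turns twice the error into an average of symmetric second differences,
which gives ℓ² instead of ℓ. -/
lemma abs_moll_sub_le_sq (hφ : IsMollifier φ) (hℓ : 0 < ℓ) (hf : ContDiff ℝ 2 f) {x : E n} {K : ℝ}
    (hK0 : 0 ≤ K) (hK : ∀ z, ‖z - x‖ ≤ ℓ → ∀ a b, |pd a (pd b f) z| ≤ K) :
    |moll φ ℓ f x - f x| ≤ n ^ 2 * K * ℓ ^ 2 := by
  have hc := hf.continuous
  have e1 : moll φ ℓ f x = ∫ y, φ y * f (x + ℓ • y) := by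
    rw [moll, ← integral_neg_eq_self]
    simp [hφ.even]
  have i1 := integrable_moll (ℓ := ℓ) hφ.toIsKernel hc x
  have i2 : Integrable fun y => φ y * f (x + ℓ • y) := by
    simpa using integrable_moll (ℓ := -ℓ) hφ.toIsKernel hc x
  have i3 : Integrable fun y => φ y * (2 * f x) := hφ.integrable.mul_const _
  have e2 : 2 * (moll φ ℓ f x - f x) =
      ∫ y, φ y * (f (x - ℓ • y) + f (x + ℓ • y) - 2 * f x) := by
    have : ∫ y, φ y * (f (x - ℓ • y) + f (x + ℓ • y) - 2 * f x) =
        moll φ ℓ f x + moll φ ℓ f x - 2 * f x := by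
      simp only [mul_sub, mul_add]
      rw [integral_sub (f := fun y => φ y * f (x - ℓ • y) + φ y * f (x + ℓ • y)) (i1.add i2) i3,
        integral_add i1 i2, integral_mul_const, hφ.integral, ← e1, one_mul]
      rfl
    rw [this]; ring
  have h2 : |2 * (moll φ ℓ f x - f x)| ≤ 2 * n ^ 2 * K * ℓ ^ 2 := by
    rw [e2, ← Real.norm_eq_abs]
    have : 2 * n ^ 2 * K * ℓ ^ 2 = ∫ y, φ y * (2 * n ^ 2 * K * ℓ ^ 2) := by
      rw [integral_mul_const, hφ.integral, one_mul]
    rw [this]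
    refine norm_integral_le_of_norm_le (hφ.integrable.mul_const _)
      (Eventually.of_forall fun y => ?_)
    rw [norm_mul, Real.norm_of_nonneg (hφ.nonneg y), Real.norm_eq_abs]
    by_cases hy : 1 < ‖y‖
    · simp [hφ.zero y hy]
    · have hn : ‖ℓ • y‖ ≤ ℓ := by
        rw [norm_smul, Real.norm_of_nonneg hℓ.le]
        exact mul_le_of_le_one_right hℓ.le (not_lt.1 hy)
      refine mul_le_mul_of_nonneg_left ?_ (hφ.nonneg y)
      refine (abs_second_difference_le hf hK0 fun z hz => hK z (hz.trans hn)).trans ?_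
      exact mul_le_mul_of_nonneg_left (pow_le_pow_left₀ (norm_nonneg _) hn 2) (by positivity)
  rw [abs_mul, abs_two] at h2
  linarith

end moll

end NashKuiper

/-! ### Mollified families and quadratic commutators. -/

namespace NashKuiper

open Filter Topology MeasureTheory
open scoped ContDiff

variable {ι : Type*} {n : ℕ}

namespace Family

variable {F : Family ι n} {ℓ σ τ : ι → ℝ}

/-- `f = O(σ)` on the `ℓ`-neighbourhood of the domains. -/
def NearO (F : Family ι n) (ℓ σ : ι → ℝ) (f : ι → E n → ℝ) : Prop :=
  ∃ C, 0 ≤ C ∧ ∀ᶠ i in F.l, ∀ x ∈ F.D i, ∀ z, ‖z - x‖ ≤ ℓ i → |f i z| ≤ C * σ i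

lemma smooth_moll (hℓ : ∀ i, 0 < ℓ i) {ψ : E n → ℝ} (hψ : IsKernel ψ) {f : ι → E n → ℝ}
    (hf : ∀ i, Continuous (f i)) : F.Smooth (fun i => moll ψ (ℓ i) (f i)) :=
  Eventually.of_forall fun i => (contDiff_moll hψ (hℓ i) (hf i)).contDiffOn

/-- Each derivative is ℓ⁻¹ times a mollification of the same f with another kernel, so the sup
bound, applied to all kernels, gives all orders. -/
lemma Symbol.moll (hℓ : ∀ i, 0 < ℓ i) {ψ : E n → ℝ} (hψ : IsKernel ψ) {f : ι → E n → ℝ}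
    (hf : ∀ i, Continuous (f i)) (hO : F.NearO ℓ σ f) :
    F.Symbol (fun i => (ℓ i)⁻¹) σ (fun i => moll ψ (ℓ i) (f i)) := by
  refine ⟨smooth_moll hℓ hψ hf, fun N => ?_⟩
  have base : ∀ {ψ : E n → ℝ}, IsKernel ψ → F.IsO σ (fun i => NashKuiper.moll ψ (ℓ i) (f i)) := by
    intro ψ hψ
    obtain ⟨C, hC, h⟩ := hO
    refine ⟨(∫ y, |ψ y|) * C, mul_nonneg (integral_nonneg fun _ => abs_nonneg _) hC, ?_⟩
    filter_upwards [h] with i h x hx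
    rw [mul_assoc]
    exact abs_moll_le hψ (hℓ i) (h x hx)
  have step : ∀ N {ψ : E n → ℝ}, IsKernel ψ →
      F.SymbolUpTo (fun i => (ℓ i)⁻¹) N σ (fun i => NashKuiper.moll ψ (ℓ i) (f i)) := by
    intro N
    induction N with
    | zero => exact base
    | succ N ih =>
      intro ψ hψ
      refine ⟨base hψ, fun a => ?_⟩
      have hc : F.Symbol (fun i => (ℓ i)⁻¹) (fun i => (ℓ i)⁻¹) (fun i _ => (ℓ i)⁻¹) :=
        Symbol.const _ 1 fun i => by rw [one_mul, abs_of_pos (inv_pos.2 (hℓ i))]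
      have h := (hc.bound N).mul (ih (hψ.pd a)) hc.smooth (smooth_moll hℓ (hψ.pd a) hf)
      simp only [mul_comm (ℓ _)⁻¹ (σ _)] at h
      exact h.congr (Eq.of_eq fun i x => (pd_moll hψ (hℓ i) (hf i) a x).symm)
  exact step N hψ

/-- The bilinear commutator expression, symmetric in the two kernels. -/
noncomputable def commutator (ℓ : ι → ℝ) (f g : ι → E n → ℝ) (ψ χ : E n → ℝ) (i : ι) (x : E n) :
    ℝ :=
  moll ψ (ℓ i) (fun z => f i z * g i z) x * moll χ (ℓ i) (fun _ => 1) x +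
    moll χ (ℓ i) (fun z => f i z * g i z) x * moll ψ (ℓ i) (fun _ => 1) x -
    (moll ψ (ℓ i) (f i) x * moll χ (ℓ i) (g i) x + moll χ (ℓ i) (f i) x * moll ψ (ℓ i) (g i) x)

/-- `f` oscillates by `O(σ)` on balls of radius `ℓ`. -/
def NearOsc (F : Family ι n) (ℓ σ : ι → ℝ) (f : ι → E n → ℝ) : Prop :=
  ∃ C, 0 ≤ C ∧ ∀ᶠ i in F.l, ∀ x ∈ F.D i, ∀ z, ‖z - x‖ ≤ ℓ i → |f i z - f i x| ≤ C * σ i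

/-- The expression does not change when constants are subtracted from f and from g. Subtracting f(x)
and g(x) leaves products of two oscillations over a ball of radius ℓ. -/
lemma abs_commutator_le (hℓ : ∀ i, 0 < ℓ i) {f g : ι → E n → ℝ} (hf : ∀ i, Continuous (f i))
    (hg : ∀ i, Continuous (g i)) {i : ι} {x : E n} {S T : ℝ}
    (h1 : ∀ z, ‖z - x‖ ≤ ℓ i → |f i z - f i x| ≤ S)
    (h2 : ∀ z, ‖z - x‖ ≤ ℓ i → |g i z - g i x| ≤ T) {ψ χ : E n → ℝ}
    (hψ : IsKernel ψ) (hχ : IsKernel χ) :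
    |commutator ℓ f g ψ χ i x| ≤ 4 * ((∫ y, |ψ y|) * (∫ y, |χ y|) * (S * T)) := by
  have hIψ : 0 ≤ ∫ y, |ψ y| := integral_nonneg fun _ => abs_nonneg _
  have hIχ : 0 ≤ ∫ y, |χ y| := integral_nonneg fun _ => abs_nonneg _
  have hfc : Continuous fun z => f i z - f i x := (hf i).sub continuous_const
  have hgc : Continuous fun z => g i z - g i x := (hg i).sub continuous_const
  have e0 : ∀ {ψ : E n → ℝ} (h : E n → ℝ), IsKernel ψ → Continuous h → ∀ c,
      moll ψ (ℓ i) (fun z => h z - c) x = moll ψ (ℓ i) h x - c * moll ψ (ℓ i) (fun _ => 1) x := by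
    intro ψ h hψ hh c
    rw [moll_sub hψ hh continuous_const, ← moll_const_mul]
    simp
  have e1 : ∀ {ψ : E n → ℝ}, IsKernel ψ →
      moll ψ (ℓ i) (fun z => (f i z - f i x) * (g i z - g i x)) x =
      moll ψ (ℓ i) (fun z => f i z * g i z) x - f i x * moll ψ (ℓ i) (g i) x -
      g i x * moll ψ (ℓ i) (f i) x + f i x * g i x * moll ψ (ℓ i) (fun _ => 1) x := by
    intro ψ hψ
    have h3 : (fun z => (f i z - f i x) * (g i z - g i x)) = fun z =>
        ((f i z * g i z - f i x * g i z) - g i x * f i z) - (-(f i x * g i x)) := by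
      ext z; ring
    have c1 : Continuous fun z => f i z * g i z := (hf i).mul (hg i)
    have c2 : Continuous fun z => f i x * g i z := continuous_const.mul (hg i)
    have c3 : Continuous fun z => g i x * f i z := continuous_const.mul (hf i)
    have c4 : Continuous fun z => f i z * g i z - f i x * g i z := c1.sub c2
    have c5 : Continuous fun z => f i z * g i z - f i x * g i z - g i x * f i z := c4.sub c3
    rw [h3, e0 _ hψ c5, moll_sub hψ c4 c3, moll_sub hψ c1 c2, moll_const_mul, moll_const_mul]
    ring
  have hb1 : ∀ {ψ : E n → ℝ}, IsKernel ψ →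
      |moll ψ (ℓ i) (fun z => (f i z - f i x) * (g i z - g i x)) x| ≤
        (∫ y, |ψ y|) * (S * T) := fun hψ =>
    abs_moll_le hψ (hℓ i) fun z hz => by
      rw [abs_mul]
      exact mul_le_mul (h1 z hz) (h2 z hz) (abs_nonneg _) ((abs_nonneg _).trans (h1 z hz))
  have hb2 : ∀ {ψ : E n → ℝ}, IsKernel ψ →
      |moll ψ (ℓ i) (fun z => f i z - f i x) x| ≤ (∫ y, |ψ y|) * S := fun hψ =>
    abs_moll_le hψ (hℓ i) h1
  have hb3 : ∀ {ψ : E n → ℝ}, IsKernel ψ →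
      |moll ψ (ℓ i) (fun z => g i z - g i x) x| ≤ (∫ y, |ψ y|) * T := fun hψ =>
    abs_moll_le hψ (hℓ i) h2
  have hb4 : ∀ {ψ : E n → ℝ}, IsKernel ψ →
      |moll ψ (ℓ i) (fun _ => 1) x| ≤ ∫ y, |ψ y| := fun hψ => by
    simpa using abs_moll_le (f := fun _ => 1) (x := x) (K := 1) hψ (hℓ i) fun z _ => by simp
  have key : commutator ℓ f g ψ χ i x =
      moll ψ (ℓ i) (fun z => (f i z - f i x) * (g i z - g i x)) x * moll χ (ℓ i) (fun _ => 1) x +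
      moll χ (ℓ i) (fun z => (f i z - f i x) * (g i z - g i x)) x * moll ψ (ℓ i) (fun _ => 1) x -
      (moll ψ (ℓ i) (fun z => f i z - f i x) x * moll χ (ℓ i) (fun z => g i z - g i x) x +
        moll χ (ℓ i) (fun z => f i z - f i x) x * moll ψ (ℓ i) (fun z => g i z - g i x) x) := by
    rw [e1 hψ, e1 hχ, e0 (f i) hψ (hf i), e0 (f i) hχ (hf i), e0 (g i) hψ (hg i),
      e0 (g i) hχ (hg i), commutator]
    ring
  have mul_le : ∀ {p q P Q : ℝ}, |p| ≤ P → |q| ≤ Q → |p * q| ≤ P * Q := fun hp hq => by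
    rw [abs_mul]
    exact mul_le_mul hp hq (abs_nonneg _) ((abs_nonneg _).trans hp)
  rw [key]
  refine (abs_sub _ _).trans ((add_le_add ((abs_add_le _ _).trans (add_le_add
    (mul_le (hb1 hψ) (hb4 hχ)) (mul_le (hb1 hχ) (hb4 hψ)))) ((abs_add_le _ _).trans (add_le_add
    (mul_le (hb2 hψ) (hb3 hχ)) (mul_le (hb2 hχ) (hb3 hψ))))).trans (le_of_eq ?_))
  ring

lemma isO_commutator (hℓ : ∀ i, 0 < ℓ i) {f g : ι → E n → ℝ} (hf : ∀ i, Continuous (f i))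
    (hg : ∀ i, Continuous (g i)) (of : F.NearOsc ℓ σ f) (og : F.NearOsc ℓ τ g) {ψ χ : E n → ℝ}
    (hψ : IsKernel ψ) (hχ : IsKernel χ) :
    F.IsO (fun i => σ i * τ i) (commutator ℓ f g ψ χ) := by
  obtain ⟨C, hC, h1⟩ := of
  obtain ⟨C', hC', h2⟩ := og
  have hIψ : 0 ≤ ∫ y, |ψ y| := integral_nonneg fun _ => abs_nonneg _
  have hIχ : 0 ≤ ∫ y, |χ y| := integral_nonneg fun _ => abs_nonneg _
  refine ⟨4 * ((∫ y, |ψ y|) * (∫ y, |χ y|) * (C * C')), by positivity, ?_⟩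
  filter_upwards [h1, h2] with i h1 h2 x hx
  refine (abs_commutator_le hℓ hf hg (h1 x hx) (h2 x hx) hψ hχ).trans (le_of_eq ?_)
  ring

/-- The derivative is ℓ⁻¹ times two expressions of the same kind, each with one kernel
differentiated. Allowing two different kernels is what makes the class stable under differentiation.
-/
lemma Symbol.commutator (hℓ : ∀ i, 0 < ℓ i) {f g : ι → E n → ℝ} (hf : ∀ i, Continuous (f i))
    (hg : ∀ i, Continuous (g i)) (of : F.NearOsc ℓ σ f) (og : F.NearOsc ℓ τ g) {ψ χ : E n → ℝ}
    (hψ : IsKernel ψ) (hχ : IsKernel χ) :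
    F.Symbol (fun i => (ℓ i)⁻¹) (fun i => σ i * τ i) (commutator ℓ f g ψ χ) := by
  have hfg : ∀ i, Continuous fun z => f i z * g i z := fun i => (hf i).mul (hg i)
  have h1c : ∀ i : ι, Continuous fun _ : E n => (1 : ℝ) := fun _ => continuous_const
  have sm : ∀ {ψ χ : E n → ℝ}, IsKernel ψ → IsKernel χ → F.Smooth (Family.commutator ℓ f g ψ χ) :=
    fun hψ hχ => by
      refine Eventually.of_forall fun i => ContDiff.contDiffOn ?_
      exact (((contDiff_moll hψ (hℓ i) (hfg i)).mul (contDiff_moll hχ (hℓ i) (h1c i))).add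
        ((contDiff_moll hχ (hℓ i) (hfg i)).mul (contDiff_moll hψ (hℓ i) (h1c i)))).sub
        (((contDiff_moll hψ (hℓ i) (hf i)).mul (contDiff_moll hχ (hℓ i) (hg i))).add
        ((contDiff_moll hχ (hℓ i) (hf i)).mul (contDiff_moll hψ (hℓ i) (hg i))))
  have hpd : ∀ {ψ χ : E n → ℝ}, IsKernel ψ → IsKernel χ → ∀ a i x,
      NashKuiper.pd a (Family.commutator ℓ f g ψ χ i) x =
        (ℓ i)⁻¹ * (Family.commutator ℓ f g (NashKuiper.pd a ψ) χ i x +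
          Family.commutator ℓ f g ψ (NashKuiper.pd a χ) i x) := by
    intro ψ χ hψ hχ a i x
    have d : ∀ {ψ h : E n → ℝ}, IsKernel ψ → Continuous h →
        DifferentiableAt ℝ (NashKuiper.moll ψ (ℓ i) h) x := fun hψ hh =>
      (contDiff_moll hψ (hℓ i) hh).differentiable (by simp) x
    have d1 := d hψ (hfg i)
    have d2 := d hχ (h1c i)
    have d3 := d hχ (hfg i)
    have d4 := d hψ (h1c i)
    have d5 := d hψ (hf i)
    have d6 := d hχ (hg i)
    have d7 := d hχ (hf i)
    have d8 := d hψ (hg i)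
    unfold Family.commutator
    rw [pd_sub _ ((d1.fun_mul d2).fun_add (d3.fun_mul d4))
      ((d5.fun_mul d6).fun_add (d7.fun_mul d8)), pd_add _ (d1.fun_mul d2) (d3.fun_mul d4),
      pd_add _ (d5.fun_mul d6) (d7.fun_mul d8), pd_mul _ d1 d2, pd_mul _ d3 d4, pd_mul _ d5 d6,
      pd_mul _ d7 d8, pd_moll hψ (hℓ i) (hfg i), pd_moll hχ (hℓ i) (hfg i),
      pd_moll hψ (hℓ i) (h1c i), pd_moll hχ (hℓ i) (h1c i), pd_moll hψ (hℓ i) (hf i),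
      pd_moll hχ (hℓ i) (hf i), pd_moll hψ (hℓ i) (hg i), pd_moll hχ (hℓ i) (hg i)]
    ring
  have step : ∀ N {ψ χ : E n → ℝ}, IsKernel ψ → IsKernel χ →
      F.SymbolUpTo (fun i => (ℓ i)⁻¹) N (fun i => σ i * τ i) (Family.commutator ℓ f g ψ χ) := by
    intro N
    induction N with
    | zero => exact fun hψ hχ => isO_commutator hℓ hf hg of og hψ hχ
    | succ N ih =>
      intro ψ χ hψ hχ
      refine ⟨isO_commutator hℓ hf hg of og hψ hχ, fun a => ?_⟩
      have hc : F.Symbol (fun i => (ℓ i)⁻¹) (fun i => (ℓ i)⁻¹) (fun i _ => (ℓ i)⁻¹) :=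
        Symbol.const _ 1 fun i => by rw [one_mul, abs_of_pos (inv_pos.2 (hℓ i))]
      have h := (hc.bound N).mul ((ih (hψ.pd a) hχ).add (ih hψ (hχ.pd a)) (sm (hψ.pd a) hχ)
        (sm hψ (hχ.pd a))) hc.smooth ((sm (hψ.pd a) hχ).add (sm hψ (hχ.pd a)))
      simp only [mul_comm (ℓ _)⁻¹ (_ * _)] at h
      refine h.congr (Eq.of_eq fun i x => ?_)
      rw [hpd hψ hχ]
  exact ⟨sm hψ hχ, fun N => step N hψ hχ⟩

lemma commutator_eq {φ : E n → ℝ} (hφ : IsMollifier φ) (ℓ : ι → ℝ) (f g : ι → E n → ℝ) (i : ι)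
    (x : E n) : commutator ℓ f g φ φ i x =
      2 * (moll φ (ℓ i) (fun z => f i z * g i z) x - moll φ (ℓ i) (f i) x * moll φ (ℓ i) (g i) x) := by
  rw [commutator, moll_const hφ]
  ring

end Family
end NashKuiper

/-! ### Neighbourhoods, cut-offs, and translation between norms and components. -/

namespace NashKuiper

open Filter Topology Metric
open scoped ContDiff Manifold

variable {n m : ℕ}

/-- A preconnected set that meets an open set but not its frontier lies in it. -/
lemma subset_of_disjoint_frontier {X : Type*} [TopologicalSpace X] {S U : Set X}
    (hS : IsPreconnected S) (hU : IsOpen U) (hSU : (S ∩ U).Nonempty)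
    (hd : Disjoint S (frontier U)) : S ⊆ U := by
  by_contra h
  obtain ⟨x, hxS, hxU⟩ := Set.not_subset.1 h
  have hcov : S ⊆ U ∪ (closure U)ᶜ := fun y hy => by
    by_cases hyU : y ∈ U
    · exact Or.inl hyU
    · refine Or.inr fun hyc => Set.disjoint_left.1 hd hy ?_
      rw [hU.frontier_eq]
      exact ⟨hyc, hyU⟩
  obtain ⟨y, -, hyU, hyc⟩ := hS _ _ hU isClosed_closure.isOpen_compl hcov hSU
    ⟨x, hxS, (hcov hxS).resolve_left hxU⟩
  exact hyc (subset_closure hyU)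

/-- A ball of radius η about a point of V is connected and misses the frontier of U, so it cannot
leave U. -/
lemma thickening_subset_of_le_setDist {U V : Set (E n)} {η : ℝ} (hU : IsOpen U) (hVU : V ⊆ U)
    (h : η ≤ setDist V (frontier U)) : thickening η V ⊆ U := by
  intro x hx
  obtain ⟨v, hv, hxv⟩ := mem_thickening_iff.1 hx
  refine subset_of_disjoint_frontier (convex_ball v η).isPreconnected hU
    ⟨v, mem_ball_self (dist_nonneg.trans_lt hxv), hVU hv⟩ ?_ hxv
  refine Set.disjoint_left.2 fun y hy hyU => ?_
  have : setDist V (frontier U) ≤ dist v y :=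
    csInf_le ⟨0, by rintro _ ⟨a, -, b, -, rfl⟩; exact dist_nonneg⟩ ⟨v, hv, y, hyU, rfl⟩
  rw [mem_ball, dist_comm] at hy
  linarith

/-- Nonemptiness of V and of the frontier matters, since the infimum over an empty set would be 0.
The frontier is nonempty because U is bounded and the dimension is positive. -/
lemma setDist_frontier_pos [NeZero n] {U V : Set (E n)} (hU : IsOpen U)
    (hUb : Bornology.IsBounded U) (hV : V.Nonempty) (hVc : IsCompact (closure V))
    (hVU : closure V ⊆ U) : 0 < setDist V (frontier U) := by
  have hUne : U.Nonempty := hV.mono (subset_closure.trans hVU)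
  have hne : (frontier U).Nonempty := by
    refine nonempty_frontier_iff.2 ⟨hUne, fun h => ?_⟩
    exact NormedSpace.unbounded_univ ℝ (E n) (h ▸ hUb)
  obtain ⟨ε, hε, h⟩ := hVc.exists_thickening_subset_open hU hVU
  refine hε.trans_le (le_csInf (hV.image2 hne) ?_)
  rintro _ ⟨a, ha, b, hb, rfl⟩
  by_contra! hlt
  rw [hU.frontier_eq] at hb
  refine hb.2 (h (mem_thickening_iff.2 ⟨a, subset_closure ha, ?_⟩))
  rwa [dist_comm]

/-- Functions on an open set extend from a smaller set to compactly supported functions. -/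
lemma exists_compactly_supported_extension {U V : Set (E n)} {η : ℝ} (hη : 0 < η) (hU : IsOpen U)
    (hUb : Bornology.IsBounded U) (h : thickening η V ⊆ U) {f : E n → ℝ}
    (hf : ContDiffOn ℝ 2 f U) :
    ∃ f' : E n → ℝ, ContDiff ℝ 2 f' ∧ HasCompactSupport f' ∧
      Set.EqOn f' f (thickening (η / 2) V) := by
  have hd : Disjoint Uᶜ (cthickening (η / 2) V) :=
    Set.disjoint_left.2 fun x hx hx' =>
      hx (h (cthickening_subset_thickening' hη (by linarith) _ hx'))
  obtain ⟨χ, h0, h1, -⟩ := exists_contMDiffMap_zero_one_nhds_of_isClosed 𝓘(ℝ, E n) (n := ⊤)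
    hU.isClosed_compl isClosed_cthickening hd
  have hχ : ContDiff ℝ 2 χ := χ.contMDiff.contDiff.of_le (WithTop.coe_le_coe.2 le_top)
  have h0' : ∀ x, x ∉ U → ∀ᶠ y in 𝓝 x, χ y = 0 := fun x hx =>
    (eventually_nhdsSet_iff_forall.1 h0) x hx
  refine ⟨fun x => χ x * f x, contDiff_iff_contDiffAt.2 fun x => ?_, ?_, fun x hx => ?_⟩
  · by_cases hx : x ∈ U
    · exact hχ.contDiffAt.mul (hf.contDiffAt (hU.mem_nhds hx))
    · refine (contDiffAt_const (c := (0 : ℝ))).congr_of_eventuallyEq ?_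
      filter_upwards [h0' x hx] with y hy
      simp [hy]
  · refine HasCompactSupport.intro hUb.isCompact_closure fun x hx => ?_
    simp [(h0' x fun hxU => hx (subset_closure hxU)).self_of_nhds]
  · have := ((eventually_nhdsSet_iff_forall.1 h1) x
      (thickening_subset_cthickening _ _ hx)).self_of_nhds
    simp [this]

section components

variable {F : Type*} [NormedAddCommGroup F] [NormedSpace ℝ F] {U V : Set (E n)} {f : E n → F}

lemma enorm_partialDeriv_le_cNorm {j k : ℕ} (hj : j ≤ k) (i : Fin j → Fin n) {x : E n}
    (hx : x ∈ U) : ‖partialDeriv i f x‖ₑ ≤ cNorm k U f := by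
  refine le_trans ?_ (Finset.single_le_sum (f := fun j => ⨆ i : Fin j → Fin n, ⨆ x ∈ U,
    ‖partialDeriv i f x‖ₑ) (fun _ _ => zero_le) (Finset.mem_range.2 (Nat.lt_succ_of_le hj)))
  exact le_iSup_of_le i (le_iSup₂_of_le x hx le_rfl)

lemma norm_partialDeriv_le {k : ℕ} {K : ℝ} (hK : 0 ≤ K) (h : cNorm k U f ≤ ENNReal.ofReal K)
    {j : ℕ} (hj : j ≤ k) (i : Fin j → Fin n) {x : E n} (hx : x ∈ U) :
    ‖partialDeriv i f x‖ ≤ K := by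
  have := (enorm_partialDeriv_le_cNorm hj i hx).trans h
  rwa [← ofReal_norm, ENNReal.ofReal_le_ofReal_iff hK] at this

lemma cNorm_le {k : ℕ} {K : ℕ → ℝ} (hK : ∀ j, 0 ≤ K j)
    (h : ∀ j ≤ k, ∀ i : Fin j → Fin n, ∀ x ∈ U, ‖partialDeriv i f x‖ ≤ K j) :
    cNorm k U f ≤ ENNReal.ofReal (∑ j ∈ Finset.range (k + 1), K j) := by
  rw [ENNReal.ofReal_sum_of_nonneg fun j _ => hK j]
  refine Finset.sum_le_sum fun j hj => iSup_le fun i => iSup₂_le fun x hx => ?_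
  rw [← ofReal_norm]
  exact ENNReal.ofReal_le_ofReal (h j (Nat.lt_succ_iff.1 (Finset.mem_range.1 hj)) i x hx)

lemma partialDeriv_zero (i : Fin 0 → Fin n) (x : E n) : partialDeriv i f x = f x := by
  simp [partialDeriv]

lemma pd_clm_comp (L : F →L[ℝ] ℝ) (a : Fin n) {x : E n} (hf : DifferentiableAt ℝ f x) :
    pd a (fun y => L (f y)) x = L (fderiv ℝ f x (EuclideanSpace.single a 1)) := by
  have := (L.hasFDerivAt.comp x hf.hasFDerivAt).fderiv
  rw [pd, show (fun y => L (f y)) = L ∘ f from rfl, this]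
  rfl

lemma clm_partialDeriv_one (L : F →L[ℝ] ℝ) (i : Fin 1 → Fin n) {x : E n}
    (hf : DifferentiableAt ℝ f x) : L (partialDeriv i f x) = pd (i 0) (fun y => L (f y)) x := by
  rw [partialDeriv, iteratedFDeriv_one_apply, pd_clm_comp L _ hf]

lemma clm_partialDeriv_two (L : F →L[ℝ] ℝ) (i : Fin 2 → Fin n) {x : E n} (hU : IsOpen U)
    (hf : ContDiffOn ℝ 2 f U) (hx : x ∈ U) :
    L (partialDeriv i f x) = pd (i 0) (pd (i 1) fun y => L (f y)) x := by
  have hd : DifferentiableAt ℝ (fderiv ℝ f) x :=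
    ((hf.contDiffAt (hU.mem_nhds hx)).fderiv_right (m := 1) (by norm_num)).differentiableAt
      (by norm_num)
  have h : Set.EqOn (pd (i 1) fun y => L (f y))
      (fun y => (L ∘L ContinuousLinearMap.apply ℝ F (EuclideanSpace.single (i 1) (1 : ℝ)))
        (fderiv ℝ f y)) U := fun y hy =>
    pd_clm_comp L _ ((hf.differentiableOn (by norm_num)).differentiableAt (hU.mem_nhds hy))
  rw [pd_congr _ hU h hx, pd_clm_comp _ _ hd, partialDeriv, iteratedFDeriv_two_apply]
  rfl

lemma cNorm_zero_le {K : ℝ} (hK : 0 ≤ K) (h : ∀ x ∈ U, ‖f x‖ ≤ K) :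
    cNorm 0 U f ≤ ENNReal.ofReal K := by
  refine (cNorm_le (K := fun _ => K) (fun _ => hK) fun j hj i x hx => ?_).trans (by simp)
  obtain rfl := Nat.le_zero.1 hj
  rw [partialDeriv_zero]
  exact h x hx

lemma norm_le_of_cNorm {k : ℕ} {K : ℝ} (hK : 0 ≤ K) (h : cNorm k U f ≤ ENNReal.ofReal K) {x : E n}
    (hx : x ∈ U) : ‖f x‖ ≤ K := by
  simpa [partialDeriv_zero] using norm_partialDeriv_le hK h (Nat.zero_le k) Fin.elim0 hx

lemma CkClosure.of_contDiffOn {D : Set (E n)} {k : ℕ} (hD : IsOpen D) (hf : ContDiffOn ℝ k f D)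
    (hVD : closure V ⊆ D) : CkClosure k f V := by
  refine ⟨hf.mono (subset_closure.trans hVD), hf.continuousOn.mono hVD, fun j hj =>
    ⟨iteratedFDeriv ℝ j f, ContinuousOn.mono ?_ hVD, fun x _ => rfl⟩⟩
  refine (hf.continuousOn_iteratedFDerivWithin (m := j) (by exact_mod_cast hj)
    hD.uniqueDiffOn).congr fun x hx => ?_
  exact (iteratedFDerivWithin_of_isOpen j hD hx).symm

/-- The derivatives of a function of class `Cᵏ` up to the boundary of a bounded set are bounded. -/
lemma CkClosure.exists_bound {k : ℕ} (hf : CkClosure k f U) (hU : Bornology.IsBounded U)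
    (L : F →L[ℝ] ℝ) {j : ℕ} (hj : j ≤ k) :
    ∃ K, 0 ≤ K ∧ ∀ i : Fin j → Fin n, ∀ x ∈ U, |L (partialDeriv i f x)| ≤ K := by
  obtain ⟨G, hG, hGf⟩ := hf.2.2 j hj
  obtain ⟨K, hK⟩ := hU.isCompact_closure.exists_bound_of_continuousOn hG
  refine ⟨‖L‖ * |K|, by positivity, fun i x hx => ?_⟩
  refine (L.le_opNorm _).trans (mul_le_mul_of_nonneg_left ?_ (norm_nonneg _))
  rw [partialDeriv, ← hGf hx]
  refine ((G x).le_opNorm _).trans ?_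
  simpa using (hK x (subset_closure hx)).trans (le_abs_self K)

end components

section vector

variable {U V : Set (E n)} {v : E n → E m}

lemma pd_component (A : Fin m) (a : Fin n) {x : E n} (hv : DifferentiableAt ℝ v x) :
    pd a (fun y => v y A) x = fderiv ℝ v x (EuclideanSpace.single a 1) A :=
  pd_clm_comp (EuclideanSpace.proj A) a hv

lemma inducedMetric_apply (a b : Fin n) {x : E n} (hv : DifferentiableAt ℝ v x) :
    inducedMetric v x a b = ∑ A, pd a (fun y => v y A) x * pd b (fun y => v y A) x := by
  simp [inducedMetric, jacobian, Matrix.mul_apply, pd_component _ _ hv]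

lemma norm_le_of_abs_le {w : E m} {K : ℝ} (hK : ∀ A, |w A| ≤ K) : ‖w‖ ≤ m * K := by
  have h : w = ∑ A, w A • EuclideanSpace.single A (1 : ℝ) := by
    ext B
    simp [Finset.sum_apply, Pi.single_apply]
  rw [h]
  refine (norm_sum_le _ _).trans ((Finset.sum_le_sum fun A _ => ?_).trans_eq
    (b := ∑ _A : Fin m, K) (by simp))
  rw [norm_smul]
  simpa using hK A

lemma abs_apply_le_norm (w : E m) (A : Fin m) : |w A| ≤ ‖w‖ := PiLp.norm_apply_le w A

lemma norm_partialDeriv_one_le {K : ℝ} (i : Fin 1 → Fin n) {x : E n}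
    (hv : DifferentiableAt ℝ v x) (h : ∀ A a, |pd a (fun y => v y A) x| ≤ K) :
    ‖partialDeriv i v x‖ ≤ m * K :=
  norm_le_of_abs_le fun A => by
    have := clm_partialDeriv_one (EuclideanSpace.proj A) i hv
    simp only [EuclideanSpace.coe_proj] at this
    rw [this]
    exact h A _

lemma norm_partialDeriv_two_le {K : ℝ} (i : Fin 2 → Fin n) {x : E n} (hU : IsOpen U) (hx : x ∈ U)
    (hv : ContDiffOn ℝ 2 v U) (h : ∀ A a b, |pd a (pd b fun y => v y A) x| ≤ K) :
    ‖partialDeriv i v x‖ ≤ m * K :=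
  norm_le_of_abs_le fun A => by
    have := clm_partialDeriv_two (EuclideanSpace.proj A) i hU hv hx
    simp only [EuclideanSpace.coe_proj] at this
    rw [this]
    exact h A _ _

lemma cNorm_one_le {K₀ K₁ : ℝ} (h0 : 0 ≤ K₀) (h1 : 0 ≤ K₁)
    (hv : ∀ x ∈ U, DifferentiableAt ℝ v x) (b0 : ∀ x ∈ U, ∀ A, |v x A| ≤ K₀)
    (b1 : ∀ x ∈ U, ∀ A a, |pd a (fun y => v y A) x| ≤ K₁) :
    cNorm 1 U v ≤ ENNReal.ofReal (m * (K₀ + K₁)) := by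
  refine (cNorm_le (K := fun j => m * if j = 0 then K₀ else K₁) (fun j => ?_)
    fun j hj i x hx => ?_).trans (le_of_eq ?_)
  · split_ifs <;> positivity
  · interval_cases j
    · simpa [partialDeriv_zero] using norm_le_of_abs_le (b0 x hx)
    · simpa using norm_partialDeriv_one_le i (hv x hx) (b1 x hx)
  · simp [Finset.sum_range_succ, mul_add]

lemma cNorm_two_le {K₀ K₁ K₂ : ℝ} (h0 : 0 ≤ K₀) (h1 : 0 ≤ K₁) (h2 : 0 ≤ K₂) (hU : IsOpen U)
    (hv : ContDiffOn ℝ 2 v U) (b0 : ∀ x ∈ U, ∀ A, |v x A| ≤ K₀)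
    (b1 : ∀ x ∈ U, ∀ A a, |pd a (fun y => v y A) x| ≤ K₁)
    (b2 : ∀ x ∈ U, ∀ A a b, |pd a (pd b fun y => v y A) x| ≤ K₂) :
    cNorm 2 U v ≤ ENNReal.ofReal (m * (K₀ + K₁ + K₂)) := by
  refine (cNorm_le (K := fun j => m * if j = 0 then K₀ else if j = 1 then K₁ else K₂) (fun j => ?_)
    fun j hj i x hx => ?_).trans (le_of_eq ?_)
  · split_ifs <;> positivity
  · interval_cases j
    · simpa [partialDeriv_zero] using norm_le_of_abs_le (b0 x hx)
    · simpa using norm_partialDeriv_one_le i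
        ((hv.differentiableOn (by norm_num)).differentiableAt (hU.mem_nhds hx)) (b1 x hx)
    · simpa using norm_partialDeriv_two_le i hU hx hv (b2 x hx)
  · simp [Finset.sum_range_succ, mul_add]

lemma abs_component_le {K : ℝ} (hK : 0 ≤ K) (hU : IsOpen U) (hv : ContDiffOn ℝ 2 v U)
    (h : cNorm 2 U v ≤ ENNReal.ofReal K) {x : E n} (hx : x ∈ U) (A : Fin m) :
    |v x A| ≤ K ∧ (∀ a, |pd a (fun y => v y A) x| ≤ K) ∧
      ∀ a b, |pd a (pd b fun y => v y A) x| ≤ K := by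
  refine ⟨(abs_apply_le_norm _ _).trans (norm_le_of_cNorm hK h hx), fun a => ?_, fun a b => ?_⟩
  · have := clm_partialDeriv_one (EuclideanSpace.proj A) (fun _ => a)
      ((hv.differentiableOn (by norm_num)).differentiableAt (hU.mem_nhds hx))
    simp only [EuclideanSpace.coe_proj] at this
    rw [← this]
    exact (abs_apply_le_norm _ _).trans (norm_partialDeriv_le hK h (by norm_num) _ hx)
  · have := clm_partialDeriv_two (EuclideanSpace.proj A) ![a, b] hU hv hx
    simp only [EuclideanSpace.coe_proj, Matrix.cons_val_zero, Matrix.cons_val_one] at this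
    rw [← this]
    exact (abs_apply_le_norm _ _).trans (norm_partialDeriv_le hK h le_rfl _ hx)

/-- If Dv y = 0 then DvᵗDv y = 0, and a nonsingular Gram matrix forces y = 0. The map is C² on a
neighbourhood of the closure, so no extension of Dv is needed. -/
lemma ImmersionOnClosure.of_det_ne_zero {D : Set (E n)} (hD : IsOpen D)
    (hv : ContDiffOn ℝ 2 v D) (hVD : closure V ⊆ D)
    (hdet : ∀ x ∈ D, (inducedMetric v x).det ≠ 0) : ImmersionOnClosure v V := by
  refine ⟨fderiv ℝ v, (hv.continuousOn_fderiv_of_isOpen hD (by norm_num)).mono hVD,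
    fun x _ => rfl, fun x hx => ?_⟩
  rw [injective_iff_map_eq_zero]
  intro y hy
  have hj : (jacobian v x).mulVec y = 0 := by
    have e : y = ∑ a, y a • EuclideanSpace.single a (1 : ℝ) := by
      ext b
      simp [Finset.sum_apply, Pi.single_apply]
    ext A
    have : fderiv ℝ v x y A = 0 := by simp [hy]
    rw [e, map_sum] at this
    simpa [jacobian, Matrix.mulVec, dotProduct, mul_comm] using this
  have hm : (inducedMetric v x).mulVec y = 0 := by
    rw [inducedMetric, ← Matrix.mulVec_mulVec, hj, Matrix.mulVec_zero]
  have := Matrix.eq_zero_of_mulVec_eq_zero (hdet x (hVD hx)) hm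
  ext a
  exact congrFun this a

end vector

section matrices

lemma abs_entry_le_norm (M : Matrix (Fin n) (Fin n) ℝ) (a b : Fin n) : |M a b| ≤ ‖M‖ := by
  rw [Matrix.frobenius_norm_def, ← Real.sqrt_eq_rpow]
  refine Real.le_sqrt_of_sq_le ?_
  have h1 := Finset.single_le_sum (f := fun j => ‖M a j‖ ^ (2 : ℝ)) (fun j _ => by positivity)
    (Finset.mem_univ b)
  have h2 := Finset.single_le_sum (f := fun i => ∑ j, ‖M i j‖ ^ (2 : ℝ))
    (fun i _ => by positivity) (Finset.mem_univ a)
  simpa using h1.trans h2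

lemma norm_le_of_abs_entry_le {M : Matrix (Fin n) (Fin n) ℝ} {K : ℝ}
    (h : ∀ a b, |M a b| ≤ K) (hK : 0 ≤ K) : ‖M‖ ≤ n * K := by
  rw [Matrix.frobenius_norm_def, ← Real.sqrt_eq_rpow]
  refine Real.sqrt_le_iff.2 ⟨by positivity, ?_⟩
  refine (Finset.sum_le_sum fun a _ => Finset.sum_le_sum fun b _ =>
    (show ‖M a b‖ ^ (2 : ℝ) ≤ K ^ 2 from ?_)).trans (le_of_eq ?_)
  · rw [Real.rpow_two, Real.norm_eq_abs]
    exact pow_le_pow_left₀ (abs_nonneg _) (h a b) 2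
  · simp
    ring

/-- The entry of a matrix, as a continuous linear functional. -/
noncomputable def entryCLM (a b : Fin n) : Matrix (Fin n) (Fin n) ℝ →L[ℝ] ℝ :=
  LinearMap.toContinuousLinearMap (Matrix.entryLinearMap ℝ ℝ a b)

/-- The entries of a metric that is `C²` up to the boundary, and their second derivatives, are
bounded. -/
lemma exists_bound_entries {Ω : Set (E n)} (hΩ : IsOpen Ω) (hΩb : Bornology.IsBounded Ω)
    {g : E n → Matrix (Fin n) (Fin n) ℝ} (hg : CkClosure 2 g Ω) :
    ∃ K, 0 ≤ K ∧ ∀ x ∈ Ω, ∀ a b, |g x a b| ≤ K ∧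
      ∀ c d, |pd c (pd d fun y => g y a b) x| ≤ K := by
  choose K0 hK0 h0 using fun p : Fin n × Fin n =>
    hg.exists_bound hΩb (entryCLM p.1 p.2) (Nat.zero_le 2)
  choose K2 hK2 h2 using fun p : Fin n × Fin n => hg.exists_bound hΩb (entryCLM p.1 p.2) le_rfl
  refine ⟨∑ p, (K0 p + K2 p), Finset.sum_nonneg fun p _ => add_nonneg (hK0 p) (hK2 p),
    fun x hx a b => ?_⟩
  have hle := Finset.single_le_sum (f := fun p => K0 p + K2 p)
    (fun p _ => add_nonneg (hK0 p) (hK2 p)) (Finset.mem_univ (a, b))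
  have e0 := h0 (a, b) Fin.elim0 x hx
  rw [partialDeriv_zero] at e0
  have k0 := hK0 (a, b)
  have k2 := hK2 (a, b)
  refine ⟨e0.trans (by linarith), fun c d => ?_⟩
  have e2 := h2 (a, b) ![c, d] x hx
  have e : entryCLM a b (partialDeriv ![c, d] g x) = pd c (pd d fun y => g y a b) x :=
    clm_partialDeriv_two (entryCLM a b) ![c, d] hΩ hg.1 hx
  exact (congrArg abs e).symm.le.trans (e2.trans (by linarith))

/-- Determinants near a continuous family of positive definite matrices are bounded below. -/
lemma exists_det_lower_bound {K : Set (E n)} (hK : IsCompact K)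
    {g : E n → Matrix (Fin n) (Fin n) ℝ} (hg : ContinuousOn g K) (hpos : ∀ x ∈ K, (g x).PosDef) :
    ∃ ε > 0, ∃ c > 0, ∀ x ∈ K, ∀ M : Matrix (Fin n) (Fin n) ℝ,
      (∀ a b, |M a b - g x a b| ≤ ε) → c ≤ M.det := by
  have hdet : Continuous fun M : Fin n → Fin n → ℝ => (Matrix.of M).det :=
    Continuous.matrix_det (continuous_matrix fun a b => by simp only [Matrix.of_apply]; fun_prop)
  have hg' : ContinuousOn (fun x a b => g x a b) K := continuousOn_pi.2 fun a =>
    continuousOn_pi.2 fun b => (entryCLM a b).continuous.comp_continuousOn hg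
  obtain ⟨c, hc, hcK⟩ : ∃ c > 0, ∀ x ∈ K, c < (g x).det := by
    rcases K.eq_empty_or_nonempty with rfl | hne
    · exact ⟨1, one_pos, by simp⟩
    · obtain ⟨x, hx, h⟩ := hK.exists_isMinOn hne (hdet.comp_continuousOn hg')
      have := (hpos x hx).det_pos
      exact ⟨(g x).det / 2, by positivity, fun y hy =>
        (half_lt_self this).trans_le (h hy)⟩
  -- The image of K under g is compact and lies in the open set where the determinant exceeds c,
  -- hence so does a closed neighbourhood of it in the sup norm of the entries.
  obtain ⟨ε, hε, h⟩ := (hK.image_of_continuousOn hg').exists_cthickening_subset_open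
    (isOpen_lt continuous_const hdet) (t := {M | c < (Matrix.of M).det})
    (by rintro _ ⟨x, hx, rfl⟩; exact hcK x hx)
  refine ⟨ε, hε, c, hc, fun x hx M hM => ?_⟩
  refine le_of_lt (h (mem_cthickening_of_dist_le (fun a b => M a b) (fun a b => g x a b) ε _
    ⟨x, hx, rfl⟩ ?_))
  exact (dist_pi_le_iff hε.le).2 fun a => (dist_pi_le_iff hε.le).2 fun b => hM a b

end matrices

end NashKuiper

/-! ### Localized maps, their mollification, and the normalized target. -/

namespace NashKuiper

open Filter Topology
open scoped ContDiff

/-- A family of localized short maps `f` into `ℝⁿ⁺¹`, at distance about `s²` from being isometric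
for the metrics `g`, with second derivatives of size `s * lam`, together with a scale `ℓ` of
mollification. The estimates hold in the `ℓ`-neighbourhood of the domains. -/
structure StageFamily (ι : Type*) (n : ℕ) extends Family ι n where
  s : ι → ℝ
  ℓ : ι → ℝ
  lam : ι → ℝ
  r : ι → ℝ
  d : ι → ℝ
  c₀ : ℝ
  K : ℝ
  ε : ℝ
  c : ℝ
  f : Fin (n + 1) → ι → E n → ℝ
  g : Fin n → Fin n → ι → E n → ℝ
  s_pos : ∀ i, 0 < s i
  s_le : ∀ i, s i ≤ 1
  s_tendsto : Tendsto s l (𝓝 0)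
  ℓ_pos : ∀ i, 0 < ℓ i
  c₀_pos : 0 < c₀
  c₀_le : c₀ ≤ 1 / (4 * (n + 2) ^ 2)
  K_nonneg : 0 ≤ K
  ε_pos : 0 < ε
  c_pos : 0 < c
  r_le : ∀ i, r i ≤ 1 / (8 * (n + 3))
  one_le : ∀ i, 1 ≤ s i * lam i
  ℓ_mul_le : ∀ i, ℓ i * lam i ≤ c₀
  abs_d_le : ∀ i, |d i| ≤ r i * s i ^ 2
  contDiff_f : ∀ A i, ContDiff ℝ 2 (f A i)
  compact_f : ∀ A i, HasCompactSupport (f A i)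
  contDiff_g : ∀ a b i, ContDiff ℝ 2 (g a b i)
  g_symm : ∀ a b i x, g a b i x = g b a i x
  pd_f_le : ∀ i, ∀ x ∈ D i, ∀ z, ‖z - x‖ ≤ ℓ i → ∀ A a, |pd a (f A i) z| ≤ K
  pd_pd_f_le : ∀ i, ∀ x ∈ D i, ∀ z, ‖z - x‖ ≤ ℓ i → ∀ A a b, |pd a (pd b (f A i)) z| ≤ s i * lam i
  pd_pd_g_le : ∀ i, ∀ x ∈ D i, ∀ z, ‖z - x‖ ≤ ℓ i → ∀ a b a' b', |pd a' (pd b' (g a b i)) z| ≤ K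
  err_le : ∀ i, ∀ x ∈ D i, ∀ z, ‖z - x‖ ≤ ℓ i → ∀ a b,
    |g a b i z - ∑ A, pd a (f A i) z * pd b (f A i) z - s i ^ 2 * h0 n a b| ≤ r i * s i ^ 2
  le_det : ∀ i, ∀ x ∈ D i, ∀ M : Matrix (Fin n) (Fin n) ℝ, (∀ a b, |M a b - g a b i x| ≤ ε) →
    c ≤ M.det

namespace StageFamily

variable {ι : Type*} {n : ℕ} (S : StageFamily ι n) {φ : E n → ℝ}

lemma c₀_le_one : S.c₀ ≤ 1 := by
  refine S.c₀_le.trans ((div_le_one (by positivity)).2 ?_)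
  have : (0 : ℝ) ≤ n := Nat.cast_nonneg n
  nlinarith

/-- Since 1 ≤ sλ, one has ℓ ≤ ℓ · sλ ≤ c₀ s. Thus an error O(ℓ²) is also O(s²). -/
lemma ℓ_le (i : ι) : S.ℓ i ≤ S.c₀ * S.s i := by
  have h1 := S.ℓ_mul_le i
  have h2 := S.one_le i
  have h3 := S.ℓ_pos i
  have h4 := S.s_pos i
  nlinarith [mul_le_mul_of_nonneg_left h2 h3.le, mul_le_mul_of_nonneg_left h1 h4.le]

lemma inv_ℓ_pos (i : ι) : 0 < (S.ℓ i)⁻¹ := inv_pos.2 (S.ℓ_pos i)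

lemma lam_le (i : ι) : S.lam i ≤ S.c₀ * (S.ℓ i)⁻¹ := by
  rw [← div_eq_mul_inv, le_div_iff₀ (S.ℓ_pos i), mul_comm]
  exact S.ℓ_mul_le i

lemma s_mul_lam_nonneg (i : ι) : 0 ≤ S.s i * S.lam i := zero_le_one.trans (S.one_le i)

lemma r_le_one (i : ι) : S.r i ≤ 1 := by
  refine (S.r_le i).trans ((div_le_one (by positivity)).2 ?_)
  have : (0 : ℝ) ≤ n := Nat.cast_nonneg n
  linarith

lemma contDiff_pd_f (A : Fin (n + 1)) (a : Fin n) (i : ι) : ContDiff ℝ 1 (pd a (S.f A i)) := by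
  have := (S.contDiff_f A i).fderiv_right (m := 1) (by norm_num)
  exact this.clm_apply contDiff_const

lemma compact_pd_f (A : Fin (n + 1)) (a : Fin n) (i : ι) : HasCompactSupport (pd a (S.f A i)) :=
  (S.compact_f A i).fderiv_apply ℝ _

lemma continuous_pd_pd_f (A : Fin (n + 1)) (a b : Fin n) (i : ι) :
    Continuous (pd a (pd b (S.f A i))) :=
  ((S.contDiff_pd_f A b i).continuous_fderiv (by norm_num)).clm_apply continuous_const

/-- The mollified maps. -/
noncomputable def u (φ : E n → ℝ) (A : Fin (n + 1)) (i : ι) : E n → ℝ := moll φ (S.ℓ i) (S.f A i)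

lemma pd_u (hφ : IsMollifier φ) (A : Fin (n + 1)) (a : Fin n) (i : ι) :
    pd a (S.u φ A i) = moll φ (S.ℓ i) (pd a (S.f A i)) :=
  funext fun x => pd_moll' hφ.toIsKernel (S.ℓ_pos i)
    ((S.contDiff_f A i).of_le (by norm_num)) (S.compact_f A i) a x

lemma pd_pd_u (hφ : IsMollifier φ) (A : Fin (n + 1)) (a b : Fin n) (i : ι) :
    pd a (pd b (S.u φ A i)) = moll φ (S.ℓ i) (pd a (pd b (S.f A i))) := by
  rw [S.pd_u hφ]
  exact funext fun x => pd_moll' hφ.toIsKernel (S.ℓ_pos i) (S.contDiff_pd_f A b i)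
    (S.compact_pd_f A b i) a x

lemma smooth_u (hφ : IsMollifier φ) (A : Fin (n + 1)) : S.Smooth (S.u φ A) :=
  Eventually.of_forall fun i =>
    (contDiff_moll hφ.toIsKernel (S.ℓ_pos i) (S.contDiff_f A i).continuous).contDiffOn

/-- The second derivatives are at most sλ ≤ s ℓ⁻¹; this extra factor s is what makes the normal and
the dual frame slow and the second fundamental form divisible by s. -/
lemma slow_pd_u (hφ : IsMollifier φ) (A : Fin (n + 1)) (b : Fin n) :
    S.Slow (fun i => (S.ℓ i)⁻¹) S.s (fun i => pd b (S.u φ A i)) := by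
  refine ⟨(S.smooth_u hφ A).pd b, ?_, fun a => ?_⟩
  · simp only [S.pd_u hφ]
    exact (Family.Symbol.moll S.ℓ_pos hφ.toIsKernel (fun i => (S.contDiff_pd_f A b i).continuous)
      ⟨S.K, S.K_nonneg, Eventually.of_forall fun i x hx z hz =>
        (S.pd_f_le i x hx z hz A b).trans (by simp)⟩).isO
  · simp only [S.pd_pd_u hφ]
    refine (Family.Symbol.moll (σ := fun i => S.s i * S.lam i) S.ℓ_pos hφ.toIsKernel
      (fun i => S.continuous_pd_pd_f A a b i) ⟨1, zero_le_one, Eventually.of_forall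
        fun i x hx z hz => (S.pd_pd_f_le i x hx z hz A a b).trans (by simp)⟩).mono 1 (fun i => ?_)
      fun i => (S.inv_ℓ_pos i).le
    have := S.lam_le i
    have h2 : S.c₀ * (S.ℓ i)⁻¹ ≤ (S.ℓ i)⁻¹ :=
      mul_le_of_le_one_left (S.inv_ℓ_pos i).le S.c₀_le_one
    rw [one_mul]
    exact mul_le_mul_of_nonneg_left (this.trans h2) (S.s_pos i).le

lemma osc_pd_f {i : ι} {x : E n} (hx : x ∈ S.D i) {z : E n} (hz : ‖z - x‖ ≤ S.ℓ i)
    (A : Fin (n + 1)) (a : Fin n) :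
    |pd a (S.f A i) z - pd a (S.f A i) x| ≤ n * S.c₀ * S.s i := by
  have h := abs_sub_le_of_pd (f := pd a (S.f A i)) (x := x) (y := z) (z := x) (S.s_mul_lam_nonneg i)
    (fun y _ => (S.contDiff_pd_f A a i).differentiable (by norm_num) y)
    (fun y hy b => S.pd_pd_f_le i x hx y hy A b a) hz (by simpa using (S.ℓ_pos i).le)
  refine h.trans ?_
  have h1 : S.s i * S.lam i * ‖z - x‖ ≤ S.s i * S.lam i * S.ℓ i :=
    mul_le_mul_of_nonneg_left hz (S.s_mul_lam_nonneg i)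
  have h2 : S.s i * (S.ℓ i * S.lam i) ≤ S.s i * S.c₀ :=
    mul_le_mul_of_nonneg_left (S.ℓ_mul_le i) (S.s_pos i).le
  have hn : (0 : ℝ) ≤ n := Nat.cast_nonneg n
  nlinarith [mul_le_mul_of_nonneg_left (h1.trans (by linarith : _ ≤ S.s i * S.c₀)) hn]

/-- The defect of the localized map. -/
noncomputable def err (a b : Fin n) (i : ι) (z : E n) : ℝ :=
  S.g a b i z - ∑ A, pd a (S.f A i) z * pd b (S.f A i) z - S.s i ^ 2 * h0 n a b

lemma continuous_mul_pd_f (A : Fin (n + 1)) (a b : Fin n) (i : ι) :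
    Continuous fun z => pd a (S.f A i) z * pd b (S.f A i) z :=
  (S.contDiff_pd_f A a i).continuous.mul (S.contDiff_pd_f A b i).continuous

lemma continuous_sum_mul_pd_f (a b : Fin n) (i : ι) :
    Continuous fun z => ∑ A, pd a (S.f A i) z * pd b (S.f A i) z :=
  continuous_finsetSum _ fun A _ => S.continuous_mul_pd_f A a b i

lemma continuous_err (a b : Fin n) (i : ι) : Continuous (S.err a b i) :=
  ((S.contDiff_g a b i).continuous.sub (S.continuous_sum_mul_pd_f a b i)).sub continuous_const

/-- The normalized target for the metric increment. -/
noncomputable def target (φ : E n → ℝ) (a b : Fin n) (i : ι) (x : E n) : ℝ :=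
  (S.s i ^ 2)⁻¹ * (moll φ (S.ℓ i) (S.g a b i) x -
    ∑ A, pd a (S.u φ A i) x * pd b (S.u φ A i) x - S.d i * h0 n a b)

/-- The defect of the mollified map is the mollified defect plus the commutator of ∂_a f and ∂_b f;
the factor ½ undoes the doubling in the symmetric commutator. The main term is a multiple of h₀
close to 1. -/
lemma target_eq (hφ : IsMollifier φ) (a b : Fin n) (i : ι) (x : E n) :
    S.target φ a b i x = (1 - (S.s i ^ 2)⁻¹ * S.d i) * h0 n a b +
      (S.s i ^ 2)⁻¹ * (moll φ (S.ℓ i) (S.err a b i) x + 1 / 2 * ∑ A,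
        Family.commutator S.ℓ (fun i => pd a (S.f A i)) (fun i => pd b (S.f A i)) φ φ i x) := by
  have hk := hφ.toIsKernel
  have e : moll φ (S.ℓ i) (S.err a b i) x = moll φ (S.ℓ i) (S.g a b i) x -
      ∑ A, moll φ (S.ℓ i) (fun z => pd a (S.f A i) z * pd b (S.f A i) z) x -
      S.s i ^ 2 * h0 n a b := by
    have h1 := moll_sub (ℓ := S.ℓ i) hk ((S.contDiff_g a b i).continuous.sub
      (S.continuous_sum_mul_pd_f a b i)) (continuous_const (y := S.s i ^ 2 * h0 n a b)) x
    have h2 := moll_sub (ℓ := S.ℓ i) hk (S.contDiff_g a b i).continuous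
      (S.continuous_sum_mul_pd_f a b i) x
    have h3 := moll_sum (ℓ := S.ℓ i) Finset.univ hk (fun A _ => S.continuous_mul_pd_f A a b i) x
    rw [← h3, ← h2]
    rw [moll_const hφ] at h1
    exact h1
  have hs : S.s i ^ 2 ≠ 0 := (pow_pos (S.s_pos i) 2).ne'
  simp only [Family.commutator_eq hφ, target, e, S.pd_u hφ, ← Finset.mul_sum,
    Finset.sum_sub_distrib]
  linear_combination (h0 n a b) * inv_mul_cancel₀ hs

lemma target_symm (a b : Fin n) (i : ι) (x : E n) : S.target φ a b i x = S.target φ b a i x := by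
  have h1 : S.g a b i = S.g b a i := funext (S.g_symm a b i)
  have h2 : h0 n a b = h0 n b a := by simp only [h0_apply, eq_comm]
  simp only [target, h1, h2, mul_comm]

lemma abs_inv_sq_mul_d_le (i : ι) : |(S.s i ^ 2)⁻¹ * S.d i| ≤ S.r i := by
  have hs := pow_pos (S.s_pos i) 2
  rw [abs_mul, abs_of_pos (inv_pos.2 hs), inv_mul_le_iff₀ hs, mul_comm]
  exact S.abs_d_le i

lemma abs_moll_err_le (hφ : IsMollifier φ) (a b : Fin n) {i : ι} {x : E n} (hx : x ∈ S.D i) :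
    |moll φ (S.ℓ i) (S.err a b i) x| ≤ S.r i * S.s i ^ 2 := by
  have := abs_moll_le hφ.toIsKernel (S.ℓ_pos i) fun z hz => S.err_le i x hx z hz a b
  rwa [hφ.integral_abs, one_mul] at this

lemma nearOsc_pd_f (A : Fin (n + 1)) (a : Fin n) :
    S.NearOsc S.ℓ S.s (fun i => pd a (S.f A i)) :=
  ⟨n * S.c₀, mul_nonneg (Nat.cast_nonneg n) S.c₀_pos.le, Eventually.of_forall
    fun _ _ hx _ hz => S.osc_pd_f hx hz A a⟩

lemma symbol_target (hφ : IsMollifier φ) (a b : Fin n) :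
    S.Symbol (fun i => (S.ℓ i)⁻¹) (fun _ => 1) (S.target φ a b) := by
  have hμ : ∀ i, 0 ≤ (S.ℓ i)⁻¹ := fun i => (S.inv_ℓ_pos i).le
  have h1 : S.Symbol (fun i => (S.ℓ i)⁻¹) (fun _ => 1)
      (fun i _ => (1 - (S.s i ^ 2)⁻¹ * S.d i) * h0 n a b) := by
    refine Family.Symbol.const _ (2 * |h0 n a b|) fun i => ?_
    rw [abs_mul, mul_one]
    refine mul_le_mul_of_nonneg_right ((abs_sub _ _).trans ?_) (abs_nonneg _)
    rw [abs_one]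
    linarith [S.abs_inv_sq_mul_d_le i, S.r_le_one i]
  have h2 : S.Symbol (fun i => (S.ℓ i)⁻¹) (fun i => S.s i ^ 2)
      (fun i => moll φ (S.ℓ i) (S.err a b i)) :=
    Family.Symbol.moll S.ℓ_pos hφ.toIsKernel (S.continuous_err a b) ⟨1, zero_le_one,
      Eventually.of_forall fun i x hx z hz => (S.err_le i x hx z hz a b).trans
        (mul_le_mul_of_nonneg_right (S.r_le_one i) (sq_nonneg _))⟩
  have h3 : S.Symbol (fun i => (S.ℓ i)⁻¹) (fun i => S.s i ^ 2) (fun i x => 1 / 2 * ∑ A,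
      Family.commutator S.ℓ (fun i => pd a (S.f A i)) (fun i => pd b (S.f A i)) φ φ i x) := by
    refine (Family.Symbol.sum _ fun A _ => ?_).const_mul _
    exact (Family.Symbol.commutator S.ℓ_pos (fun i => (S.contDiff_pd_f A a i).continuous)
      (fun i => (S.contDiff_pd_f A b i).continuous) (S.nearOsc_pd_f A a) (S.nearOsc_pd_f A b)
      hφ.toIsKernel hφ.toIsKernel).mono 1 (fun i => by rw [one_mul, sq]) hμ
  refine (h1.add (((h2.add h3).smul fun i => (S.s i ^ 2)⁻¹).mono 1 (fun i => ?_) hμ)).congr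
    (Family.Eq.of_eq fun i x => (S.target_eq hφ a b i x).symm)
  have hs := pow_pos (S.s_pos i) 2
  rw [abs_of_pos (inv_pos.2 hs), inv_mul_cancel₀ hs.ne', one_mul]

/-- The coefficients of h₀ are 1. Replacing 1 by 1 − d/s² costs r, the defect costs (n + 2)r, and
the commutator costs (n + 2)q ≤ 1/8 by the choice of c₀. As (n + 3)r ≤ 1/8, at least 3/4 remains. -/
lemma le_coeff_target (hφ : IsMollifier φ) (p : Fin n × Fin n) {i : ι} {x : E n}
    (hx : x ∈ S.D i) : 3 / 4 ≤ coeff (fun a b => S.target φ a b i x) p := by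
  have hs := pow_pos (S.s_pos i) 2
  have hn : (0 : ℝ) ≤ n := Nat.cast_nonneg n
  have hc : S.c₀ * (4 * (n + 2) ^ 2) ≤ 1 := (le_div_iff₀ (by positivity)).1 S.c₀_le
  have hr : S.r i * (8 * (n + 3)) ≤ 1 := (le_div_iff₀ (by positivity)).1 (S.r_le i)
  have hc0 := S.c₀_pos
  set q := (n + 1) * (2 * (n * S.c₀) ^ 2) with hq
  have hq8 : (n + 2) * q ≤ 1 / 8 := by
    have e1 : (n + 2 : ℝ) * q ≤ (S.c₀ * (4 * (n + 2) ^ 2)) ^ 2 / 8 := by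
      have e2 : (S.c₀ * (4 * (n + 2) ^ 2)) ^ 2 / 8 - (n + 2 : ℝ) * q =
        2 * S.c₀ ^ 2 * (n + 2) * ((n + 2) ^ 3 - (n + 1) * n ^ 2) := by rw [hq]; ring
      have e3 : (0 : ℝ) ≤ (n + 2) ^ 3 - (n + 1) * n ^ 2 := by ring_nf; positivity
      have : (0 : ℝ) ≤ 2 * S.c₀ ^ 2 * (n + 2) * ((n + 2) ^ 3 - (n + 1) * n ^ 2) := by positivity
      linarith
    have e4 : (S.c₀ * (4 * (n + 2) ^ 2)) ^ 2 ≤ 1 := pow_le_one₀ (by positivity) hc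
    linarith
  have hb : ∀ a b, |(S.s i ^ 2)⁻¹ * (moll φ (S.ℓ i) (S.err a b i) x + 1 / 2 * ∑ A,
      Family.commutator S.ℓ (fun i => pd a (S.f A i)) (fun i => pd b (S.f A i)) φ φ i x)| ≤
      S.r i + q := fun a b => by
    rw [abs_mul, abs_of_pos (inv_pos.2 hs), inv_mul_le_iff₀ hs]
    refine (abs_add_le _ _).trans ?_
    have e1 := S.abs_moll_err_le hφ a b hx
    have e2 : |∑ A, Family.commutator S.ℓ (fun i => pd a (S.f A i)) (fun i => pd b (S.f A i)) φ φ
        i x| ≤ (n + 1) * (4 * (n * S.c₀ * S.s i * (n * S.c₀ * S.s i))) := by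
      refine (Finset.abs_sum_le_sum_abs _ _).trans ((Finset.sum_le_sum fun A _ =>
        Family.abs_commutator_le S.ℓ_pos (fun i => (S.contDiff_pd_f A a i).continuous)
        (fun i => (S.contDiff_pd_f A b i).continuous) (fun z hz => S.osc_pd_f hx hz A a)
        (fun z hz => S.osc_pd_f hx hz A b) hφ.toIsKernel hφ.toIsKernel).trans (le_of_eq ?_))
      simp [hφ.integral_abs]
    rw [abs_mul (1 / 2 : ℝ), abs_of_pos (one_half_pos (α := ℝ))]
    calc _ ≤ S.r i * S.s i ^ 2 + 1 / 2 * ((n + 1) * (4 * (n * S.c₀ * S.s i * (n * S.c₀ * S.s i)))) :=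
          add_le_add e1 (mul_le_mul_of_nonneg_left e2 one_half_pos.le)
      _ = _ := by rw [hq]; ring
  simp only [S.target_eq hφ]
  rw [coeff_add, coeff_mul (1 - (S.s i ^ 2)⁻¹ * S.d i) (fun a b => h0 n a b), coeff_h0, mul_one]
  have h1 := (abs_le.1 (abs_coeff_le _ p hb)).1
  have h2 := (abs_le.1 (S.abs_inv_sq_mul_d_le i)).2
  nlinarith

/-- The metric of the mollified map. -/
lemma metric_u_eq (φ : E n → ℝ) (a b : Fin n) (i : ι) (x : E n) :
    ∑ A, pd a (S.u φ A i) x * pd b (S.u φ A i) x =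
      moll φ (S.ℓ i) (S.g a b i) x - S.s i ^ 2 * S.target φ a b i x - S.d i * h0 n a b := by
  have hs : S.s i ^ 2 ≠ 0 := (pow_pos (S.s_pos i) 2).ne'
  rw [target, mul_inv_cancel_left₀ hs]
  ring

/-- The constant is kept explicit rather than hidden in an O, because the term λ⁻² of the conclusion
has coefficient one. -/
lemma abs_moll_g_sub_le (hφ : IsMollifier φ) (a b : Fin n) {i : ι} {x : E n} (hx : x ∈ S.D i) :
    |moll φ (S.ℓ i) (S.g a b i) x - S.g a b i x| ≤ n ^ 2 * S.K * S.ℓ i ^ 2 :=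
  abs_moll_sub_le_sq hφ (S.ℓ_pos i) (S.contDiff_g a b i) S.K_nonneg
    fun z hz a' b' => S.pd_pd_g_le i x hx z hz a b a' b'

lemma isO_moll_g_sub (hφ : IsMollifier φ) (a b : Fin n) :
    S.IsO (fun i => S.s i ^ 2) (fun i x => moll φ (S.ℓ i) (S.g a b i) x - S.g a b i x) := by
  refine ⟨n ^ 2 * S.K, mul_nonneg (by positivity) S.K_nonneg, Eventually.of_forall
    fun i x hx => (S.abs_moll_g_sub_le hφ a b hx).trans ?_⟩
  refine mul_le_mul_of_nonneg_left (pow_le_pow_left₀ (S.ℓ_pos i).le ?_ 2)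
    (mul_nonneg (by positivity) S.K_nonneg)
  exact (S.ℓ_le i).trans (mul_le_of_le_one_left (S.s_pos i).le S.c₀_le_one)

lemma tendsto_sq : Tendsto (fun i => S.s i ^ 2) S.l (𝓝 0) := by
  simpa using S.s_tendsto.pow 2

lemma isO_metric_u_sub (hφ : IsMollifier φ) (a b : Fin n) :
    S.IsO (fun i => S.s i ^ 2)
      (fun i x => ∑ A, pd a (S.u φ A i) x * pd b (S.u φ A i) x - S.g a b i x) := by
  have h1 : S.IsO (fun i => S.s i ^ 2) (fun i x => S.s i ^ 2 * S.target φ a b i x) := by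
    obtain ⟨C, hC, h⟩ := (S.symbol_target hφ a b).isO
    refine ⟨C, hC, ?_⟩
    filter_upwards [h] with i h x hx
    rw [abs_mul, abs_of_nonneg (sq_nonneg _), mul_comm]
    exact mul_le_mul_of_nonneg_right ((h x hx).trans_eq (mul_one C)) (sq_nonneg _)
  have h2 : S.IsO (fun i => S.s i ^ 2) (fun i _ => S.d i * h0 n a b) := by
    refine ⟨|h0 n a b|, abs_nonneg _, Eventually.of_forall fun i x _ => ?_⟩
    rw [abs_mul, mul_comm]
    refine mul_le_mul_of_nonneg_left ((S.abs_d_le i).trans ?_) (abs_nonneg _)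
    exact mul_le_of_le_one_left (sq_nonneg _) (S.r_le_one i)
  refine ((S.isO_moll_g_sub hφ a b).add ((h1.const_mul (-1)).add (h2.const_mul (-1)))).congr
    (Family.Eq.of_eq fun i x => ?_)
  rw [S.metric_u_eq]
  ring

/-- Maps whose metric is close to `g` are immersions, quantitatively. -/
lemma eventually_le_det {G : Fin n → Fin n → ι → E n → ℝ}
    (hG : ∀ a b, S.IsO (fun i => S.s i ^ 2) (fun i x => G a b i x - S.g a b i x)) :
    ∀ᶠ i in S.l, ∀ x ∈ S.D i, S.c ≤ (Matrix.of fun a b => G a b i x).det := by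
  have h : ∀ᶠ i in S.l, ∀ a b, ∀ x ∈ S.D i, |G a b i x - S.g a b i x| ≤ S.ε :=
    eventually_all.2 fun a => eventually_all.2 fun b =>
      (hG a b).eventually_le S.tendsto_sq S.ε_pos
  filter_upwards [h] with i h x hx
  exact S.le_det i x hx _ fun a b => h a b x hx

end StageFamily
end NashKuiper

/-! ### The perturbed map and its estimates. -/

namespace NashKuiper

open Filter Topology
open scoped ContDiff

variable {ι : Type*} {n : ℕ}

namespace Family

variable {F : Family ι n} {μ₀ μ s ρ σ : ι → ℝ} {f g : ι → E n → ℝ}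

lemma Pot.mul_slow (hμ₀ : ∀ i, 0 < μ₀ i) (hμ : ∀ i, μ₀ i ≤ μ i) (hs : ∀ i, 0 ≤ s i)
    (hs1 : ∀ i, s i ≤ 1) (hf : F.Pot (fun i => (μ₀ i)⁻¹) μ (fun _ => 1) f) (hg : F.Slow μ₀ s g) :
    F.Pot (fun i => (μ₀ i)⁻¹) μ (fun _ => 1) (fun i x => f i x * g i x) := by
  have hμ' : ∀ i, 0 ≤ μ i := fun i => (hμ₀ i).le.trans (hμ i)
  refine Pot.mul hf (Pot.freq_mono hg 1 (fun i => by simpa using hμ i)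
    (fun i => mul_nonneg (hs i) (hμ₀ i).le) (fun i => (hμ₀ i).le) hμ') 1 hμ' (fun i => ?_)
    (fun i => ?_) (fun i => by simp) (fun i => ?_) (fun i => by simp)
  · rw [one_mul, inv_mul_eq_div, one_le_div (hμ₀ i)]
    exact hμ i
  · simpa using mul_le_mul (hs1 i) (hμ i) (hμ₀ i).le zero_le_one
  · rw [mul_one, mul_comm, mul_assoc, mul_inv_cancel₀ (hμ₀ i).ne', mul_one]
    exact hs1 i

lemma Pot.smul (hf : F.Pot ρ μ σ f) (c : ι → ℝ) :
    F.Pot (fun i => |c i| * ρ i) μ (fun i => |c i| * σ i) (fun i x => c i * f i x) := by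
  refine ⟨(Smooth.const c).mul hf.smooth, ?_, fun a => ((hf.pd a).smul c).congr ?_⟩
  · obtain ⟨C, hC, h⟩ := hf.isO
    refine ⟨C, hC, ?_⟩
    filter_upwards [h] with i h x hx
    rw [abs_mul, mul_left_comm]
    exact mul_le_mul_of_nonneg_left (h x hx) (abs_nonneg _)
  · filter_upwards [hf.smooth.differentiableAt] with i h x hx
    exact (pd_const_mul a (c i) (h x hx)).symm

lemma IsO.exists_uniform {κ : Type*} [Finite κ] {f : κ → ι → E n → ℝ} (hσ : ∀ i, 0 ≤ σ i)
    (hf : ∀ k, F.IsO σ (f k)) :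
    ∃ C, 0 ≤ C ∧ ∀ᶠ i in F.l, ∀ x ∈ F.D i, ∀ k, |f k i x| ≤ C * σ i := by
  classical
  cases nonempty_fintype κ
  choose C hC h using hf
  refine ⟨∑ k, C k, Finset.sum_nonneg fun k _ => hC k, ?_⟩
  filter_upwards [eventually_all.2 h] with i h x hx k
  exact (h k x hx).trans (mul_le_mul_of_nonneg_right
    (Finset.single_le_sum (fun k _ => hC k) (Finset.mem_univ k)) (hσ i))

end Family

namespace StageFamily

variable (S : StageFamily ι n) {φ : E n → ℝ}

/-- The quadratic mollification estimate gives sλ ℓ², and λℓ ≤ 1. -/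
lemma abs_u_sub_le (hφ : IsMollifier φ) (A : Fin (n + 1)) {i : ι} {x : E n} (hx : x ∈ S.D i) :
    |S.u φ A i x - S.f A i x| ≤ n ^ 2 * (S.s i * S.ℓ i) := by
  refine (abs_moll_sub_le_sq hφ (S.ℓ_pos i) (S.contDiff_f A i) (S.s_mul_lam_nonneg i)
    fun z hz a b => S.pd_pd_f_le i x hx z hz A a b).trans ?_
  have h : S.ℓ i * S.lam i ≤ 1 := (S.ℓ_mul_le i).trans S.c₀_le_one
  have h2 := mul_le_mul_of_nonneg_left h (mul_pos (S.s_pos i) (S.ℓ_pos i)).le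
  rw [mul_assoc]
  refine mul_le_mul_of_nonneg_left ?_ (by positivity)
  linarith

lemma abs_pd_u_sub_le (hφ : IsMollifier φ) (A : Fin (n + 1)) (a : Fin n) {i : ι} {x : E n}
    (hx : x ∈ S.D i) : |pd a (S.u φ A i) x - pd a (S.f A i) x| ≤ n * S.c₀ * S.s i := by
  rw [S.pd_u hφ]
  exact abs_moll_sub_le hφ (S.ℓ_pos i) (S.contDiff_pd_f A a i).continuous
    fun z hz => S.osc_pd_f hx hz A a

/-- Existence of the corrugated maps, with estimates in terms of the components. -/
theorem exists_perturbation [NeZero n] {Λ : ι → ℝ} (hΛ : ∀ i, 1 ≤ Λ i) (hΛl : Tendsto Λ S.l atTop)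
    (J : ℕ) : ∃ v : Fin (n + 1) → ι → E n → ℝ, (∀ A, S.Smooth (v A)) ∧
      (∀ᶠ i in S.l, ∀ x ∈ S.D i,
        S.c ≤ (Matrix.of fun a b => ∑ A, pd a (v A i) x * pd b (v A i) x).det) ∧
      ∃ C, 0 ≤ C ∧ ∀ᶠ i in S.l, ∀ x ∈ S.D i,
        (∀ a b, |S.g a b i x - ∑ A, pd a (v A i) x * pd b (v A i) x - S.d i * h0 n a b| ≤
          C * (S.s i ^ 2 * ((Λ i ^ J)⁻¹ + S.s i)) + n ^ 2 * S.K * S.ℓ i ^ 2) ∧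
        ∀ A, |v A i x - S.f A i x| ≤ C * (S.s i * S.ℓ i) ∧
          (∀ a, |pd a (v A i) x - pd a (S.f A i) x| ≤ C * S.s i) ∧
          ∀ a b, |pd a (pd b (v A i)) x| ≤
            C * (S.s i * ((S.ℓ i)⁻¹ * Λ i ^ (J * (nStar n - n) + n))) := by
  obtain ⟨φ, hφ⟩ := exists_isMollifier n
  have hμ₀ : ∀ i, 0 < (S.ℓ i)⁻¹ := S.inv_ℓ_pos
  have hμ0 : ∀ i, 0 ≤ (S.ℓ i)⁻¹ := fun i => (hμ₀ i).le
  have hs0 : ∀ i, 0 ≤ S.s i := fun i => (S.s_pos i).le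
  have hΛ0 : ∀ i, 0 < Λ i := fun i => one_pos.trans_le (hΛ i)
  set q := J * (nStar n - n) + n with hq
  have hμ : ∀ i, (S.ℓ i)⁻¹ ≤ (S.ℓ i)⁻¹ * Λ i ^ q := fun i =>
    le_mul_of_one_le_right (hμ0 i) (one_le_pow₀ (hΛ i))
  have hμμ : ∀ i, 0 ≤ (S.ℓ i)⁻¹ * Λ i ^ q := fun i => (hμ0 i).trans (hμ i)
  set U : Fin (n + 1) → Fin n → ι → E n → ℝ := fun A b i => pd b (S.u φ A i)
  have hU : ∀ A b, S.Slow (fun i => (S.ℓ i)⁻¹) S.s (U A b) := S.slow_pd_u hφ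
  have hdet : ∀ᶠ i in S.l, ∀ x ∈ S.D i,
      S.c ≤ ((Family.jac U i x).transpose * Family.jac U i x).det := by
    filter_upwards [S.eventually_le_det (S.isO_metric_u_sub hφ)] with i h x hx
    refine (h x hx).trans_eq (congrArg Matrix.det ?_)
    ext a b
    simp [Family.jac, Matrix.mul_apply, U]
  obtain ⟨ζ, hζ, hζ1, hζu⟩ := Family.exists_normal hμ0 S.s_le hU S.c_pos hdet
  obtain ⟨Q, hQ, hUQ⟩ := Family.exists_dual hμ0 S.s_le hU S.c_pos hdet
  obtain ⟨W, w, hW, hw, hWw⟩ := Family.exists_vonKarman hμ₀ hΛ hΛl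
    (Family.Symbol.secondForm S.s_pos S.s_le hμ0 hU hζ)
    (Family.secondForm_symm S.s (S.u φ) ζ) (S.symbol_target hφ) S.target_symm
    (fun p => Eventually.of_forall fun i x hx => S.le_coeff_target hφ p hx) J
  -- The tangential field with ∂_a u · P = w_a, by duality of the frame.
  set P : Fin (n + 1) → ι → E n → ℝ := fun A i x => ∑ c, w c i x * Q A c i x
  have hP : ∀ A, S.Pot (fun i => (S.ℓ i)⁻¹⁻¹) (fun i => (S.ℓ i)⁻¹ * Λ i ^ q) (fun _ => 1) (P A) :=
    fun A => Family.Pot.sum _ fun c _ => Family.Pot.mul_slow hμ₀ hμ hs0 S.s_le (hw c) (hQ A c)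
  have hPw : ∀ a, S.Eq (fun i x => ∑ A, pd a (S.u φ A i) x * P A i x) (w a) := fun a => by
    filter_upwards [hUQ] with i h x hx
    simp only [P, Finset.mul_sum]
    rw [Finset.sum_comm]
    have e : ∀ c, ∑ A, pd a (S.u φ A i) x * (w c i x * Q A c i x) =
        w c i x * if a = c then 1 else 0 := fun c => by
      rw [← h x hx a c, Finset.mul_sum]
      exact Finset.sum_congr rfl fun A _ => by ring
    simp [e]
  have hmet := Family.metric_expansion S.s_pos S.s_le hμ₀ (S.smooth_u hφ) hU hζ hζ1 hζu hW hP hPw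
  set p : Fin (n + 1) → ι → E n → ℝ := fun A i x =>
    S.s i * (W i x * ζ A i x) + S.s i ^ 2 * P A i x with hp
  have hpp : ∀ A, S.Pot (fun i => S.s i * S.ℓ i) (fun i => (S.ℓ i)⁻¹ * Λ i ^ q) S.s (p A) := by
    intro A
    refine (((Family.Pot.mul_slow hμ₀ hμ hs0 S.s_le hW (hζ A)).smul S.s).mono 1 (fun i => ?_)
      (fun i => ?_) hμμ).add (((hP A).smul fun i => S.s i ^ 2).mono 1 (fun i => ?_)
      (fun i => ?_) hμμ)
    · rw [abs_of_nonneg (hs0 i), inv_inv, one_mul]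
    · rw [abs_of_nonneg (hs0 i), one_mul, mul_one]
    · rw [abs_of_nonneg (sq_nonneg _), inv_inv, one_mul]
      exact mul_le_mul_of_nonneg_right (pow_le_of_le_one (hs0 i) (S.s_le i) two_ne_zero)
        (S.ℓ_pos i).le
    · rw [abs_of_nonneg (sq_nonneg _), one_mul, mul_one]
      exact pow_le_of_le_one (hs0 i) (S.s_le i) two_ne_zero
  have hpd : ∀ A a, S.Eq (fun i => pd a fun x => S.u φ A i x + p A i x)
      (fun i x => pd a (S.u φ A i) x + pd a (p A i) x) := fun A a =>
    Family.pd_add_eq (S.smooth_u hφ A) (hpp A).smooth a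
  have hpd2 : ∀ A a b, S.Eq (fun i => pd a (pd b fun x => S.u φ A i x + p A i x))
      (fun i x => pd a (pd b (S.u φ A i)) x + pd a (pd b (p A i)) x) := fun A a b => by
    filter_upwards [(hpd A b).pd a, Family.pd_add_eq ((S.smooth_u hφ A).pd b)
      ((hpp A).smooth.pd b) a] with i h1 h2 x hx
    exact (h1 hx).trans (h2 hx)
  have hinv1 : ∀ i, (Λ i ^ J)⁻¹ ≤ 1 := fun i => inv_le_one_of_one_le₀ (one_le_pow₀ (hΛ i))
  have hsm : ∀ A, S.Smooth (fun i x => S.u φ A i x + p A i x) := fun A =>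
    (S.smooth_u hφ A).add (hpp A).smooth
  refine ⟨fun A i x => S.u φ A i x + p A i x, hsm, ?_, ?_⟩
  -- The metric of the perturbed map is within O(s²) of g, and s → 0, so its determinant is
  -- eventually bounded below.
  · refine S.eventually_le_det
      (G := fun a b i x => ∑ A, pd a (fun x => S.u φ A i x + p A i x) x *
        pd b (fun x => S.u φ A i x + p A i x) x) fun a b => ?_
    have h1 := (hmet a b).mono (τ := fun i => S.s i ^ 2) 1 fun i => by
      rw [one_mul]
      exact pow_le_pow_of_le_one (hs0 i) (S.s_le i) (by norm_num)
    have h2 : S.IsO (fun i => S.s i ^ 2) (fun i x => S.s i ^ 2 *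
        (vonKarman W w (Family.secondForm S.s (S.u φ) ζ) a b i x - S.target φ a b i x +
          S.target φ a b i x)) := by
      obtain ⟨C, hC, h⟩ := ((hWw a b).mono (τ := fun _ => 1) 1 (by simpa using hinv1)).add
        (S.symbol_target hφ a b).isO
      refine ⟨C, hC, ?_⟩
      filter_upwards [h] with i h x hx
      rw [abs_mul, abs_of_nonneg (sq_nonneg _), mul_comm]
      exact mul_le_mul_of_nonneg_right ((h x hx).trans_eq (mul_one C)) (sq_nonneg _)
    refine ((h1.add h2).add (S.isO_metric_u_sub hφ a b)).congr (Family.Eq.of_eq fun i x => ?_)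
    ring
  · obtain ⟨C1, hC1, h1⟩ := Family.IsO.exists_uniform (κ := Fin n × Fin n)
      (fun i => pow_nonneg (hs0 i) 3) fun k => hmet k.1 k.2
    obtain ⟨C2, hC2, h2⟩ := Family.IsO.exists_uniform (κ := Fin n × Fin n)
      (fun i => inv_nonneg.2 (pow_nonneg (hΛ0 i).le J)) fun k => hWw k.1 k.2
    obtain ⟨C3, hC3, h3⟩ := Family.IsO.exists_uniform
      (fun i => mul_nonneg (hs0 i) (S.ℓ_pos i).le) fun A => (hpp A).isO
    obtain ⟨C4, hC4, h4⟩ := Family.IsO.exists_uniform (κ := Fin (n + 1) × Fin n) hs0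
      fun k => ((hpp k.1).pd k.2).isO
    obtain ⟨C5, hC5, h5⟩ := Family.IsO.exists_uniform (κ := Fin (n + 1) × Fin n × Fin n)
      (fun i => mul_nonneg (hs0 i) (hμμ i)) fun k => (((hpp k.1).pd k.2.2).pd k.2.1).isO
    obtain ⟨C6, hC6, h6⟩ := Family.IsO.exists_uniform (κ := Fin (n + 1) × Fin n × Fin n)
      (fun i => mul_nonneg (hs0 i) (hμ0 i)) fun k => ((hU k.1 k.2.2).pd k.2.1).isO
    have hc0 := S.c₀_pos.le
    set C := C1 + C2 + C3 + C4 + C5 + C6 + n ^ 2 + n * S.c₀ with hCdef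
    have hn2 : (0 : ℝ) ≤ n ^ 2 := by positivity
    have hnc : 0 ≤ n * S.c₀ := by positivity
    refine ⟨C, by positivity, ?_⟩
    have hpd' : ∀ᶠ i in S.l, ∀ A a, Set.EqOn (pd a fun x => S.u φ A i x + p A i x)
        (fun x => pd a (S.u φ A i) x + pd a (p A i) x) (S.D i) :=
      eventually_all.2 fun A => eventually_all.2 fun a => hpd A a
    have hpd2' : ∀ᶠ i in S.l, ∀ A a b, Set.EqOn (pd a (pd b fun x => S.u φ A i x + p A i x))
        (fun x => pd a (pd b (S.u φ A i)) x + pd a (pd b (p A i)) x) (S.D i) :=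
      eventually_all.2 fun A => eventually_all.2 fun a => eventually_all.2 fun b => hpd2 A a b
    filter_upwards [h1, h2, h3, h4, h5, h6, hpd', hpd2'] with i h1 h2 h3 h4 h5 h6 hpd hpd2 x hx
    have hs2 := sq_nonneg (S.s i)
    refine ⟨fun a b => ?_, fun A => ⟨?_, fun a => ?_, fun a b => ?_⟩⟩
    · have e1 := h1 x hx (a, b)
      have e2 := mul_le_mul_of_nonneg_left (h2 x hx (a, b)) hs2
      rw [← abs_of_nonneg hs2, ← abs_mul, abs_of_nonneg hs2] at e2
      have e3 := S.abs_moll_g_sub_le hφ a b hx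
      dsimp only at e1 e2
      rw [S.metric_u_eq] at e1
      have e4 : C1 * S.s i ^ 3 + S.s i ^ 2 * (C2 * (Λ i ^ J)⁻¹) ≤
          C * (S.s i ^ 2 * ((Λ i ^ J)⁻¹ + S.s i)) := by
        have p1 : 0 ≤ S.s i ^ 2 * (Λ i ^ J)⁻¹ :=
          mul_nonneg hs2 (inv_nonneg.2 (pow_nonneg (hΛ0 i).le J))
        have p2 : 0 ≤ S.s i ^ 3 := pow_nonneg (hs0 i) 3
        have q1 : C1 ≤ C := by linarith
        have q2 : C2 ≤ C := by linarith
        nlinarith [mul_le_mul_of_nonneg_right q1 p2, mul_le_mul_of_nonneg_right q2 p1]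
      refine le_trans ?_ (add_le_add_left e4 _)
      rw [abs_le] at e1 e2 e3 ⊢
      constructor <;> linarith [e1.1, e1.2, e2.1, e2.2, e3.1, e3.2]
    · have e1 := S.abs_u_sub_le hφ A hx
      have e2 := h3 x hx A
      have hnn := mul_nonneg (hs0 i) (S.ℓ_pos i).le
      have q1 := mul_le_mul_of_nonneg_right (show (n : ℝ) ^ 2 + C3 ≤ C by linarith) hnn
      rw [abs_le] at e1 e2 ⊢
      constructor <;> linarith [e1.1, e1.2, e2.1, e2.2]
    · have e1 := S.abs_pd_u_sub_le hφ A a hx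
      have e2 := h4 x hx (A, a)
      rw [hpd A a hx]
      have q1 := mul_le_mul_of_nonneg_right (show n * S.c₀ + C4 ≤ C by linarith) (hs0 i)
      dsimp only at e2 ⊢
      rw [abs_le] at e1 e2 ⊢
      constructor <;> linarith [e1.1, e1.2, e2.1, e2.2]
    · have e1 := h5 x hx (A, a, b)
      have e2 := h6 x hx (A, a, b)
      rw [hpd2 A a b hx]
      have q1 := mul_le_mul_of_nonneg_right (show C5 + C6 ≤ C by linarith)
        (mul_nonneg (hs0 i) (hμμ i))
      have q2 := mul_le_mul_of_nonneg_left (mul_le_mul_of_nonneg_left (hμ i) (hs0 i)) hC6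
      dsimp only at e1 e2 ⊢
      refine (abs_add_le _ _).trans ((add_le_add (e2.trans q2) e1).trans ?_)
      linarith

end StageFamily
end NashKuiper

/-! ### The family of all admissible data, and thresholds. -/

namespace NashKuiper

open Filter Topology Metric
open scoped ContDiff

variable {n : ℕ}

/-- The data to which the stage is applied. -/
structure StageData (Ω : Set (E n)) (g : E n → Matrix (Fin n) (Fin n) ℝ) where
  U : Set (E n)
  u : E n → E (n + 1)
  r : ℝ
  δ : ℝ
  lam : ℝ
  V : Set (E n)
  δ' : ℝ
  Lam : ℝ
  U_subset : U ⊆ Ω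
  isOpen_U : IsOpen U
  bounded_U : Bornology.IsBounded U
  regular_u : CkClosure 2 u U
  r_pos : 0 < r
  r_le : r ≤ 1 / (8 * (n + 3))
  δ_pos : 0 < δ
  δ_le : δ ≤ 1
  le_lam : (Real.sqrt δ)⁻¹ ≤ lam
  metric_le : cNorm 0 U (fun x => g x - inducedMetric u x - δ • h0 n) ≤ ENNReal.ofReal (r * δ)
  norm_u_le : cNorm 2 U u ≤ ENNReal.ofReal (Real.sqrt δ * lam)
  nonempty_V : V.Nonempty
  compact_V : IsCompact (closure V)
  V_subset : closure V ⊆ U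
  δ'_lt : |δ'| < r * δ / ‖h0 n‖
  one_le_Lam : 1 ≤ Lam

namespace StageData

variable {Ω : Set (E n)} {g : E n → Matrix (Fin n) (Fin n) ℝ} (d : StageData Ω g)

/-- The width of the neighbourhood of `V` in `U`. -/
noncomputable def η : ℝ := min 1 (setDist d.V (frontier d.U))

lemma η_pos [NeZero n] : 0 < d.η :=
  lt_min one_pos (setDist_frontier_pos d.isOpen_U d.bounded_U d.nonempty_V d.compact_V d.V_subset)

lemma η_le_one : d.η ≤ 1 := min_le_left _ _

lemma thickening_subset : thickening d.η d.V ⊆ d.U :=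
  thickening_subset_of_le_setDist d.isOpen_U (subset_closure.trans d.V_subset) (min_le_right _ _)

lemma half_thickening_subset [NeZero n] : thickening (d.η / 2) d.V ⊆ d.U :=
  (thickening_mono (half_le_self d.η_pos.le) _).trans d.thickening_subset

lemma sqrt_pos : 0 < Real.sqrt d.δ := Real.sqrt_pos.2 d.δ_pos

lemma sqrt_le_one : Real.sqrt d.δ ≤ 1 := Real.sqrt_le_one.2 d.δ_le

lemma one_le_mul : 1 ≤ Real.sqrt d.δ * d.lam := (inv_le_iff_one_le_mul₀' d.sqrt_pos).1 d.le_lam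

lemma one_le_lam : 1 ≤ d.lam :=
  ((one_le_inv₀ d.sqrt_pos).2 d.sqrt_le_one).trans d.le_lam

lemma contDiffOn_component (A : Fin (n + 1)) : ContDiffOn ℝ 2 (fun x => d.u x A) d.U :=
  (contDiffOn_euclidean.1 d.regular_u.1) A

lemma differentiableAt_u {x : E n} (hx : x ∈ d.U) : DifferentiableAt ℝ d.u x :=
  (d.regular_u.1.contDiffAt (d.isOpen_U.mem_nhds hx)).differentiableAt (by norm_num)

lemma abs_metric_sub_le {x : E n} (hx : x ∈ d.U) (a b : Fin n) :
    |g x a b - ∑ A, pd a (fun y => d.u y A) x * pd b (fun y => d.u y A) x - d.δ * h0 n a b| ≤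
      d.r * d.δ := by
  have h := norm_le_of_cNorm (mul_pos d.r_pos d.δ_pos).le d.metric_le hx
  refine le_trans (le_of_eq ?_) ((abs_entry_le_norm _ a b).trans h)
  rw [← inducedMetric_apply a b (d.differentiableAt_u hx)]
  rfl

lemma one_le_norm_h0 [NeZero n] : 1 ≤ ‖h0 n‖ := by
  refine le_trans ?_ (abs_entry_le_norm (h0 n) 0 0)
  have : (1 : ℝ) ≤ n := by exact_mod_cast NeZero.one_le
  rw [h0_apply, if_pos rfl, abs_of_nonneg (by positivity)]
  linarith

lemma abs_δ'_le [NeZero n] : |d.δ'| ≤ d.r * d.δ :=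
  d.δ'_lt.le.trans (div_le_self (mul_pos d.r_pos d.δ_pos).le one_le_norm_h0)

/-- The filter `Lam → ∞`, `δ → 0`. -/
noncomputable def filter (Ω : Set (E n)) (g : E n → Matrix (Fin n) (Fin n) ℝ) :
    Filter (StageData Ω g) :=
  comap (fun d => d.Lam) atTop ⊓ comap (fun d => d.δ⁻¹) atTop

lemma tendsto_Lam : Tendsto (fun d : StageData Ω g => d.Lam) (filter Ω g) atTop :=
  tendsto_comap.mono_left inf_le_left

lemma tendsto_sqrt : Tendsto (fun d : StageData Ω g => Real.sqrt d.δ) (filter Ω g) (𝓝 0) := by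
  have h : Tendsto (fun d : StageData Ω g => d.δ⁻¹) (filter Ω g) atTop :=
    tendsto_comap.mono_left inf_le_right
  have h2 := (Real.continuous_sqrt.tendsto 0).comp (tendsto_inv_atTop_zero.comp h)
  simpa [Function.comp_def] using h2

/-- An eventual statement on the type of all data becomes one with thresholds that do not depend on
U, u, V or any other datum, only on Ω, g and the property itself. -/
lemma exists_thresholds {p : StageData Ω g → Prop} (h : ∀ᶠ d in filter Ω g, p d) :
    ∃ L T : ℝ, ∀ d : StageData Ω g, L ≤ d.Lam → T ≤ d.δ⁻¹ → p d := by
  obtain ⟨⟨L, T⟩, -, h⟩ := ((atTop_basis.comap _).inf (atTop_basis.comap _)).eventually_iff.1 h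
  exact ⟨L, T, fun d h1 h2 => h ⟨h1, h2⟩⟩

/-- Mollification acts on functions defined on all of space, so u and g are cut off away from V. The
extension of g is taken from the entries a ≤ b in order to remain symmetric everywhere. -/
lemma exists_localization [NeZero n] (hg : ContDiffOn ℝ 2 g Ω)
    (hgs : ∀ x ∈ Ω, ∀ a b, g x a b = g x b a) :
    ∃ (f : Fin (n + 1) → E n → ℝ) (g' : Fin n → Fin n → E n → ℝ),
      (∀ A, ContDiff ℝ 2 (f A)) ∧ (∀ A, HasCompactSupport (f A)) ∧
      (∀ A, Set.EqOn (f A) (fun x => d.u x A) (thickening (d.η / 2) d.V)) ∧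
      (∀ a b, ContDiff ℝ 2 (g' a b)) ∧ (∀ a b x, g' a b x = g' b a x) ∧
      ∀ a b, Set.EqOn (g' a b) (fun x => g x a b) (thickening (d.η / 2) d.V) := by
  choose f hf1 hf2 hf3 using fun A => exists_compactly_supported_extension d.η_pos d.isOpen_U
    d.bounded_U d.thickening_subset (d.contDiffOn_component A)
  choose g' hg1 hg2 hg3 using fun a b => exists_compactly_supported_extension d.η_pos d.isOpen_U
    d.bounded_U d.thickening_subset
    (((entryCLM a b).contDiff.comp_contDiffOn hg).mono d.U_subset)
  refine ⟨f, fun a b => if a ≤ b then g' a b else g' b a, hf1, hf2, hf3, fun a b => ?_,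
    fun a b x => ?_, fun a b x hx => ?_⟩
  · dsimp only
    split_ifs
    exacts [hg1 a b, hg1 b a]
  · rcases lt_trichotomy a b with h | rfl | h
    · simp [h.le, h.not_ge]
    · rfl
    · simp [h.le, h.not_ge]
  · have hxΩ := d.U_subset (d.half_thickening_subset hx)
    dsimp only
    split_ifs
    · exact hg3 a b hx
    · exact (hg3 b a hx).trans (hgs x hxΩ b a)

end StageData

/-- The family of all stage data. -/
lemma exists_stageFamily [NeZero n] {Ω : Set (E n)} (hΩo : IsOpen Ω)
    (hΩb : Bornology.IsBounded Ω) {g : E n → Matrix (Fin n) (Fin n) ℝ}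
    (hg : CkClosure 2 g Ω) (hgpos : ∀ x ∈ closure Ω, (g x).PosDef) :
    ∃ S : StageFamily (StageData Ω g) n, S.l = StageData.filter Ω g ∧
      (∀ d, S.D d = thickening (d.η / 4) d.V) ∧ (∀ d, S.s d = Real.sqrt d.δ) ∧
      (∀ d, S.ℓ d = S.c₀ * d.η / d.lam) ∧ (∀ d, S.d d = d.δ') ∧
      n ^ 3 * S.K * S.c₀ ^ 2 ≤ 1 ∧
      (∀ A d, Set.EqOn (S.f A d) (fun x => d.u x A) (thickening (d.η / 2) d.V)) ∧
      ∀ a b d, Set.EqOn (S.g a b d) (fun x => g x a b) (thickening (d.η / 2) d.V) := by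
  have hgs : ∀ x ∈ Ω, ∀ a b, g x a b = g x b a := fun x hx a b => by
    simpa using (hgpos x (subset_closure hx)).isHermitian.apply b a
  obtain ⟨K, hK, hKg⟩ := exists_bound_entries hΩo hΩb hg
  obtain ⟨ε, hε, c, hc, hdet⟩ := exists_det_lower_bound hΩb.isCompact_closure hg.2.1 hgpos
  choose f g' hf1 hf2 hf3 hg1 hg2 hg3 using fun d : StageData Ω g =>
    d.exists_localization hg.1 hgs
  have hn : (0 : ℝ) ≤ n := Nat.cast_nonneg n
  -- One choice serves two purposes: c₀ ≤ 1/(4(n + 2)²) keeps the commutator small, and the factor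
  -- 1/(K + 1) makes the mollification error of g at most λ⁻², with coefficient one.
  set c₀ : ℝ := 1 / (4 * (n + 2) ^ 2 * (K + 1)) with hc₀
  have hc0 : 0 < c₀ := by positivity
  have hc1 : c₀ ≤ 1 / (4 * (n + 2) ^ 2) := by
    refine one_div_le_one_div_of_le (by positivity) ?_
    exact le_mul_of_one_le_right (by positivity) (by linarith)
  have hc4 : c₀ ≤ 1 / 4 := hc1.trans (one_div_le_one_div_of_le (by norm_num) (by nlinarith))
  -- As c₀ ≤ 1/4 and λ ≥ 1, the scale ℓ is at most η/4. Mollifying on the η/4-neighbourhood of V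
  -- therefore uses values only from the η/2-neighbourhood, where the extensions agree with u and g.
  have hN : ∀ (d : StageData Ω g), ∀ x ∈ thickening (d.η / 4) d.V, ∀ z,
      ‖z - x‖ ≤ c₀ * d.η / d.lam → z ∈ thickening (d.η / 2) d.V := fun d x hx z hz => by
    obtain ⟨v, hv, hxv⟩ := mem_thickening_iff.1 hx
    refine mem_thickening_iff.2 ⟨v, hv, (dist_triangle z x v).trans_lt ?_⟩
    have h1 : c₀ * d.η / d.lam ≤ 1 / 4 * d.η :=
      (div_le_self (mul_pos hc0 d.η_pos).le d.one_le_lam).trans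
        (mul_le_mul_of_nonneg_right hc4 d.η_pos.le)
    rw [dist_eq_norm z x]
    linarith
  have hU : ∀ (d : StageData Ω g), ∀ x ∈ thickening (d.η / 4) d.V, ∀ z,
      ‖z - x‖ ≤ c₀ * d.η / d.lam → z ∈ d.U := fun d x hx z hz =>
    d.half_thickening_subset (hN d x hx z hz)
  have pdf : ∀ (d : StageData Ω g) A a,
      Set.EqOn (pd a (f d A)) (pd a fun y => d.u y A) (thickening (d.η / 2) d.V) :=
    fun d A a x hx => pd_congr a isOpen_thickening (hf3 d A) hx
  have ppf : ∀ (d : StageData Ω g) A a b, Set.EqOn (pd a (pd b (f d A)))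
      (pd a (pd b fun y => d.u y A)) (thickening (d.η / 2) d.V) :=
    fun d A a b x hx => pd_congr a isOpen_thickening (pdf d A b) hx
  have ppg : ∀ (d : StageData Ω g) a b a' b', Set.EqOn (pd a' (pd b' (g' d a b)))
      (pd a' (pd b' fun y => g y a b)) (thickening (d.η / 2) d.V) :=
    fun d a b a' b' x hx => pd_congr a' isOpen_thickening
      (fun y hy => pd_congr b' isOpen_thickening (hg3 d a b) hy) hx
  refine ⟨{ l := StageData.filter Ω g
            D := fun d => thickening (d.η / 4) d.V
            isOpen := fun d => isOpen_thickening
            s := fun d => Real.sqrt d.δ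
            ℓ := fun d => c₀ * d.η / d.lam
            lam := fun d => d.lam
            r := fun d => d.r
            d := fun d => d.δ'
            c₀ := c₀
            K := K + 1
            ε := ε
            c := c
            f := fun A d => f d A
            g := fun a b d => g' d a b
            s_pos := fun d => d.sqrt_pos
            s_le := fun d => d.sqrt_le_one
            s_tendsto := StageData.tendsto_sqrt
            ℓ_pos := fun d => div_pos (mul_pos hc0 d.η_pos) (one_pos.trans_le d.one_le_lam)
            c₀_pos := hc0
            c₀_le := hc1
            K_nonneg := by linarith
            ε_pos := hε
            c_pos := hc
            r_le := fun d => d.r_le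
            one_le := fun d => d.one_le_mul
            ℓ_mul_le := fun d => by
              rw [div_mul_cancel₀ _ (one_pos.trans_le d.one_le_lam).ne']
              exact mul_le_of_le_one_right hc0.le d.η_le_one
            abs_d_le := fun d => by
              rw [Real.sq_sqrt d.δ_pos.le]
              exact d.abs_δ'_le
            contDiff_f := fun A d => hf1 d A
            compact_f := fun A d => hf2 d A
            contDiff_g := fun a b d => hg1 d a b
            g_symm := fun a b d => hg2 d a b
            -- The C² bound on u depends on λ, so the bound on first derivatives comes from the
            -- metric: |∂_a u|² = g_aa − δ h₀_aa − error ≤ K + 1 ≤ (K + 1)².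
            pd_f_le := fun d x hx z hz A a => by
              rw [pdf d A a (hN d x hx z hz)]
              have hzU := hU d x hx z hz
              have h1 := (abs_le.1 (d.abs_metric_sub_le hzU a a)).1
              have h2 := (abs_le.1 (hKg z (d.U_subset hzU) a a).1).2
              have h3 := Finset.single_le_sum (f := fun A => pd a (fun y => d.u y A) z *
                pd a (fun y => d.u y A) z) (fun A _ => mul_self_nonneg _) (Finset.mem_univ A)
              have h4 : 0 ≤ d.δ * h0 n a a := by
                rw [h0_apply, if_pos rfl]
                exact mul_nonneg d.δ_pos.le (by positivity)
              have h5 : d.r * d.δ ≤ 1 := by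
                refine mul_le_one₀ (d.r_le.trans ?_) d.δ_pos.le d.δ_le
                exact (div_le_one (by positivity)).2 (by linarith)
              dsimp only at h3
              refine abs_le_of_sq_le_sq ?_ (by linarith)
              nlinarith
            pd_pd_f_le := fun d x hx z hz A a b => by
              rw [ppf d A a b (hN d x hx z hz)]
              exact (abs_component_le (zero_le_one.trans d.one_le_mul) d.isOpen_U d.regular_u.1
                d.norm_u_le (hU d x hx z hz) A).2.2 a b
            pd_pd_g_le := fun d x hx z hz a b a' b' => by
              rw [ppg d a b a' b' (hN d x hx z hz)]
              exact ((hKg z (d.U_subset (hU d x hx z hz)) a b).2 a' b').trans (by linarith)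
            err_le := fun d x hx z hz a b => by
              have hzN := hN d x hx z hz
              rw [hg3 d a b hzN, Finset.sum_congr rfl fun A _ => by
                rw [pdf d A a hzN, pdf d A b hzN], Real.sq_sqrt d.δ_pos.le]
              exact d.abs_metric_sub_le (hU d x hx z hz) a b
            le_det := fun d x hx M hM => by
              have hx2 : x ∈ thickening (d.η / 2) d.V :=
                thickening_mono (by linarith [d.η_pos]) _ hx
              refine hdet x (subset_closure (d.U_subset (d.half_thickening_subset hx2))) M
                fun a b => ?_
              have := hM a b
              rwa [hg3 d a b hx2] at this }, rfl, fun _ => rfl, fun _ => rfl, fun _ => rfl,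
    fun _ => rfl, ?_, fun A d => hf3 d A, fun a b d => hg3 d a b⟩
  have e : c₀ * (4 * (n + 2) ^ 2 * (K + 1)) = 1 := one_div_mul_cancel (by positivity)
  have e1 : (n : ℝ) ^ 3 * (K + 1) * c₀ ^ 2 = n ^ 3 * c₀ / (4 * (n + 2) ^ 2) := by
    rw [eq_div_iff (by positivity)]
    linear_combination n ^ 3 * c₀ * e
  dsimp only
  rw [e1, div_le_one (by positivity)]
  have e2 : c₀ * (n + 2) ^ 2 ≤ 1 / 4 := by
    rw [le_div_iff₀ (by positivity)] at hc1
    linarith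
  have e3 : (n : ℝ) ^ 3 * c₀ ≤ (n + 2) * (c₀ * (n + 2) ^ 2) := by
    have : (0 : ℝ) ≤ c₀ * ((n + 2) ^ 3 - n ^ 3) := mul_nonneg hc0.le (by ring_nf; positivity)
    linarith
  nlinarith

end NashKuiper

/-! ### Assembly of the stage proposition. -/

theorem proposition3p6 (n : ℕ) (hn : 1 ≤ n) (Ω : Set (E n)) (hΩo : IsOpen Ω)
    (hΩb : Bornology.IsBounded Ω) (g : E n → Matrix (Fin n) (Fin n) ℝ)
    (hg : CkClosure 2 g Ω) (hgpos : ∀ x ∈ closure Ω, (g x).PosDef) (J : ℕ) :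
    ∃ δs > (0 : ℝ), ∃ rs > (0 : ℝ), ∃ cs > (0 : ℝ), ∃ C > (0 : ℝ),
      ∀ (U : Set (E n)) (u : E n → E (n + 1)) (r δ lam : ℝ),
        U ⊆ Ω → IsOpen U → Bornology.IsBounded U → IsSimplyConnected U →
        CkClosure 2 u U → ImmersionOnClosure u U →
        0 < r → 0 < δ → δ ≤ 1 → (Real.sqrt δ)⁻¹ ≤ lam →
        cNorm 0 U (fun x => g x - inducedMetric u x - δ • h0 n) ≤ ENNReal.ofReal (r * δ) →
        cNorm 2 U u ≤ ENNReal.ofReal (Real.sqrt δ * lam) →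
        r ≤ rs → δ ≤ δs →
        ∀ (V : Set (E n)) (δ' Lam : ℝ),
          IsOpen V → IsSimplyConnected V → IsCompact (closure V) → closure V ⊆ U →
          |δ'| < r * δ / ‖h0 n‖ → cs ≤ Lam →
          ∃ v : E n → E (n + 1),
            CkClosure 2 v V ∧ ImmersionOnClosure v V ∧
            cNorm 0 V (fun x => g x - inducedMetric v x - δ' • h0 n) ≤
              ENNReal.ofReal (C * δ * ((Lam ^ J)⁻¹ + Real.sqrt δ) + (lam ^ 2)⁻¹) ∧
            (∀ k : ℕ, k ≤ 1 →
              cNorm k V (fun x => v x - u x) ≤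
                ENNReal.ofReal (C * Real.sqrt δ * lam ^ ((k : ℤ) - 1))) ∧
            cNorm 2 V v ≤
              ENNReal.ofReal (C * Real.sqrt δ * lam * (min 1 (setDist V (frontier U)))⁻¹ *
                Lam ^ (J * (nStar n - n) + n)) := by
  have : NeZero n := ⟨by omega⟩
  obtain ⟨S, hSl, hSD, hSs, hSℓ, hSd, hSc, hSf, hSg⟩ := exists_stageFamily hΩo hΩb hg hgpos
  have hc0 := S.c₀_pos
  have hc1 := S.c₀_le_one
  obtain ⟨w, hw, hwdet, C, hC, hwC⟩ := S.exists_perturbation (Λ := fun d => d.Lam)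
    (fun d => d.one_le_Lam) (hSl ▸ StageData.tendsto_Lam) J
  have hall := (Filter.eventually_all.2 hw).and (hwdet.and hwC)
  rw [hSl] at hall
  obtain ⟨L, T, hLT⟩ := StageData.exists_thresholds hall
  -- δ ≤ (max T 1)⁻¹ gives T ≤ δ⁻¹, and max L 1 also ensures Λ ≥ 1. In the last constant, n + 1
  -- bounds a vector by its components, 2(1 + C) serves orders 0 and 1, and C/c₀ comes from ℓ⁻¹ =
  -- λ/(c₀η).
  refine ⟨(max T 1)⁻¹, by positivity, 1 / (8 * (n + 3)), by positivity, max L 1, by positivity,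
    (n + 1) * (2 * (1 + C) + C / S.c₀), by positivity, ?_⟩
  intro U u r δ lam hUΩ hUo hUb _ hu _ hr hδ hδ1 hlam hmet hun hrs hδs V δ' Lam hVo hVs hVc hVU
    hδ' hLam
  have hVne : V.Nonempty := by
    have : SimplyConnectedSpace V := hVs
    exact Set.nonempty_coe_sort.1 inferInstance
  set d : StageData Ω g := ⟨U, u, r, δ, lam, V, δ', Lam, hUΩ, hUo, hUb, hu, hr, hrs, hδ, hδ1, hlam,
    hmet, hun, hVne, hVc, hVU, hδ', (le_max_right _ _).trans hLam⟩ with hd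
  obtain ⟨hsm, hdet, hest⟩ := hLT d ((le_max_left _ _).trans hLam)
    ((le_max_left _ _).trans ((le_inv_comm₀ hδ (by positivity)).1 hδs))
  rw [hSD] at hsm hdet hest
  have hη := d.η_pos
  have hη1 := d.η_le_one
  have hs := d.sqrt_pos
  have hs1 := d.sqrt_le_one
  have hsl := d.one_le_mul
  have hl1 := d.one_le_lam
  have hl := one_pos.trans_le hl1
  have hΛ := d.one_le_Lam
  have hVD : closure V ⊆ Metric.thickening (d.η / 4) V :=
    Metric.closure_subset_thickening (by positivity) V
  have hDN : Metric.thickening (d.η / 4) V ⊆ Metric.thickening (d.η / 2) V :=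
    Metric.thickening_mono (by linarith) V
  have hDU : Metric.thickening (d.η / 4) V ⊆ U := hDN.trans d.half_thickening_subset
  have hVD' : V ⊆ Metric.thickening (d.η / 4) V := subset_closure.trans hVD
  set v : E n → E (n + 1) := fun x => WithLp.toLp 2 fun A => w A d x with hv
  have hvD : ContDiffOn ℝ 2 v (Metric.thickening (d.η / 4) V) :=
    contDiffOn_euclidean.2 fun A => (hsm A).of_le (WithTop.coe_le_coe.2 le_top)
  have hvd : ∀ x ∈ Metric.thickening (d.η / 4) V, DifferentiableAt ℝ v x := fun x hx =>
    (hvD.contDiffAt (Metric.isOpen_thickening.mem_nhds hx)).differentiableAt (by norm_num)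
  have hmetv : ∀ x ∈ Metric.thickening (d.η / 4) V, ∀ a b,
      inducedMetric v x a b = ∑ A, pd a (w A d) x * pd b (w A d) x := fun x hx a b =>
    inducedMetric_apply a b (hvd x hx)
  have hpdf : ∀ x ∈ Metric.thickening (d.η / 4) V, ∀ A a,
      pd a (S.f A d) x = pd a (fun y => u y A) x := fun x hx A a =>
    pd_congr a Metric.isOpen_thickening (hSf A d) (hDN hx)
  -- X is the bound claimed for second derivatives. It dominates √δ and √δ λ, hence also the lower
  -- order parts of the C² norm of v.
  set X := Real.sqrt δ * lam * d.η⁻¹ * Lam ^ (J * (nStar n - n) + n) with hX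
  have hΛq : 1 ≤ Lam ^ (J * (nStar n - n) + n) := one_le_pow₀ hΛ
  have hX1 : Real.sqrt δ * lam ≤ X := by
    rw [hX, mul_assoc]
    exact le_mul_of_one_le_right (by positivity)
      (one_le_mul_of_one_le_of_one_le ((one_le_inv₀ hη).2 hη1) hΛq)
  have hsX : Real.sqrt δ ≤ X := le_trans (le_mul_of_one_le_right hs.le hl1) hX1
  have hX0 : 0 ≤ X := hs.le.trans hsX
  have hℓ : S.ℓ d ≤ lam⁻¹ := by
    rw [hSℓ, div_eq_mul_inv]
    exact mul_le_of_le_one_left (inv_pos.2 hl).le (mul_le_one₀ hc1 hη.le hη1)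
  have hℓ1 : S.ℓ d ≤ 1 := hℓ.trans (inv_le_one_of_one_le₀ hl1)
  have hcomp : ∀ x ∈ V, ∀ A, |u x A| ≤ Real.sqrt δ * lam ∧
      ∀ a, |pd a (fun y => u y A) x| ≤ Real.sqrt δ * lam := fun x hx A =>
    have h := abs_component_le (by positivity) hUo hu.1 hun (hDU (hVD' hx)) A
    ⟨h.1, h.2.1⟩
  have b0 : ∀ x ∈ V, ∀ A, |w A d x - u x A| ≤ C * (Real.sqrt δ * lam⁻¹) := fun x hx A => by
    have h := ((hest x (hVD' hx)).2 A).1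
    rw [hSf A d (hDN (hVD' hx)), hSs] at h
    exact h.trans (mul_le_mul_of_nonneg_left (mul_le_mul_of_nonneg_left hℓ hs.le) hC)
  have b1 : ∀ x ∈ V, ∀ A a, |pd a (w A d) x - pd a (fun y => u y A) x| ≤ C * Real.sqrt δ :=
    fun x hx A a => by
      have h := ((hest x (hVD' hx)).2 A).2.1 a
      rwa [hpdf x (hVD' hx), hSs] at h
  have hub : ∀ x ∈ V, DifferentiableAt ℝ u x := fun x hx => d.differentiableAt_u (hDU (hVD' hx))
  have hc : ∀ x ∈ V, DifferentiableAt ℝ (fun y => v y - u y) x := fun x hx =>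
    (hvd x (hVD' hx)).sub (hub x hx)
  have bd1 : ∀ x ∈ V, ∀ A a, |pd a (fun y => (v y - u y) A) x| ≤ C * Real.sqrt δ :=
    fun x hx A a => by
      have e := pd_sub (f := fun y => v y A) (g := fun y => u y A) a
        ((differentiableAt_euclidean.1 (hvd x (hVD' hx))) A)
        ((differentiableAt_euclidean.1 (hub x hx)) A)
      exact (congrArg abs e).le.trans (b1 x hx A a)
  refine ⟨v, .of_contDiffOn Metric.isOpen_thickening hvD hVD,
    .of_det_ne_zero Metric.isOpen_thickening hvD hVD fun x hx => ?_, ?_, fun k hk => ?_, ?_⟩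
  · have e : inducedMetric v x = Matrix.of fun a b => ∑ A, pd a (w A d) x * pd b (w A d) x := by
      ext a b
      exact hmetv x hx a b
    rw [e]
    exact (S.c_pos.trans_le (hdet x hx)).ne'
  · have hJ : 0 ≤ (Lam ^ J)⁻¹ := by positivity
    have hX' : 0 ≤ δ * ((Lam ^ J)⁻¹ + Real.sqrt δ) := by positivity
    refine cNorm_zero_le (by positivity) fun x hx => ?_
    have hb : ∀ a b, |(g x - inducedMetric v x - δ' • h0 n) a b| ≤
        C * (δ * ((Lam ^ J)⁻¹ + Real.sqrt δ)) + n ^ 2 * S.K * S.ℓ d ^ 2 := fun a b => by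
      have h := (hest x (hVD' hx)).1 a b
      rw [hSg a b d (hDN (hVD' hx)), hSs, hSd, Real.sq_sqrt hδ.le, ← hmetv x (hVD' hx)] at h
      exact h
    have hK := S.K_nonneg
    refine (norm_le_of_abs_entry_le hb (by positivity)).trans ?_
    -- The extra factor n passes from entries to the Frobenius norm, which is why c₀ was chosen with
    -- n³ K c₀² ≤ 1.
    have h1 : n * (n ^ 2 * S.K * S.ℓ d ^ 2) ≤ (lam ^ 2)⁻¹ := by
      have hη2 : d.η ^ 2 ≤ 1 := pow_le_one₀ hη.le hη1
      have hl2 : 0 ≤ (lam ^ 2)⁻¹ := by positivity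
      have e : n * (n ^ 2 * S.K * S.ℓ d ^ 2) =
          n ^ 3 * S.K * S.c₀ ^ 2 * d.η ^ 2 * (lam ^ 2)⁻¹ := by
        rw [hSℓ]
        simp only [hd]
        field_simp
      rw [e]
      exact mul_le_of_le_one_left hl2 (mul_le_one₀ hSc (by positivity) hη2)
    have h2 : n * C ≤ (n + 1) * (2 * (1 + C) + C / S.c₀) := by
      have : 0 ≤ C / S.c₀ := by positivity
      have hn0 : (0 : ℝ) ≤ n := Nat.cast_nonneg n
      nlinarith [mul_nonneg hn0 hC, mul_nonneg hn0 this]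
    have h3 := mul_le_mul_of_nonneg_right h2 hX'
    linarith
  · have hC2 : (n + 1) * (C + C) ≤ (n + 1) * (2 * (1 + C) + C / S.c₀) := by
      have : 0 ≤ C / S.c₀ := by positivity
      exact mul_le_mul_of_nonneg_left (by linarith) (by positivity)
    have hC1 : (n + 1) * C ≤ (n + 1) * (2 * (1 + C) + C / S.c₀) :=
      le_trans (mul_le_mul_of_nonneg_left (by linarith) (by positivity)) hC2
    interval_cases k
    · refine cNorm_zero_le (by positivity) fun x hx => ?_
      refine (norm_le_of_abs_le (K := C * (Real.sqrt δ * lam⁻¹)) fun A => b0 x hx A).trans ?_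
      have := mul_le_mul_of_nonneg_right hC1 (mul_pos hs (inv_pos.2 hl)).le
      simp only [Nat.cast_add, Nat.cast_one, Nat.cast_zero, zero_sub, zpow_neg_one]
      linarith
    · refine (cNorm_one_le (K₀ := C * Real.sqrt δ) (by positivity) (by positivity) hc
        (fun x hx A => (b0 x hx A).trans ?_) bd1).trans (ENNReal.ofReal_le_ofReal ?_)
      · exact mul_le_mul_of_nonneg_left
          (mul_le_of_le_one_right hs.le (inv_le_one_of_one_le₀ hl1)) hC
      · have := mul_le_mul_of_nonneg_right hC2 hs.le
        simp only [Nat.cast_add, Nat.cast_one, sub_self, zpow_zero, mul_one]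
        linarith
  · have hCs := mul_le_mul_of_nonneg_left hsX hC
    refine (cNorm_two_le (K₀ := (1 + C) * X) (K₁ := (1 + C) * X) (K₂ := C / S.c₀ * X) (by positivity)
      (by positivity) (by positivity) hVo (hvD.mono hVD') (fun x hx A => ?_)
      (fun x hx A a => ?_) fun x hx A a b => ?_).trans (ENNReal.ofReal_le_ofReal (le_of_eq ?_))
    · have h1 := b0 x hx A
      have h2 := (hcomp x hx A).1
      have h3 : C * (Real.sqrt δ * lam⁻¹) ≤ C * Real.sqrt δ := mul_le_mul_of_nonneg_left
        (mul_le_of_le_one_right hs.le (inv_le_one_of_one_le₀ hl1)) hC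
      change |w A d x| ≤ _
      rw [abs_le] at h1 h2 ⊢
      constructor <;> linarith [h1.1, h1.2, h2.1, h2.2]
    · have h1 := b1 x hx A a
      have h2 := (hcomp x hx A).2 a
      change |pd a (w A d) x| ≤ _
      rw [abs_le] at h1 h2 ⊢
      constructor <;> linarith [h1.1, h1.2, h2.1, h2.2]
    · refine (((hest x (hVD' hx)).2 A).2.2 a b).trans (le_of_eq ?_)
      rw [hSs, hSℓ, hX]
      simp only [hd]
      field_simp
    · have e : min 1 (setDist V (frontier U)) = d.η := rfl
      rw [e, hX]
      push_cast
      ring
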